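/- **Setting.** Fix $\ell\ge 0$ and multiplicities $k_1,\dots,k_p\ge 1$. Let $\mathcal D$ be an open subset of the space of parameters $d=(\lambda_i,t_i)_{1\le i\le p}$, where the $\lambda_i\in\mathbb C$ are distinct and $t_i=\mathrm{diag}(t_{i1},\dots,t_{i\ell})$ with $t_{ij}$ a polynomial of degree at most $k_i-2$ in $x_i=x-\lambda_i$ ($t_i=0$ if $k_i=1$); the $\lambda_i$ and the coefficients of the $t_{ij}$ are coordinates on $\mathcal D$ (the deformation manifold). Let $A=Q/q$, $q=\prod_i(x-\lambda_i)^{k_i}$, be a family of $\ell\times\ell$ systems $dy/dx=Ay$ in which $Q$ is polynomial in $x$, $\deg Q\le\deg q-2$, with coefficients holomorphic on $\mathcal D$, and $$A=g_i\,\frac{d}{dx_i}\bigl(x_i^{1-k_i}t_i+m_i\log x_i\bigr)g_i^{-1}+O(1)\quad\text{at }\lambda_i,$$ with $m_i$ a constant diagonal matrix and $g_i$ an invertible matrix of power series in $x_i$. (Every solution of the isomonodromic deformation problem, in a trivialization with $\Omega|_{x=\infty}=0$, is such a family; flatness is not needed.) Put $$\Omega=\sum_i\bigl(A\,d\lambda_i-x_i^{1-k_i}g_i\,dt_i\,g_i^{-1}\bigr)_{i,-},$$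 where $(\ )_{i,-}$ is the negative part of the Laurent expansion at $\lambda_i$ and $dt_i$ is taken with $x_i$ fixed. Let $V\to\mathcal D$ be the bundle with fibre the $\mathbb C^\ell$-valued germs at $\lambda_1,\dots,\lambda_p$ modulo $x_i^{k_i}$ at $\lambda_i$, let $a\in\mathrm{End}(V)$ be multiplication by $x$, and let $\alpha$ be the $\mathrm{End}(V)$-valued 1-form given by multiplication by the first $k_i$ Taylor terms of $A^{-1}\Omega$ at each $\lambda_i$. Let $E$ be the Euler vector field, the generator of the rescaling of $x$: $E=\sum_i\lambda_i\partial_{\lambda_i}+\sum_{i,j,s}(k_i-1-s)\,t_{ijs}\,\partial_{t_{ijs}}$, where $t_{ij}=\sum_s t_{ijs}x_i^s$. Let $\mathcal D^\circ\subseteq\mathcal D$ be the set of points at which, for each $i$, the eigenvalues of $Q(\lambda_i)$ are distinct and nonzero. On an open $W\subseteq\mathcal D^\circ$, a *choice of roots* is a family $w_{ij}$ of polynomials in $x_i$, holomorphic in $d\in W$, where $w_{ij}$ is the truncation to degree at most $k_i-1$ of $x_i\,t_{ij}^{-1/(k_i-1)}$ for some choice of the root ($w_{ij}=0$ if $k_i=1$).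 A *choice of eigenvectors* is a family $\varepsilon_{ij}$ of $\mathbb C^\ell$-valued germs at $\lambda_i$ modulo $x_i^{k_i}$, holomorphic in $d\in W$ and nonzero at $\lambda_i$, with $\varepsilon_{ij}$ an eigenvector of $Q$ modulo $x_i^{k_i}$ for the $j$-th eigenvalue, i.e. $A\varepsilon_{ij}=\frac{d}{dx_i}\bigl(x_i^{1-k_i}t_{ij}+m_{ij}\log x_i\bigr)\varepsilon_{ij}+O(1)$. **Proposition.** Each $d_0\in\mathcal D^\circ$ has an open neighbourhood $W\subseteq\mathcal D^\circ$ on which a choice of roots and a choice of eigenvectors exist. Moreover, on every open $W\subseteq\mathcal D^\circ$: 1. For every choice $w$ of roots and $\varepsilon$ of eigenvectors, the $w_{ij}^s\varepsilon_{ij}$ ($1\le i\le p$, $1\le j\le\ell$, $0\le s\le k_i-1$) form a holomorphic frame for $V$. In it the matrix of $\alpha$ is holomorphic and satisfies $d\alpha=0$ and $\alpha=da$, and $E(a)=a$; also $i_E\alpha=a$. The matrix of $a$ is block diagonal with blocks labelled by $(i,j)$, the block $(i,j)$ having $\lambda_i$ on the diagonal and a constant entry $a_{ijn}$ along the $n$-th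 subdiagonal, $1\le n\le k_i-1$. 2. The functions $\lambda_i,a_{ijn}$ can be taken to depend only on $w$, and they are holomorphic local coordinates near each point of $W$. 3. Given one choice $\varepsilon$ of eigenvectors, the others are exactly the $c_{ij}\varepsilon_{ij}$ with $c_{ij}$ polynomial in $x_i$, holomorphic in $d\in W$, and nonzero at $\lambda_i$. For a given $w$, the matrices of $a$ and of $\alpha$ are the same in the frames obtained from all choices of eigenvectors. 4. If $W$ is connected, any two choices of roots are related by $w'_{ij}=\zeta_{ij}w_{ij}$ with constants $\zeta_{ij}$, $\zeta_{ij}^{k_i-1}=1$. -/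

import Mathlib

open scoped Polynomial PowerSeries

noncomputable section

namespace Isomonodromy

/-- Local coordinates on the deformation manifold: the positions `λ i` of the poles and, for every
pole and every `j`, the coefficients of the `j`-th diagonal entry of `t i`, a polynomial of degree
at most `k i - 2` (no coefficient at all if `k i = 1`).  The dimension is
`∑ i, (ℓ * (k i - 1) + 1)`.  The same space serves for points and for tangent vectors. -/
abbrev Params (p ℓ : ℕ) (k : Fin p → ℕ) : Type :=
  (Fin p → ℂ) × ((i : Fin p) → Fin ℓ → Fin (k i - 1) → ℂ)

/-- The field of formal Laurent series in the local variable `x_i = x - λ_i`. -/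
abbrev Loc : Type := LaurentSeries ℂ

variable {p ℓ : ℕ} {k : Fin p → ℕ}

/-- The `j`-th diagonal entry of `t_i`, as a linear function of the parameters. -/
def tPoly (i : Fin p) (j : Fin ℓ) : Params p ℓ k →ₗ[ℂ] ℂ[X] :=
  ∑ s : Fin (k i - 1),
    (Polynomial.monomial (s : ℕ)) ∘ₗ (LinearMap.proj s : (Fin (k i - 1) → ℂ) →ₗ[ℂ] ℂ) ∘ₗ
      (LinearMap.proj j : (Fin ℓ → Fin (k i - 1) → ℂ) →ₗ[ℂ] _) ∘ₗ
      (LinearMap.proj i : ((i : Fin p) → Fin ℓ → Fin (k i - 1) → ℂ) →ₗ[ℂ] _) ∘ₗ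
      LinearMap.snd ℂ _ _

/-- A polynomial in `x_i` as a Laurent series. -/
def polyLoc : ℂ[X] →+* Loc :=
  (HahnSeries.ofPowerSeries ℤ ℂ).comp Polynomial.coeToPowerSeries.ringHom

/-- A constant as a Laurent series. -/
def constLoc : ℂ →+* Loc := HahnSeries.C

/-- The function `x` near the pole `λ_i`, that is `λ_i + x_i`. -/
def xLoc (d : Params p ℓ k) (i : Fin p) : Loc :=
  constLoc (d.1 i) + HahnSeries.single (1 : ℤ) (1 : ℂ)

/-- `A(y) = Q(y) / q(y)` with `q(x) = ∏ i, (x - λ_i) ^ k_i`, at an element `y` of any extension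
field `κ : ℂ → L` of `ℂ`.  For `y : ℂ` this is the value of `A`; for `y = xLoc d i` it is the
Laurent expansion of `A` at the pole `λ_i`. -/
def coeffMatrix {L : Type} [Field L] (κ : ℂ →+* L) (Q : Matrix (Fin ℓ) (Fin ℓ) ℂ[X])
    (d : Params p ℓ k) (y : L) : Matrix (Fin ℓ) (Fin ℓ) L :=
  (∏ i, (y - κ (d.1 i)) ^ k i)⁻¹ • Q.map (Polynomial.eval₂ κ y)

/-- The matrix `c A - u G D G⁻¹`, `D` being diagonal. -/
def subConj {L : Type} [Field L] (c u : L) (A G : Matrix (Fin ℓ) (Fin ℓ) L) (D : Fin ℓ → L) :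
    Matrix (Fin ℓ) (Fin ℓ) L :=
  c • A - u • (G * Matrix.diagonal D * G⁻¹)

theorem subConj_add {L : Type} [Field L] (c c' u : L) (A G : Matrix (Fin ℓ) (Fin ℓ) L)
    (D D' : Fin ℓ → L) :
    subConj (c + c') u A G (D + D') = subConj c u A G D + subConj c' u A G D' := by
  unfold subConj
  rw [show Matrix.diagonal (D + D') = Matrix.diagonal D + Matrix.diagonal D' from
    (Matrix.diagonal_add D D').symm, mul_add, add_mul, add_smul, smul_add]
  abel

theorem subConj_smul {L : Type} [Field L] (b c u : L) (A G : Matrix (Fin ℓ) (Fin ℓ) L)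
    (D : Fin ℓ → L) :
    subConj (b * c) u A G (b • D) = b • subConj c u A G D := by
  unfold subConj
  rw [Matrix.diagonal_smul, mul_smul_comm, smul_mul_assoc, mul_smul, smul_comm u b, smul_sub]

theorem mul_smul_apply {L : Type} [Field L] (b : L) (M N : Matrix (Fin ℓ) (Fin ℓ) L)
    (r s : Fin ℓ) : (M * b • N) r s = b * (M * N) r s := by
  rw [mul_smul_comm, Matrix.smul_apply, smul_eq_mul]

/-- The `j`-th diagonal entry of `d/dx_i (x_i ^ (1 - k_i) * t_i(x_i) + m_i * log x_i)`. -/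
def formalEigenvalue (m : Fin p → Fin ℓ → ℂ) (d : Params p ℓ k) (i : Fin p) (j : Fin ℓ) : Loc :=
  LaurentSeries.derivative ℂ (HahnSeries.single (1 - (k i : ℤ)) (1 : ℂ) * polyLoc (tPoly i j d)) +
    HahnSeries.single (-1 : ℤ) (m i j)

/-- A Laurent series is `O(1)`: it has no negative terms. -/
def IsHol (f : Loc) : Prop := ∀ n : ℤ, n < 0 → f.coeff n = 0

/-- A matrix of power series, as a matrix of Laurent series. -/
def seriesLoc (g : Matrix (Fin ℓ) (Fin ℓ) ℂ⟦X⟧) : Matrix (Fin ℓ) (Fin ℓ) Loc :=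
  g.map (HahnSeries.ofPowerSeries ℤ ℂ)

/-- A holomorphic family of linear systems `dy/dx = A y`, `A = Q / q`, over an open set `dom` of the
parameter space, in which the singular part of `A` at the poles is the one given by the parameters:
`A = g_i * d/dx_i (x_i ^ (1 - k_i) * t_i + m_i * log x_i) * g_i⁻¹ + O(1)` at `λ_i`, the exponents
of formal monodromy `m_i` being constant.  The bundle `E` is trivialized.  The solutions
of the isomonodromic deformation problem are such families; the zero curvature
equations that single them out are not imposed. -/
structure SystemFamily (p ℓ : ℕ) (k : Fin p → ℕ) where
  dom : Set (Params p ℓ k)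
  isOpen_dom : IsOpen dom
  poles_distinct : ∀ d ∈ dom, Function.Injective d.1
  Q : Params p ℓ k → Matrix (Fin ℓ) (Fin ℓ) ℂ[X]
  /-- There is no singularity at infinity: `deg Q ≤ deg q - 2`. -/
  degree_Q : ∀ d ∈ dom, ∀ r s, (Q d r s).degree + 2 ≤ ((∑ i, k i : ℕ) : WithBot ℕ)
  holomorphic_Q : ∀ r s n, DifferentiableOn ℂ (fun d => (Q d r s).coeff n) dom
  m : Fin p → Fin ℓ → ℂ
  g : Params p ℓ k → Fin p → Matrix (Fin ℓ) (Fin ℓ) ℂ⟦X⟧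
  isUnit_g : ∀ d ∈ dom, ∀ i, IsUnit (g d i)
  singularPart : ∀ d ∈ dom, ∀ i r s,
    IsHol ((coeffMatrix constLoc (Q d) d (xLoc d i) -
      seriesLoc (g d i) * Matrix.diagonal (formalEigenvalue m d i) * (seriesLoc (g d i))⁻¹) r s)

namespace SystemFamily

variable (F : SystemFamily p ℓ k)

/-- The points at which, for each `i`, the eigenvalues of `Q(λ_i)` are distinct and nonzero. -/
def regularPoints : Set (Params p ℓ k) :=
  {d | d ∈ F.dom ∧ ∀ i, ((F.Q d).map (Polynomial.eval (d.1 i))).charpoly.roots.Nodup ∧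
    (0 : ℂ) ∉ ((F.Q d).map (Polynomial.eval (d.1 i))).charpoly.roots}

/-- The Laurent expansion of `A` at `λ_i`. -/
def locA (d : Params p ℓ k) (i : Fin p) : Matrix (Fin ℓ) (Fin ℓ) Loc :=
  coeffMatrix constLoc (F.Q d) d (xLoc d i)

/-- The contraction with the tangent vector `X` of
`A dλ_i - x_i ^ (1 - k_i) * g_i * dt_i * g_i⁻¹` at `λ_i` (here `d` is taken with `x_i` fixed). -/
def variation (d X : Params p ℓ k) (i : Fin p) : Matrix (Fin ℓ) (Fin ℓ) Loc :=
  subConj (constLoc (X.1 i)) (HahnSeries.single (1 - (k i : ℤ)) (1 : ℂ)) (F.locA d i)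
    (seriesLoc (F.g d i)) (fun j => polyLoc (tPoly i j X))

/-- The 1-form `Ω = ∑ i, (A dλ_i - x_i ^ (1 - k_i) * g_i * dt_i * g_i⁻¹)_{i,-}`, contracted with
the tangent vector `X`, at an element `y` of an extension field `κ : ℂ → L` of `ℂ`; the subscript
denotes the negative part of the Laurent expansion at `λ_i`, which has a pole of order at
most `k_i`. -/
def Omega {L : Type} [Field L] (κ : ℂ →+* L) (d X : Params p ℓ k) (y : L) :
    Matrix (Fin ℓ) (Fin ℓ) L :=
  Matrix.of fun r s => ∑ i, ∑ n ∈ Finset.Icc 1 (k i),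
    κ ((F.variation d X i r s).coeff (-(n : ℤ))) * ((y - κ (d.1 i)) ^ n)⁻¹

/-- The coefficient of `x_i ^ n` in the expansion of `A⁻¹ * Ω_X` at `λ_i`. -/
def alphaCoeff (d X : Params p ℓ k) (i : Fin p) (n : ℕ) : Matrix (Fin ℓ) (Fin ℓ) ℂ :=
  ((F.locA d i)⁻¹ * F.Omega constLoc d X (xLoc d i)).map (fun f => f.coeff (n : ℤ))

theorem variation_add (d X Y : Params p ℓ k) (i : Fin p) :
    F.variation d (X + Y) i = F.variation d X i + F.variation d Y i := by
  unfold variation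
  rw [← subConj_add]
  congr 1
  · simp
  · funext j; simp

theorem tPoly_smul (c : ℂ) (X : Params p ℓ k) (i : Fin p) (j : Fin ℓ) :
    polyLoc (tPoly i j (c • X)) = constLoc c * polyLoc (tPoly i j X) := by
  have h : polyLoc (Polynomial.C c) = constLoc c := by simp [polyLoc, constLoc]
  rw [map_smul, Polynomial.smul_eq_C_mul, map_mul, h]

theorem variation_smul (c : ℂ) (d X : Params p ℓ k) (i : Fin p) :
    F.variation d (c • X) i = constLoc c • F.variation d X i := by
  unfold variation
  refine Eq.trans ?_ (subConj_smul (constLoc c) _ _ _ _ _)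
  congr 1
  · simp
  · funext j; exact tPoly_smul c X i j

theorem coeff_constLoc_mul (c : ℂ) (f : Loc) (n : ℤ) :
    (constLoc c * f).coeff n = c * f.coeff n := by
  simp [constLoc]

theorem Omega_add {L : Type} [Field L] (κ : ℂ →+* L) (d X Y : Params p ℓ k) (y : L) :
    F.Omega κ d (X + Y) y = F.Omega κ d X y + F.Omega κ d Y y := by
  ext r s
  simp [Omega, variation_add, add_mul, Finset.sum_add_distrib]

theorem Omega_smul {L : Type} [Field L] (κ : ℂ →+* L) (c : ℂ) (d X : Params p ℓ k) (y : L) :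
    F.Omega κ d (c • X) y = κ c • F.Omega κ d X y := by
  ext r s
  simp [Omega, variation_smul, coeff_constLoc_mul, mul_assoc, Finset.mul_sum]

theorem alphaCoeff_add (d X Y : Params p ℓ k) (i : Fin p) :
    F.alphaCoeff d (X + Y) i = F.alphaCoeff d X i + F.alphaCoeff d Y i := by
  funext n
  ext r s
  simp [alphaCoeff, Omega_add, mul_add]

theorem alphaCoeff_smul (c : ℂ) (d X : Params p ℓ k) (i : Fin p) :
    F.alphaCoeff d (c • X) i = c • F.alphaCoeff d X i := by
  funext n
  ext r s
  have h := mul_smul_apply (constLoc c) (F.locA d i)⁻¹ (F.Omega constLoc d X (xLoc d i)) r s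
  have h' := congrArg (fun f : Loc => f.coeff (n : ℤ)) h
  simp only [alphaCoeff, Omega_smul, Matrix.map_apply, Pi.smul_apply, Matrix.smul_apply,
    smul_eq_mul]
  exact h'.trans (coeff_constLoc_mul c _ _)

end SystemFamily

/-- The fibre of the bundle `V`, in the trivialization given by the trivialization of `E` and
the coordinates `x_i = x - λ_i`: an element `v` has for each `i` a component `v_i`, a polynomial in
`x_i` of degree at most `k_i - 1` with values in `ℂ^ℓ` (a germ at `λ_i` modulo `x_i ^ k_i`), given
by its coefficients `v i s`. -/
abbrev Fibre (p ℓ : ℕ) (k : Fin p → ℕ) : Type := (i : Fin p) → Fin (k i) → Fin ℓ → ℂ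

/-- Multiplication of a vector-valued polynomial by the matrix-valued series `∑ n, h n * x ^ n`,
modulo `x ^ K`. -/
def jetMul (K ℓ : ℕ) : (ℕ → Matrix (Fin ℓ) (Fin ℓ) ℂ) →ₗ[ℂ]
    (Fin K → Fin ℓ → ℂ) →ₗ[ℂ] (Fin K → Fin ℓ → ℂ) :=
  LinearMap.mk₂ ℂ
    (fun h v s => ∑ n : Fin K, if n ≤ s then (h ((s : ℕ) - n)).mulVec (v n) else 0)
    (by
      intro h h' v; funext s
      simp only [Pi.add_apply, ← Finset.sum_add_distrib]
      refine Finset.sum_congr rfl fun n _ => ?_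
      split_ifs <;> simp [Matrix.add_mulVec])
    (by
      intro c h v; funext s
      simp only [Pi.smul_apply, Finset.smul_sum]
      refine Finset.sum_congr rfl fun n _ => ?_
      split_ifs <;> simp [Matrix.smul_mulVec])
    (by
      intro h v v'; funext s
      simp only [Pi.add_apply, ← Finset.sum_add_distrib]
      refine Finset.sum_congr rfl fun n _ => ?_
      split_ifs <;> simp [Matrix.mulVec_add])
    (by
      intro c h v; funext s
      simp only [Pi.smul_apply, Finset.smul_sum]
      refine Finset.sum_congr rfl fun n _ => ?_
      split_ifs <;> simp [Matrix.mulVec_smul])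

/-- Multiplication of a vector-valued polynomial by a scalar polynomial, modulo `x ^ K`. -/
def jetSMul {K ℓ : ℕ} (f : ℂ[X]) (v : Fin K → Fin ℓ → ℂ) : Fin K → Fin ℓ → ℂ :=
  jetMul K ℓ (fun n => f.coeff n • (1 : Matrix (Fin ℓ) (Fin ℓ) ℂ)) v

/-- The endomorphism `a` of `V`, multiplication by `x = λ_i + x_i`. -/
def aEnd (d : Params p ℓ k) : Fibre p ℓ k →ₗ[ℂ] Fibre p ℓ k :=
  LinearMap.pi fun i =>
    jetMul (k i) ℓ
      (fun n => (Polynomial.C (d.1 i) + Polynomial.X).coeff n • (1 : Matrix (Fin ℓ) (Fin ℓ) ℂ)) ∘ₗ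
      LinearMap.proj i

/-- The 1-form `α` with values in the endomorphisms of `V`: `α_X` is multiplication by the first
`k_i` terms of the Taylor expansion of `A⁻¹ * Ω_X` at each `λ_i`. -/
def SystemFamily.alpha (F : SystemFamily p ℓ k) (d : Params p ℓ k) :
    Params p ℓ k →ₗ[ℂ] Fibre p ℓ k →ₗ[ℂ] Fibre p ℓ k :=
  LinearMap.mk₂ ℂ (fun X v i => jetMul (k i) ℓ (F.alphaCoeff d X i) (v i))
    (by intro X Y v; funext i; simp [F.alphaCoeff_add])
    (by intro c X v; funext i; simp [F.alphaCoeff_smul])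
    (by intro X v v'; funext i; simp)
    (by intro c X v; funext i; simp)

/-- Rescaling of the coordinate, `x ↦ c x`: it sends `λ_i` to `c λ_i` and, as it preserves
`x_i ^ (1 - k_i) * t_i(x_i)`, the coefficient of `x_i ^ s` in `t_i` to its multiple by
`c ^ (k_i - 1 - s)`. -/
def dilate (c : ℂ) (d : Params p ℓ k) : Params p ℓ k :=
  (fun i => c * d.1 i, fun i j s => c ^ (k i - 1 - (s : ℕ)) * d.2 i j s)

/-- The Euler vector field, the generator of the flow `x ↦ exp(τ) x`. -/
def eulerField (d : Params p ℓ k) : Params p ℓ k :=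
  deriv (fun τ : ℂ => dilate (Complex.exp τ) d) 0

/-- Indices `(i, (j, s))` of a frame of `V`. -/
abbrev FrameIndex (p ℓ : ℕ) (k : Fin p → ℕ) : Type := (i : Fin p) × (Fin ℓ × Fin (k i))

/-- A frame of `V`: a basis of each fibre. -/
abbrev Frame (p ℓ : ℕ) (k : Fin p → ℕ) : Type :=
  Params p ℓ k → Module.Basis (FrameIndex p ℓ k) ℂ (Fibre p ℓ k)

/-- The matrix of `a` in a frame. -/
def matA (e : Frame p ℓ k) (d : Params p ℓ k) :
    Matrix (FrameIndex p ℓ k) (FrameIndex p ℓ k) ℂ :=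
  LinearMap.toMatrix (e d) (e d) (aEnd d)

/-- The entries of the matrix of `α` in a frame, which are 1-forms on the parameter space. -/
def SystemFamily.matAlpha (F : SystemFamily p ℓ k) (e : Frame p ℓ k) (d : Params p ℓ k)
    (I J : FrameIndex p ℓ k) : Params p ℓ k →L[ℂ] ℂ :=
  LinearMap.toContinuousLinearMap
    ((Matrix.entryLinearMap ℂ ℂ I J) ∘ₗ (LinearMap.toMatrix (e d) (e d)).toLinearMap ∘ₗ F.alpha d)

/-- `w d i j` is the `j`-th diagonal entry of `w_i`, depending holomorphically on `d ∈ W`: it is `0`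
if `k_i = 1`, and otherwise the Taylor expansion of `x_i * t_i ^ (-1 / (k_i - 1))` truncated to
degree at most `k_i - 1`, for some choice of the root. -/
def IsRootBranch (W : Set (Params p ℓ k)) (w : Params p ℓ k → Fin p → Fin ℓ → ℂ[X]) : Prop :=
  ∀ i j, (∀ n, DifferentiableOn ℂ (fun d => (w d i j).coeff n) W) ∧
    ∀ d ∈ W, (k i = 1 → w d i j = 0) ∧
      (2 ≤ k i → ∃ r : ℂ⟦X⟧, r ^ (k i - 1) * (tPoly i j d : ℂ⟦X⟧) = 1 ∧
        w d i j = PowerSeries.trunc (k i) (PowerSeries.X * r))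

/-- `ε d i j` is, near `λ_i` and modulo `x_i ^ k_i`, an eigenvector of `Q` (equivalently, of
`A = Q / q`) for the `j`-th eigenvalue, holomorphic in `x` and in `d ∈ W`, and nonzero at `λ_i`.
The labelling by `j` is that of the diagonal entries of `t_i` and `m_i`: the eigenvalue is
the `j`-th diagonal entry of `d/dx_i (x_i ^ (1 - k_i) * t_i + m_i * log x_i)`, up to `O(1)`. -/
def SystemFamily.IsEigenframe (F : SystemFamily p ℓ k) (W : Set (Params p ℓ k))
    (ε : Params p ℓ k → (i : Fin p) → Fin ℓ → Fin (k i) → Fin ℓ → ℂ) : Prop :=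
  ∀ i j, DifferentiableOn ℂ (fun d => ε d i j) W ∧
    ∀ d ∈ W, (∀ s : Fin (k i), (s : ℕ) = 0 → ε d i j s ≠ 0) ∧
      ∀ r, IsHol (((F.locA d i - Matrix.scalar (Fin ℓ) (formalEigenvalue F.m d i j)).mulVec
        (fun r' => ∑ s : Fin (k i), HahnSeries.single ((s : ℕ) : ℤ) (ε d i j s r'))) r)

/-- The frame `e` is obtained from the eigenvectors `ε i j` by expanding the `j`-th component of
sections near `λ_i` in powers of `w i j`: it consists of the `(w i j) ^ s * ε i j`. -/
def IsPowerFrame (W : Set (Params p ℓ k)) (w : Params p ℓ k → Fin p → Fin ℓ → ℂ[X])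
    (ε : Params p ℓ k → (i : Fin p) → Fin ℓ → Fin (k i) → Fin ℓ → ℂ) (e : Frame p ℓ k) : Prop :=
  ∀ d ∈ W, ∀ (i : Fin p) (j : Fin ℓ) (s : Fin (k i)),
    e d ⟨i, (j, s)⟩ = Pi.single i (jetSMul (w d i j ^ (s : ℕ)) (ε d i j))

/-- The matrix with diagonal blocks labelled by `(i, j)`, with `λ_i` on the diagonal and the entry
`a_{i,j,n}`, `1 ≤ n ≤ k_i - 1`, all along the `n`-th subdiagonal of the block `(i, j)`; here
`c = (λ, a)`, and `a_{i,j,n}` is `c.2 i j ⟨n - 1, _⟩`. -/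
def normalForm (c : Params p ℓ k) : Matrix (FrameIndex p ℓ k) (FrameIndex p ℓ k) ℂ :=
  Matrix.of fun I J =>
    if I.1 = J.1 ∧ (I.2.1 : Fin ℓ) = J.2.1 then
      if h : (J.2.2 : ℕ) < (I.2.2 : ℕ) then
        c.2 I.1 I.2.1 ⟨(I.2.2 : ℕ) - (J.2.2 : ℕ) - 1, by have := I.2.2.isLt; omega⟩
      else if (I.2.2 : ℕ) = (J.2.2 : ℕ) then c.1 I.1 else 0
    else 0

/-- `φ` is a holomorphic local coordinate system near each point of `W`. -/
def IsLocalCoordinates (φ : Params p ℓ k → Params p ℓ k) (W : Set (Params p ℓ k)) : Prop :=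
  DifferentiableOn ℂ φ W ∧
    ∀ d ∈ W, ∃ ψ : OpenPartialHomeomorph (Params p ℓ k) (Params p ℓ k),
      d ∈ ψ.source ∧ ψ.source ⊆ W ∧ Set.EqOn ψ φ ψ.source ∧ DifferentiableOn ℂ ψ.symm ψ.target

/-- A matrix-valued 1-form `ω` on `W` is holomorphic and closed: `dω(X, Y) = 0` for all `X`, `Y`. -/
def IsClosedForm (W : Set (Params p ℓ k))
    (ω : Params p ℓ k → FrameIndex p ℓ k → FrameIndex p ℓ k → (Params p ℓ k →L[ℂ] ℂ)) : Prop :=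
  ∀ I J, DifferentiableOn ℂ (fun d => ω d I J) W ∧
    ∀ d ∈ W, ∀ X Y, fderiv ℂ (fun d' => ω d' I J) d X Y - fderiv ℂ (fun d' => ω d' I J) d Y X = 0

end Isomonodromy

end

open scoped Polynomial PowerSeries

noncomputable section

namespace Isomonodromy

variable {p ℓ : ℕ} {k : Fin p → ℕ}

/-! At a pole write `A = x_i ^ (-k_i) * B` with `B` a matrix of power series (`locB`). The condition
on the singular part says that, modulo `x_i ^ k_i`, `g_i` conjugates `B` to the diagonal matrix of
the series `β_ij = (1 - k_i) t_ij + x_i t_ij' + m_ij x_i ^ (k_i - 1)` (`betaSer`, `jet_locB`). The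
`β_ij(0)` are, up to one nonzero factor for each `i`, the eigenvalues of `Q(λ_i)`. So at regular
points the `β_ij` and their differences are units, and eigenvectors over the ring of jets are unique
up to a factor.

At `λ_i` the form `Ω` differs from `A dλ_i - x_i ^ (1 - k_i) g_i dt_i g_i⁻¹` by `O(1)`, and `A⁻¹`
turns `O(1)` into `O(x_i ^ k_i)`. Hence `α_Y` acts on the `j`-th eigenline as multiplication by the
scalar series `Y(λ_i) - x_i t_ij(Y) / β_ij` (`alphaSer`, `exists_alphaCoeff_eq`), while `a` acts as
`λ_i + x_i`. In the frame `w_ij ^ s ε_ij` the matrix entries are the coefficients of these two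
series in powers of `w_ij` (`toMatrix_frame`). This gives the block shape, and shows that the
entries do not depend on `ε`.

The main computation is `hasDerivAt_wCoeff_X`. Differentiate `x = ∑ a_n w ^ n` in the parameters
with `x` fixed: `∑ (δa_n) w ^ n = -(dx/dw) δw`. Since `w = x t ^ (-1 / (k - 1))`, the right side is
`-x δt / β` modulo `x ^ k`, which is exactly the non-constant part of `α`. Thus `α = da`, and
closedness is the symmetry of second derivatives. If `α_Y` vanishes then `Y(λ_i) = 0` and `t_ij(Y) =
0`, so the `λ_i` and `a_ijn` are coordinates by the inverse function theorem. For the Euler field,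
`t_ij(E) = m_ij x_i ^ (k_i - 1) - β_ij`, whence `i_E α = a`.

Existence of holomorphic choices cannot use `g_i`, which is not assumed holomorphic in `d`.
Eigenvectors come from columns of the adjugate of `B - β_ij`, roots from a branch of the root of
`t_ij(0)` and a linear differential equation in `x_i`. -/

/-! ### Laurent series at a pole. -/

/-- Power series as Laurent series. -/
abbrev toLoc : ℂ⟦X⟧ →+* Loc := HahnSeries.ofPowerSeries ℤ ℂ

theorem toLoc_injective : Function.Injective toLoc := HahnSeries.ofPowerSeries_injective

theorem coeff_toLoc (f : ℂ⟦X⟧) (n : ℕ) : (toLoc f).coeff (n : ℤ) = PowerSeries.coeff n f :=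
  LaurentSeries.coeff_coe_powerSeries f n

theorem isHol_toLoc (h : ℂ⟦X⟧) : IsHol (toLoc h) := by
  intro n hn
  have := PowerSeries.coeff_coe (f := h) n
  rw [if_pos hn] at this
  exact this

theorem isHol_iff {f : Loc} : IsHol f ↔ ∃ h, f = toLoc h := by
  constructor
  · intro hf
    refine ⟨PowerSeries.mk fun n => f.coeff n, ?_⟩
    ext n
    rcases lt_or_ge n 0 with hn | hn
    · rw [hf n hn, isHol_toLoc _ n hn]
    · lift n to ℕ using hn
      rw [coeff_toLoc, PowerSeries.coeff_mk]
  · rintro ⟨h, rfl⟩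
    exact isHol_toLoc h

theorem toLoc_X_pow (K : ℕ) : toLoc PowerSeries.X ^ K = HahnSeries.single (K : ℤ) 1 := by
  rw [← map_pow]
  exact HahnSeries.ofPowerSeries_X_pow K

theorem toLoc_X_ne_zero : toLoc PowerSeries.X ≠ 0 := by
  rw [map_ne_zero_iff _ toLoc_injective]
  exact PowerSeries.X_ne_zero

theorem inv_toLoc_X_pow (K : ℕ) :
    (toLoc PowerSeries.X ^ K)⁻¹ = HahnSeries.single (-(K : ℤ)) 1 := by
  refine inv_eq_of_mul_eq_one_right ?_
  rw [toLoc_X_pow, HahnSeries.single_mul_single]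
  simp

/-- Turns every `O(1)` condition on series with a pole of order `K` into a congruence modulo `x ^
K`. -/
theorem isHol_div_iff {K : ℕ} {h : ℂ⟦X⟧} :
    IsHol ((toLoc PowerSeries.X ^ K)⁻¹ * toLoc h) ↔ PowerSeries.X ^ K ∣ h := by
  have hX := pow_ne_zero K toLoc_X_ne_zero
  rw [isHol_iff]
  constructor
  · rintro ⟨g, hg⟩
    refine ⟨g, toLoc_injective ?_⟩
    rw [map_mul, ← hg, map_pow, mul_inv_cancel_left₀ hX]
  · rintro ⟨g, rfl⟩
    exact ⟨g, by rw [map_mul, map_pow, inv_mul_cancel_left₀ hX]⟩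

theorem constLoc_eq (c : ℂ) : constLoc c = toLoc (PowerSeries.C c) :=
  (HahnSeries.ofPowerSeries_C c).symm

theorem polyLoc_eq (P : ℂ[X]) : polyLoc P = toLoc (P : ℂ⟦X⟧) := rfl

theorem xLoc_eq (d : Params p ℓ k) (i : Fin p) :
    xLoc d i = toLoc (PowerSeries.C (d.1 i) + PowerSeries.X) := by
  rw [xLoc, constLoc_eq, map_add, HahnSeries.ofPowerSeries_X]

theorem single_one_sub (K : ℕ) : (HahnSeries.single (1 - (K : ℤ)) (1 : ℂ) : Loc) =
    toLoc PowerSeries.X * (toLoc PowerSeries.X ^ K)⁻¹ := by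
  rw [inv_toLoc_X_pow, HahnSeries.ofPowerSeries_X, HahnSeries.single_mul_single, mul_one,
    sub_eq_add_neg]

theorem coeff_inv_X_pow_mul (K : ℕ) (f : Loc) (n : ℤ) :
    ((toLoc PowerSeries.X ^ K)⁻¹ * f).coeff n = f.coeff (n + K) := by
  have h := HahnSeries.coeff_single_mul_add (r := (1 : ℂ)) (x := f) (a := n + K) (b := -(K : ℤ))
  rw [inv_toLoc_X_pow]
  simpa using h

/-! ### The formal eigenvalues and the matrix `A` with their poles cleared. -/

/-- The `j`-th diagonal entry of `t_i`, as a power series. -/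
def tSer (i : Fin p) (j : Fin ℓ) (d : Params p ℓ k) : ℂ⟦X⟧ := (tPoly i j d : ℂ⟦X⟧)

/-- `x_i ^ k_i` times the `j`-th formal eigenvalue at `λ_i`. -/
def betaSer (m : Fin p → Fin ℓ → ℂ) (d : Params p ℓ k) (i : Fin p) (j : Fin ℓ) : ℂ⟦X⟧ :=
  PowerSeries.C (1 - (k i : ℂ)) * tSer i j d +
    PowerSeries.X * PowerSeries.derivative (R := ℂ) (tSer i j d) +
    PowerSeries.C (m i j) * PowerSeries.X ^ (k i - 1)

theorem coeff_X_mul_derivative (f : ℂ⟦X⟧) (n : ℕ) :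
    PowerSeries.coeff n (PowerSeries.X * PowerSeries.derivative (R := ℂ) f) =
      n * PowerSeries.coeff n f := by
  cases n with
  | zero => simp
  | succ n => rw [PowerSeries.coeff_succ_X_mul, PowerSeries.coeff_derivative]; push_cast; ring1

/-- Differentiating `x ^ (1 - k + N)` produces the factor `1 - k + N`; the first two terms of
`betaSer` account for `1 - k` and for `N`. -/
theorem formalEigenvalue_eq (hk : ∀ i, 1 ≤ k i) (m : Fin p → Fin ℓ → ℂ) (d : Params p ℓ k)
    (i : Fin p) (j : Fin ℓ) :
    formalEigenvalue m d i j = (toLoc PowerSeries.X ^ k i)⁻¹ * toLoc (betaSer m d i j) := by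
  have hki := hk i
  have h1 : (HahnSeries.single (-1 : ℤ) (m i j) : Loc) = (toLoc PowerSeries.X ^ k i)⁻¹ *
      toLoc (PowerSeries.C (m i j) * PowerSeries.X ^ (k i - 1)) := by
    rw [inv_toLoc_X_pow, map_mul, map_pow, toLoc_X_pow, HahnSeries.ofPowerSeries_C,
      HahnSeries.C_apply,
      HahnSeries.single_mul_single, HahnSeries.single_mul_single]
    have e : -(k i : ℤ) + (0 + ((k i - 1 : ℕ) : ℤ)) = -1 := by push_cast [hki]; ring1
    rw [e, one_mul, mul_one]
  rw [formalEigenvalue, betaSer, map_add, mul_add, h1]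
  congr 1
  ext n
  rw [coeff_inv_X_pow_mul, LaurentSeries.derivative_apply, LaurentSeries.hasseDeriv_coeff,
    polyLoc_eq, single_one_sub, mul_comm (toLoc _), mul_assoc, coeff_inv_X_pow_mul, ← map_mul]
  have e : n + ((1 : ℕ) : ℤ) + k i = n + k i + 1 := by push_cast; ring1
  rw [e]
  rcases lt_or_ge (n + k i) 0 with hn | hn
  · rw [isHol_toLoc _ _ hn]
    rcases lt_or_ge (n + k i + 1) 0 with hn' | hn'
    · rw [isHol_toLoc _ _ hn']; simp
    · have : n + k i + 1 = ((0 : ℕ) : ℤ) := by omega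
      rw [this, coeff_toLoc]; simp
  · obtain ⟨N, hN⟩ := Int.eq_ofNat_of_zero_le hn
    have hN1 : n + k i + 1 = ((N + 1 : ℕ) : ℤ) := by omega
    rw [hN1, hN, coeff_toLoc, coeff_toLoc, PowerSeries.coeff_succ_X_mul, map_add,
      PowerSeries.coeff_C_mul, coeff_X_mul_derivative, Ring.choose_one_right]
    have : n = (N : ℤ) - k i := by omega
    rw [this]
    simp [tSer]
    ring1

/-- The product of the `(x - λ_j) ^ k_j`, `j ≠ i`, expanded at `λ_i`. -/
def cofactorSer (d : Params p ℓ k) (i : Fin p) : ℂ⟦X⟧ :=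
  ∏ j ∈ Finset.univ.erase i, (PowerSeries.C (d.1 i - d.1 j) + PowerSeries.X) ^ k j

theorem constantCoeff_cofactorSer (d : Params p ℓ k) (i : Fin p) :
    PowerSeries.constantCoeff (cofactorSer d i) =
      ∏ j ∈ Finset.univ.erase i, (d.1 i - d.1 j) ^ k j := by
  simp [cofactorSer]

theorem constantCoeff_cofactorSer_ne_zero {d : Params p ℓ k} (hd : Function.Injective d.1)
    (i : Fin p) : PowerSeries.constantCoeff (cofactorSer d i) ≠ 0 := by
  rw [constantCoeff_cofactorSer, Finset.prod_ne_zero_iff]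
  intro j hj
  refine pow_ne_zero _ (sub_ne_zero.2 fun h => ?_)
  exact (Finset.ne_of_mem_erase hj) (hd h).symm

theorem toLoc_inv {f : ℂ⟦X⟧} (hf : PowerSeries.constantCoeff f ≠ 0) : (toLoc f)⁻¹ = toLoc f⁻¹ := by
  refine inv_eq_of_mul_eq_one_right ?_
  rw [← map_mul, PowerSeries.mul_inv_cancel _ hf, map_one]

/-- The expansion of `x_i ^ k_i * A` at `λ_i`. -/
def SystemFamily.locB (F : SystemFamily p ℓ k) (d : Params p ℓ k) (i : Fin p) :
    Matrix (Fin ℓ) (Fin ℓ) ℂ⟦X⟧ :=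
  (cofactorSer d i)⁻¹ • (F.Q d).map
    (Polynomial.eval₂ PowerSeries.C (PowerSeries.C (d.1 i) + PowerSeries.X))

/-- The poles being distinct, `q` is `x_i ^ k_i` times a series that does not vanish at `λ_i` and so
is a unit. -/
theorem SystemFamily.locA_eq (F : SystemFamily p ℓ k) {d : Params p ℓ k}
    (hd : Function.Injective d.1) (i : Fin p) :
    F.locA d i = (F.locB d i).map fun f => (toLoc PowerSeries.X ^ k i)⁻¹ * toLoc f := by
  have hprod : ∏ j, (xLoc d i - constLoc (d.1 j)) ^ k j =
      toLoc PowerSeries.X ^ k i * toLoc (cofactorSer d i) := by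
    rw [← Finset.mul_prod_erase Finset.univ _ (Finset.mem_univ i)]
    congr 1
    · rw [xLoc_eq, constLoc_eq]; simp
    · rw [cofactorSer, map_prod]
      refine Finset.prod_congr rfl fun j _ => ?_
      rw [map_pow, xLoc_eq, constLoc_eq, ← map_sub, map_sub PowerSeries.C, add_sub_right_comm]
  ext1 r s
  rw [locA, coeffMatrix, hprod, mul_inv, toLoc_inv (constantCoeff_cofactorSer_ne_zero hd i)]
  simp only [Matrix.smul_apply, Matrix.map_apply, locB, smul_eq_mul, map_mul, mul_assoc]
  congr 2
  rw [xLoc_eq, Polynomial.hom_eval₂]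
  congr 1
  ext1 c
  exact constLoc_eq c

/-! ### Jets of series and of vectors. -/

/-- Power series modulo `x ^ K`. -/
def Jet (K : ℕ) : Type := ℂ⟦X⟧ ⧸ Ideal.span {(PowerSeries.X ^ K : ℂ⟦X⟧)}

instance (K : ℕ) : CommRing (Jet K) :=
  inferInstanceAs (CommRing (ℂ⟦X⟧ ⧸ Ideal.span {(PowerSeries.X ^ K : ℂ⟦X⟧)}))

/-- Reduction of power series modulo `x ^ K`. -/
def jet (K : ℕ) : ℂ⟦X⟧ →+* Jet K := Ideal.Quotient.mk _

theorem jet_eq_iff {K : ℕ} {f g : ℂ⟦X⟧} : jet K f = jet K g ↔ PowerSeries.X ^ K ∣ f - g := by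
  exact Ideal.Quotient.eq.trans Ideal.mem_span_singleton

theorem jet_eq_zero_iff {K : ℕ} {f : ℂ⟦X⟧} : jet K f = 0 ↔ PowerSeries.X ^ K ∣ f := by
  rw [← map_zero (jet K), jet_eq_iff, sub_zero]

theorem jet_eq_iff_coeff {K : ℕ} {f g : ℂ⟦X⟧} :
    jet K f = jet K g ↔ ∀ n < K, PowerSeries.coeff n f = PowerSeries.coeff n g := by
  rw [jet_eq_iff, PowerSeries.X_pow_dvd_iff]
  simp [sub_eq_zero]

theorem jet_surjective (K : ℕ) : Function.Surjective (jet K) := Ideal.Quotient.mk_surjective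

theorem jet_X_pow (K : ℕ) : jet K PowerSeries.X ^ K = 0 := by
  rw [← map_pow, jet_eq_zero_iff]

theorem isUnit_of_constantCoeff_ne_zero {f : ℂ⟦X⟧} (hf : PowerSeries.constantCoeff f ≠ 0) :
    IsUnit f :=
  PowerSeries.isUnit_iff_constantCoeff.2 hf.isUnit

/-- A vector-valued polynomial in `x` of degree less than `K` as a vector of power series. -/
def jetSer {K : ℕ} (v : Fin K → Fin ℓ → ℂ) (r : Fin ℓ) : ℂ⟦X⟧ :=
  PowerSeries.mk fun n => if h : n < K then v ⟨n, h⟩ r else 0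

theorem coeff_jetSer {K : ℕ} (v : Fin K → Fin ℓ → ℂ) (r : Fin ℓ) (s : Fin K) :
    PowerSeries.coeff (s : ℕ) (jetSer v r) = v s r := by
  simp [jetSer]

theorem coeff_jetSer' {K : ℕ} (v : Fin K → Fin ℓ → ℂ) (r : Fin ℓ) {n : ℕ} (h : n < K) :
    PowerSeries.coeff n (jetSer v r) = v ⟨n, h⟩ r := by
  simp [jetSer, h]

/-- A vector-valued polynomial in `x` of degree less than `K` as a vector of jets. -/
def jetVec {K : ℕ} : (Fin K → Fin ℓ → ℂ) →+ (Fin ℓ → Jet K) where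
  toFun v r := jet K (jetSer v r)
  map_zero' := by
    funext r
    rw [Pi.zero_apply, ← map_zero (jet K), jet_eq_iff_coeff]
    intro n hn
    simp [coeff_jetSer' _ _ hn]
  map_add' v w := by
    funext r
    rw [Pi.add_apply, ← map_add, jet_eq_iff_coeff]
    intro n hn
    simp [coeff_jetSer' _ _ hn]

theorem jetVec_apply {K : ℕ} (v : Fin K → Fin ℓ → ℂ) (r : Fin ℓ) :
    jetVec v r = jet K (jetSer v r) := rfl

theorem jetVec_eq_iff {K : ℕ} {v : Fin K → Fin ℓ → ℂ} {f : Fin ℓ → ℂ⟦X⟧} :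
    (jetVec v = fun r => jet K (f r)) ↔ ∀ s r, v s r = PowerSeries.coeff (s : ℕ) (f r) := by
  rw [funext_iff]
  simp only [jetVec_apply, jet_eq_iff_coeff]
  constructor
  · intro h s r
    rw [← h r s s.isLt, coeff_jetSer]
  · intro h r n hn
    rw [coeff_jetSer' _ _ hn, h]

theorem jetVec_injective {K : ℕ} : Function.Injective (jetVec (ℓ := ℓ) (K := K)) := by
  intro v w h
  funext s r
  rw [jetVec_eq_iff.1 (h : jetVec v = fun r => jet K (jetSer w r)), coeff_jetSer]

/-- The truncated convolution is the Cauchy product modulo `x ^ K`. This transfers all computations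
in the fibres of `V` to matrix algebra over the ring of jets. -/
theorem jetVec_jetMul {K : ℕ} {h : ℕ → Matrix (Fin ℓ) (Fin ℓ) ℂ}
    {M : Matrix (Fin ℓ) (Fin ℓ) ℂ⟦X⟧} (hM : ∀ n < K, h n = M.map (PowerSeries.coeff n))
    (v : Fin K → Fin ℓ → ℂ) :
    jetVec (jetMul K ℓ h v) = (M.map (jet K)).mulVec (jetVec v) := by
  have e : (M.map (jet K)).mulVec (jetVec v) = fun r => jet K (M.mulVec (jetSer v) r) := by
    funext r
    rw [RingHom.map_mulVec]
    rfl
  rw [e, jetVec_eq_iff]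
  intro s r
  have h1 : jetMul K ℓ h v s r =
      ∑ n : Fin K, if (n : ℕ) ≤ s then ((h ((s : ℕ) - n)).mulVec (v n)) r else 0 := by
    simp only [jetMul, LinearMap.mk₂_apply, Finset.sum_apply, Fin.le_def]
    refine Finset.sum_congr rfl fun n _ => ?_
    split_ifs <;> simp
  -- Extending the summand to all of `ℕ` turns the sum over `Fin K` into one over a range, which the
  -- condition `m ≤ s` then cuts down.
  let f : ℕ → ℂ := fun m => if m ≤ (s : ℕ) then ∑ r', PowerSeries.coeff ((s : ℕ) - m) (M r r') *
    PowerSeries.coeff m (jetSer v r') else 0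
  have h2 : ∀ n : Fin K,
      (if (n : ℕ) ≤ s then ((h ((s : ℕ) - n)).mulVec (v n)) r else 0) = f n := by
    intro n
    have hn : (s : ℕ) - n < K := lt_of_le_of_lt (Nat.sub_le _ _) s.isLt
    simp [f, hM _ hn, Matrix.mulVec, dotProduct, coeff_jetSer]
  refine (h1.trans ((Finset.sum_congr rfl fun n _ => h2 n).trans
    (Fin.sum_univ_eq_sum_range f K))).trans ?_
  rw [← Finset.sum_filter]
  have h3 : (Finset.range K).filter (· ≤ (s : ℕ)) = Finset.range ((s : ℕ) + 1) := by
    ext m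
    have := s.isLt
    simp only [Finset.mem_filter, Finset.mem_range]
    omega
  rw [h3, Finset.sum_comm]
  simp only [Matrix.mulVec, dotProduct, map_sum]
  refine Finset.sum_congr rfl fun r' _ => ?_
  rw [mul_comm, PowerSeries.coeff_mul, Finset.Nat.sum_antidiagonal_eq_sum_range_succ
    (fun a b => PowerSeries.coeff a (jetSer v r') * PowerSeries.coeff b (M r r'))]
  exact Finset.sum_congr rfl fun n _ => mul_comm _ _

theorem jetVec_jetSMul {K : ℕ} (f : ℂ[X]) (v : Fin K → Fin ℓ → ℂ) :
    jetVec (jetSMul f v) = jet K (f : ℂ⟦X⟧) • jetVec v := by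
  have hM : ∀ n < K, f.coeff n • (1 : Matrix (Fin ℓ) (Fin ℓ) ℂ) =
      (Matrix.scalar (Fin ℓ) (f : ℂ⟦X⟧)).map (PowerSeries.coeff n) := by
    intro n _
    ext r s
    by_cases hrs : r = s <;> simp [hrs]
  rw [jetSMul, jetVec_jetMul hM]
  have : (Matrix.scalar (Fin ℓ) (f : ℂ⟦X⟧)).map (jet K) =
      Matrix.scalar (Fin ℓ) (jet K (f : ℂ⟦X⟧)) := by
    ext r s
    by_cases hrs : r = s <;> simp [hrs]
  rw [this]
  simp only [Matrix.scalar_apply]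
  funext r
  simp [Matrix.mulVec_diagonal]

/-! ### Diagonalization modulo `x_i ^ k_i` and regular points. -/

/-- In a basis of eigenvectors, the eigenvectors of a matrix over a ring are the multiples of the
basis vectors, if the differences of the eigenvalues are units. -/
theorem eigenvector_iff {R : Type*} [CommRing R] {B G : Matrix (Fin ℓ) (Fin ℓ) R} {β : Fin ℓ → R}
    (hG : IsUnit G) (h : B * G = G * Matrix.diagonal β) {j : Fin ℓ}
    (hu : ∀ l, l ≠ j → IsUnit (β l - β j)) (v : Fin ℓ → R) :
    B.mulVec v = β j • v ↔ ∃ c : R, v = c • G.mulVec (Pi.single j 1) := by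
  constructor
  · intro hv
    obtain ⟨H, hGH, hHG⟩ := isUnit_iff_exists.1 hG
    have hBH : H * B = Matrix.diagonal β * H := by
      calc H * B = H * (B * G) * H := by rw [Matrix.mul_assoc, Matrix.mul_assoc B, hGH, mul_one]
        _ = Matrix.diagonal β * H := by rw [h, ← Matrix.mul_assoc H, hHG, one_mul]
    -- In the coordinates `H v` the eigenvector equation is `(β l - β j) * (H v) l = 0`.
    have h0 : ∀ l, l ≠ j → H.mulVec v l = 0 := by
      intro l hl
      have h1 := congrFun (congrArg H.mulVec hv) l
      rw [Matrix.mulVec_mulVec, hBH, ← Matrix.mulVec_mulVec, Matrix.mulVec_smul,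
        Matrix.mulVec_diagonal, Pi.smul_apply, smul_eq_mul, ← sub_eq_zero, ← sub_mul] at h1
      exact (hu l hl).mul_right_eq_zero.1 h1
    refine ⟨H.mulVec v j, ?_⟩
    rw [← Matrix.mulVec_smul]
    have h2 : H.mulVec v j • (Pi.single j 1 : Fin ℓ → R) = H.mulVec v := by
      funext l
      by_cases hl : l = j
      · subst hl; simp
      · simp [hl, h0 l hl]
    rw [h2, Matrix.mulVec_mulVec, hGH, Matrix.one_mulVec]
  · rintro ⟨c, rfl⟩
    rw [Matrix.mulVec_smul, Matrix.mulVec_mulVec, h, ← Matrix.mulVec_mulVec, smul_comm]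
    congr 1
    rw [← Matrix.mulVec_smul]
    congr 1
    funext l
    by_cases hl : l = j
    · subst hl; simp [Matrix.mulVec_diagonal]
    · simp [Matrix.mulVec_diagonal, hl]

theorem seriesLoc_inv {g : Matrix (Fin ℓ) (Fin ℓ) ℂ⟦X⟧} (hg : IsUnit g) :
    (seriesLoc g)⁻¹ = g⁻¹.map toLoc := by
  refine Matrix.inv_eq_right_inv ?_
  rw [seriesLoc, ← Matrix.map_mul, Matrix.mul_nonsing_inv _ ((Matrix.isUnit_iff_isUnit_det _).1 hg)]
  simp

theorem mul_diagonal_mul_map {L : Type*} [CommRing L] (c : L) (G H : Matrix (Fin ℓ) (Fin ℓ) L)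
    (β : Fin ℓ → L) : G * Matrix.diagonal (fun j => c * β j) * H =
      (G * Matrix.diagonal β * H).map fun f => c * f := by
  ext r s
  rw [Matrix.mul_apply, Matrix.map_apply, Matrix.mul_apply, Finset.mul_sum]
  refine Finset.sum_congr rfl fun j _ => ?_
  rw [Matrix.mul_diagonal, Matrix.mul_diagonal]
  ring

namespace SystemFamily

variable (F : SystemFamily p ℓ k)

/-- The columns of `g_i` are eigenvectors for the formal eigenvalues, modulo `x_i ^ k_i`. -/
theorem jet_locB (hk : ∀ i, 1 ≤ k i) {d : Params p ℓ k} (hd : d ∈ F.dom) (i : Fin p) :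
    (F.locB d i).map (jet (k i)) * (F.g d i).map (jet (k i)) =
      (F.g d i).map (jet (k i)) * Matrix.diagonal fun j => jet (k i) (betaSer F.m d i j) := by
  have hg := F.isUnit_g d hd i
  have hdet := (Matrix.isUnit_iff_isUnit_det _).1 hg
  have key : (F.locB d i).map (jet (k i)) =
      (F.g d i * Matrix.diagonal (betaSer F.m d i) * (F.g d i)⁻¹).map (jet (k i)) := by
    ext1 r s
    rw [Matrix.map_apply, Matrix.map_apply, jet_eq_iff, ← isHol_div_iff]
    have h := F.singularPart d hd i r s
    have h1 : formalEigenvalue F.m d i =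
        fun j => (toLoc PowerSeries.X ^ k i)⁻¹ * toLoc (betaSer F.m d i j) :=
      funext fun j => formalEigenvalue_eq hk F.m d i j
    have h2 : Matrix.diagonal (fun j => toLoc (betaSer F.m d i j)) =
        (Matrix.diagonal (betaSer F.m d i)).map toLoc := by
      rw [Matrix.diagonal_map (map_zero _)]
    have h3 := F.locA_eq (F.poles_distinct d hd) i
    rw [locA] at h3
    rw [h1, seriesLoc_inv hg, seriesLoc, mul_diagonal_mul_map, h2, ← Matrix.map_mul,
      ← Matrix.map_mul, h3] at h
    rw [Matrix.sub_apply, Matrix.map_apply, Matrix.map_apply, Matrix.map_apply, ← mul_sub,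
      ← map_sub] at h
    exact h
  rw [key, ← Matrix.map_mul, Matrix.mul_assoc, Matrix.nonsing_inv_mul _ hdet, mul_one,
    Matrix.map_mul, Matrix.diagonal_map (map_zero _)]

/-- The value at `x_i = 0` of the relation between jets; it is visible there because `k i ≥ 1`. -/
theorem constantCoeff_locB (hk : ∀ i, 1 ≤ k i) {d : Params p ℓ k} (hd : d ∈ F.dom) (i : Fin p) :
    (F.locB d i).map PowerSeries.constantCoeff * (F.g d i).map PowerSeries.constantCoeff =
      (F.g d i).map PowerSeries.constantCoeff *
        Matrix.diagonal fun j => PowerSeries.constantCoeff (betaSer F.m d i j) := by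
  have h := F.jet_locB hk hd i
  have h1 : Matrix.diagonal (fun j => jet (k i) (betaSer F.m d i j)) =
      (Matrix.diagonal (betaSer F.m d i)).map (jet (k i)) := by
    rw [Matrix.diagonal_map (map_zero _)]
  have h2 : (Matrix.diagonal fun j => PowerSeries.constantCoeff (betaSer F.m d i j)) =
      (Matrix.diagonal (betaSer F.m d i)).map PowerSeries.constantCoeff := by
    rw [Matrix.diagonal_map (map_zero _)]
  rw [h1, ← Matrix.map_mul, ← Matrix.map_mul] at h
  rw [h2, ← Matrix.map_mul, ← Matrix.map_mul]
  ext1 r s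
  have h3 := congrFun (congrFun h r) s
  rw [Matrix.map_apply, Matrix.map_apply, jet_eq_iff_coeff] at h3
  simpa using h3 0 (hk i)

theorem map_eval_Q {d : Params p ℓ k} (hd : d ∈ F.dom) (i : Fin p) :
    (F.Q d).map (Polynomial.eval (d.1 i)) = PowerSeries.constantCoeff (cofactorSer d i) •
      (F.locB d i).map PowerSeries.constantCoeff := by
  have h0 := constantCoeff_cofactorSer_ne_zero (F.poles_distinct d hd) i
  ext1 r s
  simp only [Matrix.map_apply, Matrix.smul_apply, locB, smul_eq_mul, map_mul,
    PowerSeries.constantCoeff_inv, mul_inv_cancel_left₀ h0, Polynomial.hom_eval₂]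
  simp [Polynomial.eval, Polynomial.eval₂_eq_sum]

theorem isUnit_map_g {R : Type*} [CommRing R] {d : Params p ℓ k} (hd : d ∈ F.dom) (i : Fin p)
    (f : ℂ⟦X⟧ →+* R) : IsUnit ((F.g d i).map f) :=
  (F.isUnit_g d hd i).map (RingHom.mapMatrix f)

/-- `Q(λ_i)` is conjugate to a nonzero multiple of the diagonal matrix of the `β_ij(0)`. The new
condition involves `d` only through the `t_ij`, so it is visibly open. -/
theorem mem_regularPoints_iff (hk : ∀ i, 1 ≤ k i) {d : Params p ℓ k} (hd : d ∈ F.dom) :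
    d ∈ F.regularPoints ↔ ∀ i,
      Function.Injective (fun j => PowerSeries.constantCoeff (betaSer F.m d i j)) ∧
        ∀ j, PowerSeries.constantCoeff (betaSer F.m d i j) ≠ 0 := by
  simp only [regularPoints, Set.mem_ofPred_eq, hd, true_and]
  refine forall_congr' fun i => ?_
  set c := PowerSeries.constantCoeff (cofactorSer d i) with hc
  have hc0 : c ≠ 0 := constantCoeff_cofactorSer_ne_zero (F.poles_distinct d hd) i
  set b := fun j => PowerSeries.constantCoeff (betaSer F.m d i j) with hb
  obtain ⟨u, hu⟩ := F.isUnit_map_g hd i PowerSeries.constantCoeff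
  have hchar : ((F.Q d).map (Polynomial.eval (d.1 i))).charpoly.roots =
      Finset.univ.val.map fun j => c * b j := by
    have h1 : (F.Q d).map (Polynomial.eval (d.1 i)) =
        (u : Matrix (Fin ℓ) (Fin ℓ) ℂ) * Matrix.diagonal (fun j => c * b j) *
          (u : Matrix (Fin ℓ) (Fin ℓ) ℂ)⁻¹ := by
      rw [← Matrix.coe_units_inv]
      rw [Units.eq_mul_inv_iff_mul_eq, F.map_eval_Q hd i, smul_mul_assoc, hu,
        F.constantCoeff_locB hk hd i, ← mul_smul_comm, ← Matrix.diagonal_smul]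
      rfl
    rw [h1, Matrix.charpoly_units_conj, Matrix.charpoly_diagonal]
    have h2 := Polynomial.roots_multiset_prod_X_sub_C (Finset.univ.val.map fun j => c * b j)
    rw [Multiset.map_map] at h2
    exact h2
  rw [hchar, Multiset.nodup_map_iff_inj_on Finset.univ.nodup]
  simp [hc0, Function.Injective, eq_comm, hb]

/-- At `x_i = 0` the determinant is the product of the nonzero `β_ij(0)`. -/
theorem isUnit_locB (hk : ∀ i, 1 ≤ k i) {d : Params p ℓ k} (hd : d ∈ F.regularPoints)
    (i : Fin p) : IsUnit (F.locB d i) := by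
  have hdom := hd.1
  have h := ((F.mem_regularPoints_iff hk hdom).1 hd i).2
  rw [Matrix.isUnit_iff_isUnit_det]
  refine isUnit_of_constantCoeff_ne_zero ?_
  rw [RingHom.map_det, RingHom.mapMatrix_apply]
  intro h0
  have h1 := congrArg Matrix.det (F.constantCoeff_locB hk hdom i)
  rw [Matrix.det_mul, Matrix.det_mul, h0, zero_mul, Matrix.det_diagonal] at h1
  have h2 := (Matrix.isUnit_iff_isUnit_det _).1 (F.isUnit_map_g hdom i PowerSeries.constantCoeff)
  exact mul_ne_zero h2.ne_zero (Finset.prod_ne_zero_iff.2 fun j _ => h j) h1.symm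

end SystemFamily

/-! ### The action of `α` on the eigenlines. -/

theorem isHol_iff_mem_range {f : Loc} : IsHol f ↔ f ∈ toLoc.range := by
  rw [isHol_iff, RingHom.mem_range]
  exact exists_congr fun h => eq_comm

/-- A Laurent series with a pole of order at most `K` is holomorphic after subtraction of its
principal part. -/
theorem isHol_principalPart_sub {K : ℕ} {f : Loc} (hf : IsHol (toLoc PowerSeries.X ^ K * f)) :
    IsHol (∑ n ∈ Finset.Icc 1 K, constLoc (f.coeff (-(n : ℤ))) * (toLoc PowerSeries.X ^ n)⁻¹ -
      f) := by
  intro m hm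
  have h1 : ∀ n : ℕ, (constLoc (f.coeff (-(n : ℤ))) * (toLoc PowerSeries.X ^ n)⁻¹).coeff m =
      if m = -(n : ℤ) then f.coeff m else 0 := by
    intro n
    rw [SystemFamily.coeff_constLoc_mul, inv_toLoc_X_pow, HahnSeries.coeff_single]
    split_ifs with h
    · rw [mul_one, h]
    · rw [mul_zero]
  rw [HahnSeries.coeff_sub, HahnSeries.coeff_sum, Finset.sum_congr rfl fun n _ => h1 n]
  -- For `-K ≤ m < 0` exactly one summand contributes; for `m < -K` none does, and the bound on the
  -- pole kills the coefficient of `f`.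
  rcases le_or_gt (-(K : ℤ)) m with hmK | hmK
  · rw [Finset.sum_eq_single m.natAbs]
    · rw [if_pos (by omega), sub_self]
    · intro n _ hn
      rw [if_neg (by omega)]
    · intro h
      exact absurd (Finset.mem_Icc.2 (by omega)) h
  · rw [Finset.sum_eq_zero, zero_sub, neg_eq_zero]
    · have h2 := coeff_inv_X_pow_mul K (toLoc PowerSeries.X ^ K * f) m
      rw [inv_mul_cancel_left₀ (pow_ne_zero K toLoc_X_ne_zero)] at h2
      rw [h2]
      exact hf _ (by omega)
    · intro n hn
      rw [Finset.mem_Icc] at hn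
      rw [if_neg (by omega)]

/-- The function of `x` by which `α_Y` acts on the `j`-th eigenspace at `λ_i`. -/
def alphaSer (m : Fin p → Fin ℓ → ℂ) (d Y : Params p ℓ k) (i : Fin p) (j : Fin ℓ) : ℂ⟦X⟧ :=
  PowerSeries.C (Y.1 i) - PowerSeries.X * (tSer i j Y * (betaSer m d i j)⁻¹)

theorem map_mul_map_mul {R L : Type*} [CommRing R] [Field L] (ι : R →+* L) {a b : L}
    (hab : a * b = 1) (M N : Matrix (Fin ℓ) (Fin ℓ) R) :
    (M.map fun f => a * ι f) * (N.map fun f => b * ι f) = (M * N).map ι := by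
  ext r s
  rw [Matrix.mul_apply, Matrix.map_apply, Matrix.mul_apply, map_sum]
  refine Finset.sum_congr rfl fun j _ => ?_
  rw [Matrix.map_apply, Matrix.map_apply, map_mul]
  linear_combination ι (M r j) * ι (N j s) * hab

namespace SystemFamily

variable (F : SystemFamily p ℓ k)

/-- The contraction of `A dλ_i - x_i ^ (1 - k_i) * g_i * dt_i * g_i⁻¹`, times `x_i ^ k_i`. -/
def variationSer (d Y : Params p ℓ k) (i : Fin p) : Matrix (Fin ℓ) (Fin ℓ) ℂ⟦X⟧ :=
  PowerSeries.C (Y.1 i) • F.locB d i - (PowerSeries.X : ℂ⟦X⟧) •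
    (F.g d i * Matrix.diagonal (fun j => tSer i j Y) * (F.g d i)⁻¹)

theorem variation_eq {d : Params p ℓ k} (hd : d ∈ F.dom) (Y : Params p ℓ k) (i : Fin p) :
    F.variation d Y i =
      (F.variationSer d Y i).map fun f => (toLoc PowerSeries.X ^ k i)⁻¹ * toLoc f := by
  ext1 r s
  have h1 : (seriesLoc (F.g d i) * Matrix.diagonal (fun j => polyLoc (tPoly i j Y)) *
      (seriesLoc (F.g d i))⁻¹) =
      (F.g d i * Matrix.diagonal (fun j => tSer i j Y) * (F.g d i)⁻¹).map toLoc := by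
    rw [seriesLoc_inv (F.isUnit_g d hd i), seriesLoc, Matrix.map_mul, Matrix.map_mul,
      Matrix.diagonal_map (map_zero _)]
    rfl
  rw [variation, subConj, h1, F.locA_eq (F.poles_distinct d hd), single_one_sub, constLoc_eq]
  simp only [Matrix.sub_apply, Matrix.smul_apply, Matrix.map_apply, variationSer, smul_eq_mul,
    map_sub, map_mul]
  ring

/-- The summands of `Ω` at the other poles are regular at `λ_i`, and the summand at `λ_i` is the
principal part of the variation. -/
theorem isHol_Omega_sub_variation {d : Params p ℓ k} (hd : d ∈ F.dom) (Y : Params p ℓ k)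
    (i : Fin p) (r s : Fin ℓ) :
    IsHol (F.Omega constLoc d Y (xLoc d i) r s - F.variation d Y i r s) := by
  have e : F.Omega constLoc d Y (xLoc d i) r s = ∑ i', ∑ n ∈ Finset.Icc 1 (k i'),
      constLoc ((F.variation d Y i' r s).coeff (-(n : ℤ))) *
        ((xLoc d i - constLoc (d.1 i')) ^ n)⁻¹ := rfl
  rw [e, ← Finset.add_sum_erase Finset.univ _ (Finset.mem_univ i), add_sub_right_comm,
    isHol_iff_mem_range]
  refine add_mem ?_ (sum_mem fun i' hi' => sum_mem fun n _ => ?_)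
  · rw [← isHol_iff_mem_range]
    have h1 : xLoc d i - constLoc (d.1 i) = toLoc PowerSeries.X := by
      rw [xLoc_eq, constLoc_eq]; simp
    rw [h1]
    refine isHol_principalPart_sub ?_
    rw [F.variation_eq hd, Matrix.map_apply, mul_inv_cancel_left₀ (pow_ne_zero _ toLoc_X_ne_zero)]
    exact isHol_toLoc _
  · have h1 : xLoc d i - constLoc (d.1 i') =
        toLoc (PowerSeries.C (d.1 i - d.1 i') + PowerSeries.X) := by
      rw [xLoc_eq, constLoc_eq, ← map_sub, map_sub PowerSeries.C, add_sub_right_comm]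
    have h2 : PowerSeries.constantCoeff
        ((PowerSeries.C (d.1 i - d.1 i') + PowerSeries.X) ^ n) ≠ 0 := by
      simp only [map_pow, map_add, PowerSeries.constantCoeff_C, PowerSeries.constantCoeff_X,
        add_zero]
      refine pow_ne_zero _ (sub_ne_zero.2 fun h => ?_)
      exact (Finset.ne_of_mem_erase hi') (F.poles_distinct d hd h).symm
    rw [h1, ← map_pow, toLoc_inv h2, constLoc_eq, ← map_mul]
    exact ⟨_, rfl⟩

/-- In `A⁻¹ Ω` the factors `x_i ^ k_i` cancel, and the unknown regular part of `Ω` contributes only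
`O(x_i ^ k_i)`. What remains modulo `x_i ^ k_i` is `B⁻¹` times `variationSer`, and `g_i`
diagonalizes both factors. -/
theorem exists_alphaCoeff_eq (hk : ∀ i, 1 ≤ k i) {d : Params p ℓ k} (hd : d ∈ F.regularPoints)
    (Y : Params p ℓ k) (i : Fin p) :
    ∃ M : Matrix (Fin ℓ) (Fin ℓ) ℂ⟦X⟧,
      (∀ n, F.alphaCoeff d Y i n = M.map (PowerSeries.coeff n)) ∧
      M.map (jet (k i)) * (F.g d i).map (jet (k i)) = (F.g d i).map (jet (k i)) *
        Matrix.diagonal fun j => jet (k i) (alphaSer F.m d Y i j) := by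
  have hdom := hd.1
  have hreg := ((F.mem_regularPoints_iff hk hdom).1 hd i).2
  have hBu := F.isUnit_locB hk hd i
  have hB := (Matrix.isUnit_iff_isUnit_det _).1 hBu
  have hX := pow_ne_zero (k i) toLoc_X_ne_zero
  choose H hH using fun r s => isHol_iff.1 (F.isHol_Omega_sub_variation hdom Y i r s)
  let N : Matrix (Fin ℓ) (Fin ℓ) ℂ⟦X⟧ :=
    F.variationSer d Y i + Matrix.of fun r s => PowerSeries.X ^ k i * H r s
  have hOmega : F.Omega constLoc d Y (xLoc d i) =
      N.map fun f => (toLoc PowerSeries.X ^ k i)⁻¹ * toLoc f := by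
    ext1 r s
    rw [← sub_add_cancel (F.Omega constLoc d Y (xLoc d i) r s) (F.variation d Y i r s), hH,
      F.variation_eq hdom]
    simp only [N, Matrix.map_apply, Matrix.add_apply, Matrix.of_apply, map_add, map_mul, map_pow,
      mul_add, inv_mul_cancel_left₀ hX]
    ring
  have hAinv : (F.locA d i)⁻¹ =
      ((F.locB d i)⁻¹).map fun f => toLoc PowerSeries.X ^ k i * toLoc f := by
    refine Matrix.inv_eq_right_inv ?_
    rw [F.locA_eq (F.poles_distinct d hdom), map_mul_map_mul toLoc (inv_mul_cancel₀ hX),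
      Matrix.mul_nonsing_inv _ hB]
    simp
  refine ⟨(F.locB d i)⁻¹ * N, fun n => ?_, ?_⟩
  · rw [alphaCoeff, hAinv, hOmega, map_mul_map_mul toLoc (mul_inv_cancel₀ hX), Matrix.map_map]
    ext1 r s
    exact coeff_toLoc _ n
  · set G := (F.g d i).map (jet (k i)) with hG
    set B := (F.locB d i).map (jet (k i)) with hBdef
    have hBG : B * G = G * Matrix.diagonal fun j => jet (k i) (betaSer F.m d i j) :=
      F.jet_locB hk hdom i
    have hBunit : IsUnit B := hBu.map (RingHom.mapMatrix (jet (k i)))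
    have hBN : B * ((F.locB d i)⁻¹ * N).map (jet (k i)) = N.map (jet (k i)) := by
      rw [hBdef, ← Matrix.map_mul, ← Matrix.mul_assoc, Matrix.mul_nonsing_inv _ hB, one_mul]
    have hGinv : ((F.g d i)⁻¹).map (jet (k i)) * G = 1 := by
      rw [hG, ← Matrix.map_mul, Matrix.nonsing_inv_mul _
        ((Matrix.isUnit_iff_isUnit_det _).1 (F.isUnit_g d hdom i))]
      simp
    have hN : N.map (jet (k i)) = jet (k i) (PowerSeries.C (Y.1 i)) • B -
        jet (k i) PowerSeries.X • (G * Matrix.diagonal (fun j => jet (k i) (tSer i j Y)) *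
          ((F.g d i)⁻¹).map (jet (k i))) := by
      have h1 : Matrix.diagonal (fun j => jet (k i) (tSer i j Y)) =
          (Matrix.diagonal (fun j => tSer i j Y)).map (jet (k i)) := by
        rw [Matrix.diagonal_map (map_zero _)]
      rw [h1, hG, ← Matrix.map_mul, ← Matrix.map_mul]
      ext1 r s
      simp only [N, variationSer, hBdef, Matrix.map_apply, Matrix.add_apply, Matrix.sub_apply,
        Matrix.smul_apply, Matrix.of_apply, map_add, map_sub, map_mul, map_pow, smul_eq_mul,
        jet_X_pow, zero_mul, add_zero]
    have hβ : ∀ j, jet (k i) (betaSer F.m d i j) * jet (k i) (alphaSer F.m d Y i j) =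
        jet (k i) (PowerSeries.C (Y.1 i)) * jet (k i) (betaSer F.m d i j) -
          jet (k i) PowerSeries.X * jet (k i) (tSer i j Y) := by
      intro j
      rw [← map_mul, ← map_mul, ← map_mul, ← map_sub]
      congr 1
      have := PowerSeries.mul_inv_cancel _ (hreg j)
      rw [alphaSer]
      linear_combination (-PowerSeries.X * tSer i j Y) * this
    -- Multiplying by the unit `B` leaves the scalar identities `hβ` to be compared.
    refine hBunit.mul_left_cancel ?_
    rw [← Matrix.mul_assoc, ← Matrix.mul_assoc, hBN, hBG, Matrix.mul_assoc G,
      Matrix.diagonal_mul_diagonal, funext hβ, hN, sub_mul, smul_mul_assoc, smul_mul_assoc,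
      Matrix.mul_assoc _ _ G, hGinv, mul_one, hBG, ← mul_smul_comm, ← mul_smul_comm, ← mul_sub,
      ← Matrix.diagonal_smul, ← Matrix.diagonal_smul, Matrix.diagonal_sub]
    rfl

/-! ### Comparison of eigenvectors with the columns of `g_i`. -/

/-- The `j`-th formal eigenvector at `λ_i`, modulo `x_i ^ k_i`. -/
def formalEigenvector (d : Params p ℓ k) (i : Fin p) (j : Fin ℓ) : Fin ℓ → Jet (k i) :=
  ((F.g d i).map (jet (k i))).mulVec (Pi.single j 1)

theorem mulVec_formalEigenvector {d : Params p ℓ k} {i : Fin p}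
    {M : Matrix (Fin ℓ) (Fin ℓ) (Jet (k i))} {f : Fin ℓ → Jet (k i)}
    (h : M * (F.g d i).map (jet (k i)) = (F.g d i).map (jet (k i)) * Matrix.diagonal f)
    (j : Fin ℓ) : M.mulVec (F.formalEigenvector d i j) = f j • F.formalEigenvector d i j := by
  rw [formalEigenvector, Matrix.mulVec_mulVec, h, ← Matrix.mulVec_mulVec, ← Matrix.mulVec_smul]
  congr 1
  funext l
  by_cases hl : l = j
  · subst hl; simp [Matrix.mulVec_diagonal]
  · simp [Matrix.mulVec_diagonal, hl]

/-- A sum of multiples of the formal eigenvectors vanishes only trivially. -/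
theorem formalEigenvector_sum_eq_zero {d : Params p ℓ k} (hd : d ∈ F.dom) {i : Fin p}
    {c : Fin ℓ → Jet (k i)} (h : ∑ j, c j • F.formalEigenvector d i j = 0) : c = 0 := by
  obtain ⟨H, -, hHG⟩ := isUnit_iff_exists.1 (F.isUnit_map_g hd i (jet (k i)))
  have h1 : ∑ j, c j • F.formalEigenvector d i j = ((F.g d i).map (jet (k i))).mulVec c := by
    have : c = ∑ j, c j • (Pi.single j 1 : Fin ℓ → Jet (k i)) := by
      funext l
      simp [Finset.sum_apply, Pi.single_apply]
    conv_rhs => rw [this]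
    simp only [Matrix.mulVec_sum, Matrix.mulVec_smul, formalEigenvector]
  rw [h1] at h
  have h2 := congrArg H.mulVec h
  rwa [Matrix.mulVec_mulVec, hHG, Matrix.one_mulVec, Matrix.mulVec_zero] at h2

/-- The pointwise eigenvector condition, in terms of jets. -/
theorem isHol_eigenvector_iff (hk : ∀ i, 1 ≤ k i) {d : Params p ℓ k} (hd : d ∈ F.regularPoints)
    (i : Fin p) (j : Fin ℓ) (v : Fin (k i) → Fin ℓ → ℂ) :
    (∀ r, IsHol (((F.locA d i - Matrix.scalar (Fin ℓ) (formalEigenvalue F.m d i j)).mulVec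
        (fun r' => ∑ s : Fin (k i), HahnSeries.single ((s : ℕ) : ℤ) (v s r'))) r)) ↔
      ((F.locB d i).map (jet (k i))).mulVec (jetVec v) =
        jet (k i) (betaSer F.m d i j) • jetVec v := by
  have hser : (fun r' => ∑ s : Fin (k i), (HahnSeries.single ((s : ℕ) : ℤ) (v s r') : Loc)) =
      toLoc ∘ jetSer v := by
    funext r'
    have h1 : jetSer v r' = ∑ s : Fin (k i), PowerSeries.monomial (s : ℕ) (v s r') := by
      ext n
      rw [map_sum]
      simp only [PowerSeries.coeff_monomial, jetSer, PowerSeries.coeff_mk]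
      split_ifs with h
      · rw [Finset.sum_eq_single ⟨n, h⟩]
        · simp
        · intro s _ hs
          rw [if_neg]
          rintro rfl
          exact hs rfl
        · simp
      · rw [Finset.sum_eq_zero]
        intro s _
        rw [if_neg]
        rintro rfl
        exact h s.isLt
    rw [Function.comp_apply, h1, map_sum]
    refine Finset.sum_congr rfl fun s _ => ?_
    rw [PowerSeries.monomial_eq_C_mul_X_pow, map_mul, map_pow, toLoc_X_pow,
      HahnSeries.ofPowerSeries_C, HahnSeries.C_apply, HahnSeries.single_mul_single, zero_add,
      mul_one]
  rw [hser, funext_iff]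
  refine forall_congr' fun r => ?_
  have h2 : (F.locA d i - Matrix.scalar (Fin ℓ) (formalEigenvalue F.m d i j)).mulVec
      (toLoc ∘ jetSer v) r = (toLoc PowerSeries.X ^ k i)⁻¹ *
        toLoc ((F.locB d i).mulVec (jetSer v) r - betaSer F.m d i j * jetSer v r) := by
    rw [Matrix.sub_mulVec, Pi.sub_apply, F.locA_eq (F.poles_distinct d hd.1),
      formalEigenvalue_eq hk, map_sub, mul_sub, RingHom.map_mulVec]
    congr 1
    · simp only [Matrix.mulVec, dotProduct, Matrix.map_apply, Finset.mul_sum]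
      exact Finset.sum_congr rfl fun _ _ => mul_assoc _ _ _
    · rw [Matrix.scalar_apply, Matrix.mulVec_diagonal, map_mul, mul_assoc]
      rfl
  rw [h2, isHol_div_iff, ← jet_eq_iff, RingHom.map_mulVec, map_mul]
  rfl

theorem isUnit_jet_betaSer_sub (hk : ∀ i, 1 ≤ k i) {d : Params p ℓ k} (hd : d ∈ F.regularPoints)
    (i : Fin p) {j l : Fin ℓ} (h : l ≠ j) :
    IsUnit (jet (k i) (betaSer F.m d i l) - jet (k i) (betaSer F.m d i j)) := by
  rw [← map_sub]
  refine (isUnit_of_constantCoeff_ne_zero ?_).map (jet (k i))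
  rw [map_sub]
  exact sub_ne_zero.2 fun e => h (((F.mem_regularPoints_iff hk hd.1).1 hd i).1 e)

/-- Pointwise eigenvectors are multiples of the formal ones, with an invertible factor if they
do not vanish at `λ_i`. -/
theorem eigenvector_iff_exists (hk : ∀ i, 1 ≤ k i) {d : Params p ℓ k} (hd : d ∈ F.regularPoints)
    (i : Fin p) (j : Fin ℓ) (v : Fin (k i) → Fin ℓ → ℂ) :
    ((∀ s : Fin (k i), (s : ℕ) = 0 → v s ≠ 0) ∧
      ∀ r, IsHol (((F.locA d i - Matrix.scalar (Fin ℓ) (formalEigenvalue F.m d i j)).mulVec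
        (fun r' => ∑ s : Fin (k i), HahnSeries.single ((s : ℕ) : ℤ) (v s r'))) r)) ↔
      ∃ c : ℂ⟦X⟧, PowerSeries.constantCoeff c ≠ 0 ∧
        jetVec v = jet (k i) c • F.formalEigenvector d i j := by
  rw [F.isHol_eigenvector_iff hk hd, eigenvector_iff (F.isUnit_map_g hd.1 i (jet (k i)))
    (F.jet_locB hk hd.1 i) (fun l hl => F.isUnit_jet_betaSer_sub hk hd i hl)]
  -- The value at `λ_i` is `c(0)` times a column of the invertible matrix `g_i(0)`, so it is nonzero
  -- exactly when `c(0)` is.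
  have key : ∀ c : ℂ⟦X⟧, jetVec v = jet (k i) c • F.formalEigenvector d i j →
      ∀ s : Fin (k i), (s : ℕ) = 0 → v s = PowerSeries.constantCoeff c •
        ((F.g d i).map PowerSeries.constantCoeff).mulVec (Pi.single j 1) := by
    intro c hc s hs
    have h1 : jetVec v = fun r => jet (k i) (c * F.g d i r j) := by
      rw [hc]
      funext r
      simp [formalEigenvector]
    rw [jetVec_eq_iff] at h1
    funext r
    rw [h1 s r, hs]
    simp
  constructor
  · rintro ⟨hv, c, hc⟩
    obtain ⟨c, rfl⟩ := jet_surjective _ c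
    refine ⟨c, fun h0 => hv ⟨0, hk i⟩ rfl ?_, hc⟩
    rw [key c hc _ rfl, h0, zero_smul]
  · rintro ⟨c, hc0, hc⟩
    refine ⟨fun s hs h => ?_, jet (k i) c, hc⟩
    rw [key c hc s hs, smul_eq_zero, or_iff_right hc0] at h
    obtain ⟨H, -, hHG⟩ := isUnit_iff_exists.1 (F.isUnit_map_g hd.1 i PowerSeries.constantCoeff)
    have h2 := congrArg H.mulVec h
    rw [Matrix.mulVec_mulVec, hHG, Matrix.one_mulVec, Matrix.mulVec_zero] at h2
    simpa using congrFun h2 j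

end SystemFamily

/-! ### Expansion of a series in powers of `w = x * r`. -/

/-- The series `(f - f(0)) / x`. -/
def divX (f : ℂ⟦X⟧) : ℂ⟦X⟧ := PowerSeries.mk fun n => PowerSeries.coeff (n + 1) f

theorem eq_C_add_X_mul_divX (f : ℂ⟦X⟧) :
    f = PowerSeries.C (PowerSeries.constantCoeff f) + PowerSeries.X * divX f := by
  conv_lhs => rw [PowerSeries.eq_X_mul_shift_add_const f]
  rw [add_comm]
  rfl

/-- The series `(f - f(0)) / w`, where `w = x * r`. -/
def wShift (r f : ℂ⟦X⟧) : ℂ⟦X⟧ := divX f * r⁻¹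

/-- The coefficient of `w ^ s` in the expansion of `f` in powers of `w = x * r`. -/
def wCoeff (r : ℂ⟦X⟧) (s : ℕ) (f : ℂ⟦X⟧) : ℂ := PowerSeries.constantCoeff ((wShift r)^[s] f)

theorem eq_C_add_mul_wShift {r : ℂ⟦X⟧} (hr : PowerSeries.constantCoeff r ≠ 0) (f : ℂ⟦X⟧) :
    f = PowerSeries.C (PowerSeries.constantCoeff f) + PowerSeries.X * r * wShift r f := by
  conv_lhs => rw [eq_C_add_X_mul_divX f]
  rw [wShift]
  linear_combination (-PowerSeries.X * divX f) * PowerSeries.inv_mul_cancel r hr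

/-- Repeated division by `w`; the remainder after `K` steps is a multiple of `w ^ K`, hence of `x ^
K`. -/
theorem sum_wCoeff {r : ℂ⟦X⟧} (hr : PowerSeries.constantCoeff r ≠ 0) (K : ℕ) (f : ℂ⟦X⟧) :
    f = ∑ s ∈ Finset.range K, PowerSeries.C (wCoeff r s f) * (PowerSeries.X * r) ^ s +
      (PowerSeries.X * r) ^ K * (wShift r)^[K] f := by
  induction K with
  | zero => simp
  | succ K ih =>
    rw [Finset.sum_range_succ]
    have h := eq_C_add_mul_wShift hr ((wShift r)^[K] f)
    rw [← Function.iterate_succ_apply' (wShift r)] at h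
    rw [wCoeff]
    linear_combination ih + (PowerSeries.X * r) ^ K * h

theorem jet_sum_wCoeff {r : ℂ⟦X⟧} (hr : PowerSeries.constantCoeff r ≠ 0) (K : ℕ) (f : ℂ⟦X⟧) :
    jet K f =
      jet K (∑ s ∈ Finset.range K, PowerSeries.C (wCoeff r s f) * (PowerSeries.X * r) ^ s) := by
  conv_lhs => rw [sum_wCoeff hr K f, map_add, map_mul, mul_pow, map_mul (jet K) (_ ^ K), map_pow,
    jet_X_pow, zero_mul, zero_mul, add_zero]

/-- Uniqueness of the expansion. The constant term gives `c 0 = 0`; dividing by `x * r` then lowers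
`K` by one. -/
theorem eq_zero_of_jet_sum_eq_zero {r : ℂ⟦X⟧} (hr : PowerSeries.constantCoeff r ≠ 0) {K : ℕ}
    {c : ℕ → ℂ} (h : jet K
      (∑ s ∈ Finset.range K, PowerSeries.C (c s) * (PowerSeries.X * r) ^ s) = 0) :
    ∀ s < K, c s = 0 := by
  induction K generalizing c with
  | zero => intro s hs; omega
  | succ K ih =>
    rw [jet_eq_zero_iff, Finset.sum_range_succ'] at h
    have h0 : c 0 = 0 := by
      have := PowerSeries.X_pow_dvd_iff.1 h 0 (Nat.succ_pos K)
      simpa using this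
    have h1 : PowerSeries.X ^ (K + 1) ∣ PowerSeries.X *
        (r * ∑ s ∈ Finset.range K, PowerSeries.C (c (s + 1)) * (PowerSeries.X * r) ^ s) := by
      convert h using 1
      rw [h0, map_zero, zero_mul, add_zero, Finset.mul_sum, Finset.mul_sum]
      exact Finset.sum_congr rfl fun s _ => by ring1
    rw [pow_succ', mul_dvd_mul_iff_left PowerSeries.X_ne_zero,
      (isUnit_of_constantCoeff_ne_zero hr).dvd_mul_left, ← jet_eq_zero_iff] at h1
    intro s hs
    cases s with
    | zero => exact h0
    | succ s => exact ih h1 s (Nat.lt_of_succ_lt_succ hs)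

theorem wCoeff_eq_of_jet_eq {r : ℂ⟦X⟧} (hr : PowerSeries.constantCoeff r ≠ 0) {K : ℕ}
    {c : ℕ → ℂ} {f : ℂ⟦X⟧} (h : jet K f =
      jet K (∑ s ∈ Finset.range K, PowerSeries.C (c s) * (PowerSeries.X * r) ^ s))
    {s : ℕ} (hs : s < K) : wCoeff r s f = c s := by
  rw [jet_sum_wCoeff hr K f, ← sub_eq_zero, ← map_sub, ← Finset.sum_sub_distrib] at h
  refine sub_eq_zero.1 (eq_zero_of_jet_sum_eq_zero (c := fun s => wCoeff r s f - c s) hr ?_ s hs)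
  rw [← h]
  congr 1
  exact Finset.sum_congr rfl fun s _ => by rw [map_sub, sub_mul]

/-! ### Families of power series with holomorphic coefficients. -/

section Families

variable {E : Type*} [NormedAddCommGroup E] [NormedSpace ℂ E] {W : Set E}

/-- A family of power series with holomorphic coefficients. -/
def HolSeries (W : Set E) (f : E → ℂ⟦X⟧) : Prop :=
  ∀ n, DifferentiableOn ℂ (fun d => PowerSeries.coeff n (f d)) W

theorem HolSeries.mono {V : Set E} {f : E → ℂ⟦X⟧} (hf : HolSeries W f) (h : V ⊆ W) :
    HolSeries V f := fun n => (hf n).mono h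

theorem HolSeries.const (f : ℂ⟦X⟧) : HolSeries W fun _ => f := fun _ => differentiableOn_const _

theorem HolSeries.C {c : E → ℂ} (hc : DifferentiableOn ℂ c W) :
    HolSeries W fun d => PowerSeries.C (c d) := by
  intro n
  simp only [PowerSeries.coeff_C]
  by_cases h : n = 0
  · simpa [h] using hc
  · simp [h]

theorem HolSeries.add {f g : E → ℂ⟦X⟧} (hf : HolSeries W f) (hg : HolSeries W g) :
    HolSeries W fun d => f d + g d := by
  intro n
  simp only [map_add]
  exact (hf n).add (hg n)

theorem HolSeries.sub {f g : E → ℂ⟦X⟧} (hf : HolSeries W f) (hg : HolSeries W g) :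
    HolSeries W fun d => f d - g d := by
  intro n
  simp only [map_sub]
  exact (hf n).sub (hg n)

theorem HolSeries.mul {f g : E → ℂ⟦X⟧} (hf : HolSeries W f) (hg : HolSeries W g) :
    HolSeries W fun d => f d * g d := by
  intro n
  simp only [PowerSeries.coeff_mul]
  exact DifferentiableOn.fun_sum fun x _ => (hf x.1).mul (hg x.2)

theorem HolSeries.sum {ι : Type*} {s : Finset ι} {f : ι → E → ℂ⟦X⟧}
    (hf : ∀ i ∈ s, HolSeries W (f i)) : HolSeries W fun d => ∑ i ∈ s, f i d := by
  intro n
  simp only [map_sum]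
  exact DifferentiableOn.fun_sum fun i hi => hf i hi n

theorem HolSeries.pow {f : E → ℂ⟦X⟧} (hf : HolSeries W f) (N : ℕ) :
    HolSeries W fun d => f d ^ N := by
  induction N with
  | zero => simpa using HolSeries.const 1
  | succ N ih => simpa only [pow_succ] using ih.mul hf

theorem HolSeries.prod {ι : Type*} {s : Finset ι} {f : ι → E → ℂ⟦X⟧}
    (hf : ∀ i ∈ s, HolSeries W (f i)) : HolSeries W fun d => ∏ i ∈ s, f i d := by
  classical
  induction s using Finset.induction_on with
  | empty => simpa using HolSeries.const 1
  | insert i s hi ih =>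
    simp only [Finset.prod_insert hi]
    exact (hf i (Finset.mem_insert_self i s)).mul
      (ih fun j hj => hf j (Finset.mem_insert_of_mem hj))

theorem HolSeries.derivative {f : E → ℂ⟦X⟧} (hf : HolSeries W f) :
    HolSeries W fun d => PowerSeries.derivative (R := ℂ) (f d) := by
  intro n
  simp only [PowerSeries.coeff_derivative]
  exact (hf (n + 1)).mul_const _

theorem HolSeries.divX {f : E → ℂ⟦X⟧} (hf : HolSeries W f) : HolSeries W fun d => divX (f d) := by
  intro n
  simp only [Isomonodromy.divX, PowerSeries.coeff_mk]
  exact hf (n + 1)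

theorem HolSeries.constantCoeff {f : E → ℂ⟦X⟧} (hf : HolSeries W f) :
    DifferentiableOn ℂ (fun d => PowerSeries.constantCoeff (f d)) W := by
  simpa using hf 0

/-- The recursion for the coefficients of the inverse divides only by the constant term. -/
theorem HolSeries.inv {f : E → ℂ⟦X⟧} (hf : HolSeries W f)
    (h0 : ∀ d ∈ W, PowerSeries.constantCoeff (f d) ≠ 0) : HolSeries W fun d => (f d)⁻¹ := by
  intro n
  induction n using Nat.strong_induction_on with
  | _ n ih =>
    rw [show (fun d => PowerSeries.coeff n (f d)⁻¹) = _ from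
      funext fun d => PowerSeries.coeff_inv n (f d)]
    split_ifs with hn
    · exact hf.constantCoeff.inv h0
    · refine (hf.constantCoeff.inv h0).neg.mul (DifferentiableOn.fun_sum fun x _ => ?_)
      split_ifs with hx
      · exact (hf x.1).mul (ih x.2 hx)
      · exact differentiableOn_const _

theorem HolSeries.wCoeff {r f : E → ℂ⟦X⟧} (hr : HolSeries W r)
    (h0 : ∀ d ∈ W, PowerSeries.constantCoeff (r d) ≠ 0) (hf : HolSeries W f) (s : ℕ) :
    DifferentiableOn ℂ (fun d => wCoeff (r d) s (f d)) W := by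
  have h : HolSeries W fun d => (wShift (r d))^[s] (f d) := by
    induction s with
    | zero => exact hf
    | succ s ih =>
      simp only [Function.iterate_succ_apply']
      exact ih.divX.mul (hr.inv h0)
  exact h.constantCoeff

end Families

/-! ### Variation of the expansion of `x` in powers of `w`. -/

/-- `f'` is the coefficientwise derivative at `τ` of the family `f` of power series. -/
def HasSerDerivAt (f : ℂ → ℂ⟦X⟧) (f' : ℂ⟦X⟧) (τ : ℂ) : Prop :=
  ∀ n, HasDerivAt (fun z => PowerSeries.coeff n (f z)) (PowerSeries.coeff n f') τ

theorem HasSerDerivAt.mul {f g : ℂ → ℂ⟦X⟧} {f' g' : ℂ⟦X⟧} {τ : ℂ} (hf : HasSerDerivAt f f' τ)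
    (hg : HasSerDerivAt g g' τ) :
    HasSerDerivAt (fun z => f z * g z) (f' * g τ + f τ * g') τ := by
  intro n
  simp only [PowerSeries.coeff_mul, map_add]
  rw [← Finset.sum_add_distrib]
  exact HasDerivAt.fun_sum fun x _ => (hf x.1).mul (hg x.2)

theorem HasSerDerivAt.const (f : ℂ⟦X⟧) (τ : ℂ) : HasSerDerivAt (fun _ => f) 0 τ := by
  intro n
  rw [map_zero]
  exact hasDerivAt_const _ _

theorem HasSerDerivAt.C {c : ℂ → ℂ} {c' τ : ℂ} (hc : HasDerivAt c c' τ) :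
    HasSerDerivAt (fun z => PowerSeries.C (c z)) (PowerSeries.C c') τ := by
  intro n
  simp only [PowerSeries.coeff_C]
  by_cases h : n = 0
  · simpa [h] using hc
  · simpa [h] using hasDerivAt_const _ _

theorem HasSerDerivAt.pow {f : ℂ → ℂ⟦X⟧} {f' : ℂ⟦X⟧} {τ : ℂ} (hf : HasSerDerivAt f f' τ) (N : ℕ) :
    HasSerDerivAt (fun z => f z ^ N) ((N : ℂ⟦X⟧) * f τ ^ (N - 1) * f') τ := by
  induction N with
  | zero => simpa using HasSerDerivAt.const 1 τ
  | succ N ih =>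
    have h := ih.mul hf
    simp only [← pow_succ] at h
    convert h using 1
    rcases N with _ | N
    · simp
    · simp only [Nat.add_sub_cancel]
      push_cast
      ring

theorem HasSerDerivAt.sum {ι : Type*} {s : Finset ι} {f : ι → ℂ → ℂ⟦X⟧} {f' : ι → ℂ⟦X⟧} {τ : ℂ}
    (hf : ∀ i ∈ s, HasSerDerivAt (f i) (f' i) τ) :
    HasSerDerivAt (fun z => ∑ i ∈ s, f i z) (∑ i ∈ s, f' i) τ := by
  intro n
  simp only [map_sum]
  exact HasDerivAt.fun_sum fun i hi => hf i hi n

/-- A family that is constant modulo `x ^ K` has a derivative that vanishes modulo `x ^ K`. -/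
theorem HasSerDerivAt.jet_eq_zero {f : ℂ → ℂ⟦X⟧} {f' c : ℂ⟦X⟧} {τ : ℂ} {K : ℕ}
    (hf : HasSerDerivAt f f' τ) (h : ∀ᶠ z in nhds τ, jet K (f z) = jet K c) :
    jet K f' = 0 := by
  rw [jet_eq_zero_iff, PowerSeries.X_pow_dvd_iff]
  intro n hn
  have h1 : (fun z => PowerSeries.coeff n (f z)) =ᶠ[nhds τ] fun _ => PowerSeries.coeff n c := by
    filter_upwards [h] with z hz
    exact jet_eq_iff_coeff.1 hz n hn
  exact (hf n).unique ((hasDerivAt_const τ (PowerSeries.coeff n c)).congr_of_eventuallyEq h1)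

/-- Differentiation in `x` costs one order of precision, which multiplication by `x` restores in
`jet_X_mul`. -/
theorem jet_derivative {K : ℕ} {f g : ℂ⟦X⟧} (h : jet K f = jet K g) :
    jet (K - 1) (PowerSeries.derivative (R := ℂ) f) =
      jet (K - 1) (PowerSeries.derivative (R := ℂ) g) := by
  rw [jet_eq_iff_coeff] at h ⊢
  intro n hn
  rw [PowerSeries.coeff_derivative, PowerSeries.coeff_derivative, h (n + 1) (by omega)]

theorem jet_X_mul {K : ℕ} {f g : ℂ⟦X⟧} (h : jet (K - 1) f = jet (K - 1) g) :
    jet K (PowerSeries.X * f) = jet K (PowerSeries.X * g) := by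
  rw [jet_eq_iff_coeff] at h ⊢
  intro n hn
  cases n with
  | zero => simp
  | succ n => rw [PowerSeries.coeff_succ_X_mul, PowerSeries.coeff_succ_X_mul, h n (by omega)]

/-- The variation of the coefficients of the expansion of `x` in powers of `w = x * r`, where
`r ^ (K - 1) * t = 1` modulo `x ^ (K - 1)`. -/
theorem hasDerivAt_wCoeff_X {K : ℕ} (hK : 1 ≤ K) {r t : ℂ → ℂ⟦X⟧} {r' t' b : ℂ⟦X⟧} {τ : ℂ}
    (hr : HasSerDerivAt r r' τ) (ht : HasSerDerivAt t t' τ)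
    (hr0 : ∀ᶠ z in nhds τ, PowerSeries.constantCoeff (r z) ≠ 0)
    (hrt : ∀ᶠ z in nhds τ, jet (K - 1) (r z ^ (K - 1) * t z) = 1)
    (hb : jet (K - 1) b = jet (K - 1) (PowerSeries.C (1 - (K : ℂ)) * t τ +
      PowerSeries.X * PowerSeries.derivative (R := ℂ) (t τ)))
    (hb0 : PowerSeries.constantCoeff b ≠ 0) {a' : ℕ → ℂ}
    (ha : ∀ n, HasDerivAt (fun z => wCoeff (r z) n PowerSeries.X) (a' n) τ) {n : ℕ} (hn : n < K) :
    a' n = wCoeff (r τ) n (-(PowerSeries.X * (t' * b⁻¹))) := by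
  have hr0τ := hr0.self_of_nhds
  have hrtτ := hrt.self_of_nhds
  -- By uniqueness of the expansion it is enough that `∑ a'_s w ^ s` and `-x t' / b` agree modulo `x
  -- ^ K`.
  refine (wCoeff_eq_of_jet_eq hr0τ ?_ hn).symm
  set D := PowerSeries.derivative (R := ℂ) with hD
  set w : ℂ → ℂ⟦X⟧ := fun z => PowerSeries.X * r z with hw
  set a : ℕ → ℂ → ℂ := fun n z => wCoeff (r z) n PowerSeries.X with ha_def
  -- `P` is `dx/dw`.
  set P : ℂ⟦X⟧ := ∑ s ∈ Finset.range K,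
    PowerSeries.C (a s τ) * ((s : ℂ⟦X⟧) * w τ ^ (s - 1)) with hP
  have hwd : HasSerDerivAt w (PowerSeries.X * r') τ := by
    have := (HasSerDerivAt.const PowerSeries.X τ).mul hr
    simpa using this
  -- The derivative of `x = ∑ a_s w ^ s` in the parameter, with `x` fixed.
  have h1 : jet K (∑ s ∈ Finset.range K, PowerSeries.C (a' s) * w τ ^ s) +
      jet K (P * (PowerSeries.X * r')) = 0 := by
    have h := HasSerDerivAt.sum (s := Finset.range K)
      fun s _ => (HasSerDerivAt.C (ha s)).mul (hwd.pow s)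
    have h2 := h.jet_eq_zero (K := K) (c := PowerSeries.X) (by
      filter_upwards [hr0] with z hz
      exact (jet_sum_wCoeff hz K PowerSeries.X).symm)
    rw [Finset.sum_add_distrib, map_add] at h2
    rw [← h2, hP, Finset.sum_mul]
    congr 2
    exact Finset.sum_congr rfl fun s _ => by ring1
  -- The derivative of the same identity in `x`: `(dx/dw) (dw/dx) = 1`.
  have h2 : jet (K - 1) P * jet (K - 1) (D (w τ)) = 1 := by
    have h := jet_derivative (jet_sum_wCoeff hr0τ K PowerSeries.X)
    rw [PowerSeries.derivative_X, map_one, map_sum] at h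
    rw [← map_mul, h, hP, Finset.sum_mul]
    congr 1
    refine Finset.sum_congr rfl fun s _ => ?_
    symm
    rw [Derivation.leibniz, PowerSeries.derivative_C, smul_zero, add_zero,
      PowerSeries.derivative_pow, smul_eq_mul]
    ring1
  have hDw : D (w τ) = r τ + PowerSeries.X * D (r τ) := by
    rw [hw, Derivation.leibniz, PowerSeries.derivative_X, smul_eq_mul, smul_eq_mul]
    ring1
  have hru : ∀ m, IsUnit (jet (K - 1) (r τ ^ m)) := fun m =>
    ((isUnit_of_constantCoeff_ne_zero hr0τ).pow m).map _
  suffices hmain : jet (K - 1) (P * r') = jet (K - 1) (t' * b⁻¹) by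
    have h := jet_X_mul hmain
    rw [map_neg, ← h, ← add_eq_zero_iff_neg_eq, ← h1, add_comm]
    congr 2
    ring1
  -- For `K = 1` the congruence is modulo `x ^ 0` and is empty.
  rcases Nat.eq_or_lt_of_le hK with hK1 | hK1
  · rw [← hK1]
    rw [jet_eq_iff_coeff]
    intro n hn
    omega
  have hN : r τ ^ (K - 1) = r τ ^ (K - 1 - 1) * r τ := by
    rw [← pow_succ]
    congr 1
    omega
  -- The parameter derivative of `r ^ (K - 1) t = 1`, divided by the unit `r ^ (K - 2)`.
  have h3 : ((K - 1 : ℕ) : Jet (K - 1)) * jet (K - 1) r' * jet (K - 1) (t τ) +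
      jet (K - 1) (r τ) * jet (K - 1) t' = 0 := by
    have h := ((hr.pow (K - 1)).mul ht).jet_eq_zero (K := K - 1) (c := 1) (by
      filter_upwards [hrt] with z hz
      rw [hz, map_one])
    refine (hru (K - 1 - 1)).mul_right_eq_zero.1 ?_
    rw [← h]
    rw [hN]
    simp only [map_add, map_mul, map_pow, map_natCast]
    ring1
  -- The `x`-derivative of the same relation, multiplied by `x` to recover the lost order.
  have h4 : jet (K - 1) (PowerSeries.X * (((K - 1 : ℕ) : ℂ⟦X⟧) * D (r τ) * t τ + r τ * D (t τ))) =
      0 := by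
    have h := jet_derivative (hrtτ.trans (map_one (jet (K - 1))).symm)
    rw [PowerSeries.derivative_one, Derivation.leibniz, PowerSeries.derivative_pow] at h
    have h' := jet_X_mul h
    rw [mul_zero, map_zero] at h'
    refine (hru (K - 1 - 1)).mul_right_eq_zero.1 ?_
    rw [← h', ← map_mul]
    congr 1
    rw [hN]
    simp only [smul_eq_mul]
    ring1
  have hC : (PowerSeries.C (1 - (K : ℂ)) : ℂ⟦X⟧) = -((K - 1 : ℕ) : ℂ⟦X⟧) := by
    rw [← map_natCast (PowerSeries.C (R := ℂ)), ← map_neg]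
    congr 1
    push_cast [hK]
    ring1
  -- `b` is `-(K - 1) t` times the logarithmic derivative `x w' / w`.
  have h5 : jet (K - 1) b * jet (K - 1) (r τ) =
      -(((K - 1 : ℕ) : Jet (K - 1)) * jet (K - 1) (t τ) * jet (K - 1) (D (w τ))) := by
    rw [hb, hC, hDw]
    simp only [map_add, map_mul, map_neg, map_natCast] at h4 ⊢
    linear_combination h4
  have hbu : jet (K - 1) b * jet (K - 1) b⁻¹ = 1 := by
    rw [← map_mul, PowerSeries.mul_inv_cancel _ hb0, map_one]
  have hNu : IsUnit ((K - 1 : ℕ) : Jet (K - 1)) := by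
    rw [← map_natCast (jet (K - 1)), ← map_natCast (PowerSeries.C (R := ℂ))]
    refine ((IsUnit.map _ ?_).map _)
    rw [isUnit_iff_ne_zero, Nat.cast_ne_zero]
    omega
  have htu : IsUnit (jet (K - 1) (t τ)) := by
    rw [map_mul] at hrtτ
    exact IsUnit.of_mul_eq_one_right _ hrtτ
  -- Combining the three relations gives `b P r' = t'` up to the factor `(K - 1) t`, which is a
  -- unit.
  have hfin : ((K - 1 : ℕ) : Jet (K - 1)) * jet (K - 1) (t τ) *
      (jet (K - 1) b * (jet (K - 1) P * jet (K - 1) r') - jet (K - 1) t') = 0 := by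
    linear_combination jet (K - 1) b * jet (K - 1) P * h3 -
      jet (K - 1) P * jet (K - 1) t' * h5 +
      ((K - 1 : ℕ) : Jet (K - 1)) * jet (K - 1) (t τ) * jet (K - 1) t' * h2
  have hfin' := (hNu.mul htu).mul_right_eq_zero.1 hfin
  rw [map_mul, map_mul]
  linear_combination jet (K - 1) b⁻¹ * hfin' - jet (K - 1) P * jet (K - 1) r' * hbu

theorem divX_add (f g : ℂ⟦X⟧) : divX (f + g) = divX f + divX g := by
  ext n
  simp [divX]

theorem divX_C (c : ℂ) : divX (PowerSeries.C c) = 0 := by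
  ext n
  simp [divX]

theorem wShift_add (r f g : ℂ⟦X⟧) : wShift r (f + g) = wShift r f + wShift r g := by
  rw [wShift, divX_add, add_mul]
  rfl

/-- A constant is removed by the first division, so `λ_i` enters only the coefficient of `w ^ 0`. -/
theorem wCoeff_add_succ_C (r : ℂ⟦X⟧) (c : ℂ) (f : ℂ⟦X⟧) (n : ℕ) :
    wCoeff r (n + 1) (PowerSeries.C c + f) = wCoeff r (n + 1) f := by
  rw [wCoeff, wCoeff, Function.iterate_succ_apply, Function.iterate_succ_apply, wShift_add]
  congr 2
  rw [wShift, divX_C, zero_mul, zero_add]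

theorem wCoeff_zero (r f : ℂ⟦X⟧) : wCoeff r 0 f = PowerSeries.constantCoeff f := rfl

/-! ### The series `t_ij`, `β_ij` and the roots as functions of the parameters. -/

theorem coeff_tSer (i : Fin p) (j : Fin ℓ) (d : Params p ℓ k) (n : ℕ) :
    PowerSeries.coeff n (tSer i j d) = if h : n < k i - 1 then d.2 i j ⟨n, h⟩ else 0 := by
  simp only [tSer, tPoly, Polynomial.coeff_coe, LinearMap.sum_apply, LinearMap.comp_apply,
    LinearMap.proj_apply, LinearMap.snd_apply, Polynomial.finsetSum_coeff,
    Polynomial.coeff_monomial]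
  split_ifs with h
  · rw [Finset.sum_eq_single ⟨n, h⟩]
    · simp
    · intro s _ hs
      rw [if_neg]
      rintro rfl
      exact hs rfl
    · simp
  · rw [Finset.sum_eq_zero]
    intro s _
    rw [if_neg]
    rintro rfl
    exact h s.isLt

/-- `t_ij` has degree at most `k_i - 2`, so reduction modulo `x ^ (k_i - 1)` loses nothing. -/
theorem tSer_eq_zero_iff {i : Fin p} {j : Fin ℓ} {d : Params p ℓ k} :
    jet (k i - 1) (tSer i j d) = 0 ↔ d.2 i j = 0 := by
  rw [← map_zero (jet (k i - 1)), jet_eq_iff_coeff, funext_iff]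
  constructor
  · intro h n
    have := h n n.isLt
    simpa [coeff_tSer] using this
  · intro h n hn
    have := h ⟨n, hn⟩
    simpa [coeff_tSer, hn] using this

theorem tSer_add_smul (i : Fin p) (j : Fin ℓ) (d Y : Params p ℓ k) (z : ℂ) :
    tSer i j (d + z • Y) = tSer i j d + PowerSeries.C z * tSer i j Y := by
  ext n
  simp only [map_add, PowerSeries.coeff_C_mul, coeff_tSer]
  split_ifs with h <;> simp

theorem holSeries_tSer (i : Fin p) (j : Fin ℓ) (W : Set (Params p ℓ k)) :
    HolSeries W fun d => tSer i j d := by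
  intro n
  simp only [coeff_tSer]
  split_ifs with h
  · fun_prop
  · exact differentiableOn_const _

theorem holSeries_betaSer (m : Fin p → Fin ℓ → ℂ) (i : Fin p) (j : Fin ℓ)
    (W : Set (Params p ℓ k)) : HolSeries W fun d => betaSer m d i j :=
  (((HolSeries.const _).mul (holSeries_tSer i j W)).add
    ((HolSeries.const _).mul (holSeries_tSer i j W).derivative)).add (HolSeries.const _)

/-- The exponents `m_ij` enter `β_ij` only at order `x ^ (k_i - 1)`, which is invisible here; this
is why the coordinates do not involve them. -/
theorem jet_betaSer (m : Fin p → Fin ℓ → ℂ) (d : Params p ℓ k) (i : Fin p) (j : Fin ℓ) :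
    jet (k i - 1) (betaSer m d i j) = jet (k i - 1) (PowerSeries.C (1 - (k i : ℂ)) * tSer i j d +
      PowerSeries.X * PowerSeries.derivative (R := ℂ) (tSer i j d)) := by
  rw [betaSer, map_add _ (_ + _), map_mul _ (PowerSeries.C (m i j)), map_pow, jet_X_pow, mul_zero,
    add_zero]

/-- A unit series `r` such that `w_ij = x_i * r` modulo `x_i ^ k_i`. -/
def rootSer (w : Params p ℓ k → Fin p → Fin ℓ → ℂ[X]) (d : Params p ℓ k) (i : Fin p)
    (j : Fin ℓ) : ℂ⟦X⟧ :=
  if k i = 1 then 1 else divX (w d i j : ℂ⟦X⟧)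

namespace IsRootBranch

variable {W : Set (Params p ℓ k)} {w : Params p ℓ k → Fin p → Fin ℓ → ℂ[X]}

/-- Truncation keeps the exact root `r` only modulo `x ^ (k_i - 1)`. This suffices, as `w_ij = x r`
is needed modulo `x ^ k_i`. If `k_i = 1`, any unit would serve in place of `r`. -/
theorem exists_root (hk : ∀ i, 1 ≤ k i) (hw : IsRootBranch W w) {d : Params p ℓ k} (hd : d ∈ W)
    (i : Fin p) (j : Fin ℓ) : ∃ r : ℂ⟦X⟧, PowerSeries.constantCoeff r ≠ 0 ∧
      jet (k i - 1) (rootSer w d i j) = jet (k i - 1) r ∧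
      jet (k i - 1) (r ^ (k i - 1) * tSer i j d) = 1 ∧
      PowerSeries.constantCoeff (rootSer w d i j) = PowerSeries.constantCoeff r ∧
      jet (k i) (w d i j : ℂ⟦X⟧) = jet (k i) (PowerSeries.X * rootSer w d i j) := by
  rcases Nat.eq_or_lt_of_le (hk i) with h1 | h1
  · refine ⟨1, by simp, ?_, ?_, ?_, ?_⟩
    · rw [rootSer, if_pos h1.symm]
    · rw [← map_one (jet (k i - 1)), jet_eq_iff_coeff]
      intro n hn
      omega
    · rw [rootSer, if_pos h1.symm]
    · rw [((hw i j).2 d hd).1 h1.symm, jet_eq_iff_coeff]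
      intro n hn
      obtain rfl : n = 0 := by omega
      simp
  · obtain ⟨r, hr, hwr⟩ := ((hw i j).2 d hd).2 h1
    have hc : ∀ n, PowerSeries.coeff n (w d i j : ℂ⟦X⟧) =
        if n < k i then PowerSeries.coeff n (PowerSeries.X * r) else 0 := by
      intro n
      rw [Polynomial.coeff_coe, hwr, PowerSeries.coeff_trunc]
    have hroot : rootSer w d i j = divX (w d i j : ℂ⟦X⟧) := by rw [rootSer, if_neg (by omega)]
    have hcoe : ∀ n < k i - 1, PowerSeries.coeff n (rootSer w d i j) = PowerSeries.coeff n r := by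
      intro n hn
      rw [hroot, divX, PowerSeries.coeff_mk, hc, if_pos (by omega), PowerSeries.coeff_succ_X_mul]
    refine ⟨r, ?_, jet_eq_iff_coeff.2 hcoe, ?_, ?_, ?_⟩
    · intro h0
      have h2 := congrArg PowerSeries.constantCoeff hr
      rw [map_mul, map_pow, h0, zero_pow (by omega), zero_mul, map_one] at h2
      exact zero_ne_one h2
    · exact (congrArg (jet (k i - 1)) hr).trans (map_one _)
    · simpa using hcoe 0 (by omega)
    · congr 1
      conv_lhs => rw [eq_C_add_X_mul_divX (w d i j : ℂ⟦X⟧)]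
      have h3 := hc 0
      rw [if_pos (by omega), PowerSeries.coeff_zero_X_mul,
        PowerSeries.coeff_zero_eq_constantCoeff_apply] at h3
      rw [h3, map_zero, zero_add, hroot]

theorem constantCoeff_rootSer_ne_zero (hk : ∀ i, 1 ≤ k i) (hw : IsRootBranch W w)
    {d : Params p ℓ k} (hd : d ∈ W) (i : Fin p) (j : Fin ℓ) :
    PowerSeries.constantCoeff (rootSer w d i j) ≠ 0 := by
  obtain ⟨r, h0, -, -, h, -⟩ := hw.exists_root hk hd i j
  rwa [h]

theorem jet_rootSer_pow (hk : ∀ i, 1 ≤ k i) (hw : IsRootBranch W w)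
    {d : Params p ℓ k} (hd : d ∈ W) (i : Fin p) (j : Fin ℓ) :
    jet (k i - 1) (rootSer w d i j ^ (k i - 1) * tSer i j d) = 1 := by
  obtain ⟨r, -, h1, h2, -, -⟩ := hw.exists_root hk hd i j
  rw [← h2, map_mul, map_mul, map_pow, map_pow, h1]

theorem jet_eq (hk : ∀ i, 1 ≤ k i) (hw : IsRootBranch W w)
    {d : Params p ℓ k} (hd : d ∈ W) (i : Fin p) (j : Fin ℓ) :
    jet (k i) (w d i j : ℂ⟦X⟧) = jet (k i) (PowerSeries.X * rootSer w d i j) := by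
  obtain ⟨r, -, -, -, -, h⟩ := hw.exists_root hk hd i j
  exact h

theorem holSeries_rootSer (hw : IsRootBranch W w) (i : Fin p) (j : Fin ℓ) :
    HolSeries W fun d => rootSer w d i j := by
  unfold rootSer
  split_ifs
  · exact HolSeries.const 1
  · refine HolSeries.divX fun n => ?_
    simpa only [Polynomial.coeff_coe] using (hw i j).1 n

end IsRootBranch

/-! ### The coordinates `λ_i`, `a_ijn` and their differentials. -/

/-- The coefficients of the expansion of `x = λ_i + x_i` in powers of `w_ij`. -/
def xCoeff (w : Params p ℓ k → Fin p → Fin ℓ → ℂ[X]) (d : Params p ℓ k) (i : Fin p) (j : Fin ℓ)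
    (n : ℕ) : ℂ :=
  wCoeff (rootSer w d i j) n (PowerSeries.C (d.1 i) + PowerSeries.X)

/-- The poles and the higher coefficients of the expansion of `x` in powers of `w`. -/
def coordMap (w : Params p ℓ k → Fin p → Fin ℓ → ℂ[X]) (d : Params p ℓ k) : Params p ℓ k :=
  (d.1, fun i j n => xCoeff w d i j (n + 1))

theorem hasSerDerivAt_line {E : Type*} [NormedAddCommGroup E] [NormedSpace ℂ E] {W : Set E}
    (hW : IsOpen W) {f : E → ℂ⟦X⟧} (hf : HolSeries W f) {d : E} (hd : d ∈ W) (Y : E) :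
    ∃ f', HasSerDerivAt (fun z : ℂ => f (d + z • Y)) f' 0 := by
  refine ⟨PowerSeries.mk fun n => fderiv ℂ (fun d => PowerSeries.coeff n (f d)) d Y, fun n => ?_⟩
  have h1 := ((hf n).differentiableAt (hW.mem_nhds hd)).hasFDerivAt
  rw [PowerSeries.coeff_mk]
  exact HasFDerivAt.hasLineDerivAt h1 Y

theorem tendsto_line {E : Type*} [NormedAddCommGroup E] [NormedSpace ℂ E] {W : Set E}
    (hW : IsOpen W) {d : E} (hd : d ∈ W) (Y : E) :
    ∀ᶠ z : ℂ in nhds 0, d + z • Y ∈ W := by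
  have h : ContinuousAt (fun z : ℂ => d + z • Y) 0 := by fun_prop
  refine h.eventually_mem (hW.mem_nhds ?_)
  simpa using hd

section Coordinates

variable {W : Set (Params p ℓ k)} {w : Params p ℓ k → Fin p → Fin ℓ → ℂ[X]}

theorem differentiableOn_xCoeff (hk : ∀ i, 1 ≤ k i) (hw : IsRootBranch W w) (i : Fin p)
    (j : Fin ℓ) (n : ℕ) : DifferentiableOn ℂ (fun d => xCoeff w d i j n) W := by
  refine (hw.holSeries_rootSer i j).wCoeff
    (fun d hd => hw.constantCoeff_rootSer_ne_zero hk hd i j) ?_ n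
  refine HolSeries.add (HolSeries.C ?_) (HolSeries.const _)
  fun_prop

/-- The formula for the eigenvalues of `α` is free of `g_i`, whose dependence on `d` is arbitrary;
holomorphy of `α` in the frame rests on this. -/
theorem holSeries_alphaSer {m : Fin p → Fin ℓ → ℂ}
    (hm : ∀ d ∈ W, ∀ i j, PowerSeries.constantCoeff (betaSer m d i j) ≠ 0)
    (Y : Params p ℓ k) (i : Fin p) (j : Fin ℓ) :
    HolSeries W fun d => alphaSer m d Y i j :=
  (HolSeries.const _).sub ((HolSeries.const _).mul ((HolSeries.const _).mul
    ((holSeries_betaSer m i j W).inv fun d hd => hm d hd i j)))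

/-- The differential of the coefficients of `x` is given by `α`. -/
theorem fderiv_xCoeff (hk : ∀ i, 1 ≤ k i) (hW : IsOpen W) (hw : IsRootBranch W w)
    {m : Fin p → Fin ℓ → ℂ} {d : Params p ℓ k} (hd : d ∈ W) (i : Fin p) (j : Fin ℓ)
    (hm : PowerSeries.constantCoeff (betaSer m d i j) ≠ 0) (Y : Params p ℓ k)
    {n : ℕ} (hn : n < k i) :
    fderiv ℂ (fun d => xCoeff w d i j n) d Y =
      wCoeff (rootSer w d i j) n (alphaSer m d Y i j) := by
  rcases n with _ | n
  · have h1 : (fun d : Params p ℓ k => xCoeff w d i j 0) =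
        (ContinuousLinearMap.proj i : (Fin p → ℂ) →L[ℂ] ℂ) ∘L
          ContinuousLinearMap.fst ℂ (Fin p → ℂ) ((i : Fin p) → Fin ℓ → Fin (k i - 1) → ℂ) := by
      funext d
      simp [xCoeff, wCoeff_zero]
    rw [h1, ContinuousLinearMap.fderiv]
    simp [wCoeff_zero, alphaSer]
  · have hdiff := fun n => ((differentiableOn_xCoeff hk hw i j n).differentiableAt
      (hW.mem_nhds hd)).hasFDerivAt
    -- The constant coefficient of `x_i` is identically `0` whereas that of `λ_i + x_i` is not, so
    -- `n = 0` gets its own value.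
    have hline : ∀ n, HasDerivAt (fun z : ℂ => wCoeff (rootSer w (d + z • Y) i j) n PowerSeries.X)
        (if n = 0 then 0 else fderiv ℂ (fun d => xCoeff w d i j n) d Y) 0 := by
      intro n
      rcases n with _ | n
      · simpa [wCoeff_zero] using hasDerivAt_const (0 : ℂ) (0 : ℂ)
      · have h := HasFDerivAt.hasLineDerivAt (hdiff (n + 1)) Y
        simp only [HasLineDerivAt, xCoeff, wCoeff_add_succ_C] at h
        simpa [xCoeff, wCoeff_add_succ_C] using h
    obtain ⟨r', hr'⟩ := hasSerDerivAt_line hW (hw.holSeries_rootSer i j) hd Y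
    have ht : HasSerDerivAt (fun z : ℂ => tSer i j (d + z • Y)) (tSer i j Y) 0 := by
      intro n
      simp only [tSer_add_smul, map_add, PowerSeries.coeff_C_mul]
      simpa using ((hasDerivAt_id (0 : ℂ)).mul_const (PowerSeries.coeff n (tSer i j Y))).const_add
        (PowerSeries.coeff n (tSer i j d))
    have h := hasDerivAt_wCoeff_X (hk i) (b := betaSer m d i j) hr' ht
      (by
        filter_upwards [tendsto_line hW hd Y] with z hz
        exact hw.constantCoeff_rootSer_ne_zero hk hz i j)
      (by
        filter_upwards [tendsto_line hW hd Y] with z hz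
        exact hw.jet_rootSer_pow hk hz i j)
      (by rw [zero_smul, add_zero]; exact jet_betaSer m d i j) hm hline hn
    rw [if_neg (Nat.succ_ne_zero n), zero_smul, add_zero] at h
    rw [h, alphaSer, sub_eq_add_neg, wCoeff_add_succ_C]

theorem differentiableOn_coordMap (hk : ∀ i, 1 ≤ k i) (hw : IsRootBranch W w) :
    DifferentiableOn ℂ (coordMap w) W := by
  refine DifferentiableOn.prodMk (by fun_prop) ?_
  rw [differentiableOn_pi]; intro i
  rw [differentiableOn_pi]; intro j
  rw [differentiableOn_pi]; intro n
  exact differentiableOn_xCoeff hk hw i j _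

theorem fderiv_coordMap (hk : ∀ i, 1 ≤ k i) (hW : IsOpen W) (hw : IsRootBranch W w)
    {m : Fin p → Fin ℓ → ℂ}
    (hm : ∀ d ∈ W, ∀ i j, PowerSeries.constantCoeff (betaSer m d i j) ≠ 0)
    {d : Params p ℓ k} (hd : d ∈ W) (Y : Params p ℓ k) :
    fderiv ℂ (coordMap w) d Y =
      (Y.1, fun i j (n : Fin (k i - 1)) =>
        wCoeff (rootSer w d i j) (n + 1) (alphaSer m d Y i j)) := by
  have h := ((differentiableOn_coordMap hk hw).differentiableAt (hW.mem_nhds hd)).hasFDerivAt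
  refine Prod.ext ?_ ?_
  · have h1 := h.fst.unique (hasFDerivAt_fst (𝕜 := ℂ) (p := d))
    exact congrArg (fun L => L Y) h1
  · funext i j n
    have hn : (n : ℕ) + 1 < k i := by omega
    refine Eq.trans ?_ (fderiv_xCoeff hk hW hw hd i j (hm d hd i j) Y hn)
    have h1 := hasFDerivAt_pi'.1 (hasFDerivAt_pi'.1 (hasFDerivAt_pi'.1 h.snd i) j) n
    rw [show (fun d => xCoeff w d i j (n + 1)) = fun d => (coordMap w d).2 i j n from rfl,
      h1.fderiv]
    rfl

/-- A vector `Y` in the kernel has `Y.1 = 0`, and the expansion of its `alphaSer` vanishes up to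
order `k_i`. So `x t_ij(Y) / β_ij` vanishes modulo `x ^ k_i`; cancelling `x` and the unit leaves
`t_ij(Y) = 0` modulo `x ^ (k_i - 1)`, which determines it. -/
theorem fderiv_coordMap_injective (hk : ∀ i, 1 ≤ k i) (hW : IsOpen W) (hw : IsRootBranch W w)
    {m : Fin p → Fin ℓ → ℂ}
    (hm : ∀ d ∈ W, ∀ i j, PowerSeries.constantCoeff (betaSer m d i j) ≠ 0)
    {d : Params p ℓ k} (hd : d ∈ W) : Function.Injective (fderiv ℂ (coordMap w) d) := by
  rw [injective_iff_map_eq_zero]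
  intro Y hY
  rw [fderiv_coordMap hk hW hw hm hd] at hY
  have h1 : Y.1 = 0 := congrArg Prod.fst hY
  refine Prod.ext h1 ?_
  funext i j
  rw [Prod.snd_zero, Pi.zero_apply, Pi.zero_apply, ← tSer_eq_zero_iff]
  have h2 : ∀ n < k i, wCoeff (rootSer w d i j) n (alphaSer m d Y i j) = 0 := by
    intro n hn
    rcases n with _ | n
    · simp [wCoeff_zero, alphaSer, h1]
    · exact congrFun (congrFun (congrFun (congrArg Prod.snd hY) i) j) ⟨n, by omega⟩
  have h3 := jet_sum_wCoeff (hw.constantCoeff_rootSer_ne_zero hk hd i j) (k i) (alphaSer m d Y i j)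
  rw [Finset.sum_eq_zero fun s hs => by rw [h2 s (Finset.mem_range.1 hs), map_zero, zero_mul],
    map_zero, jet_eq_zero_iff, alphaSer, h1, Pi.zero_apply, map_zero, zero_sub, dvd_neg] at h3
  have hki : k i = k i - 1 + 1 := by have := hk i; omega
  rw [jet_eq_zero_iff]
  rw [hki, pow_succ', mul_dvd_mul_iff_left PowerSeries.X_ne_zero] at h3
  refine (IsUnit.dvd_mul_right (isUnit_of_constantCoeff_ne_zero ?_)).1 h3
  rw [PowerSeries.constantCoeff_inv]
  exact inv_ne_zero (hm d hd i j)

/-- An injective endomorphism in finite dimension is invertible, and a continuous derivative is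
strict, so the inverse function theorem applies. -/
theorem isLocalCoordinates_of_fderiv {φ : Params p ℓ k → Params p ℓ k} (hW : IsOpen W)
    (hφ : DifferentiableOn ℂ φ W) (hcont : ∀ Y, ContinuousOn (fun d => fderiv ℂ φ d Y) W)
    (hinj : ∀ d ∈ W, Function.Injective (fderiv ℂ φ d)) : IsLocalCoordinates φ W := by
  refine ⟨hφ, fun d hd => ?_⟩
  have hder : ∀ d ∈ W, HasFDerivAt φ (fderiv ℂ φ d) d := fun d hd =>
    (hφ.differentiableAt (hW.mem_nhds hd)).hasFDerivAt
  have hequiv : ∀ d ∈ W, ∃ L : Params p ℓ k ≃L[ℂ] Params p ℓ k,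
      (L : Params p ℓ k →L[ℂ] Params p ℓ k) = fderiv ℂ φ d := by
    intro d hd
    refine ⟨(LinearEquiv.ofInjectiveEndo
      (fderiv ℂ φ d : Params p ℓ k →ₗ[ℂ] Params p ℓ k) (hinj d hd)).toContinuousLinearEquiv, ?_⟩
    exact ContinuousLinearMap.ext fun Y => rfl
  have hc : ContinuousOn (fderiv ℂ φ) W := continuousOn_clm_apply.2 hcont
  have hstrict : HasStrictFDerivAt φ (fderiv ℂ φ d) d :=
    hasStrictFDerivAt_of_hasFDerivAt_of_continuousAt
      (Filter.eventually_of_mem (hW.mem_nhds hd) hder) (hc.continuousAt (hW.mem_nhds hd))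
  obtain ⟨L, hL⟩ := hequiv d hd
  rw [← hL] at hstrict
  -- Restricting the source to `W` makes the differential invertible at every point of it, so the
  -- inverse is differentiable on the whole target and not only at the image of `d`.
  let ψ := (hstrict.toOpenPartialHomeomorph φ).restrOpen W hW
  have hψ : ∀ y, ψ y = φ y := fun y => by
    change (hstrict.toOpenPartialHomeomorph φ) y = φ y
    rw [hstrict.toOpenPartialHomeomorph_coe]
  have hsource : ψ.source ⊆ W := fun y hy => hy.2
  refine ⟨ψ, ⟨hstrict.mem_toOpenPartialHomeomorph_source, hd⟩, hsource, fun y _ => hψ y, ?_⟩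
  intro y hy
  have hy' := hsource (ψ.map_target hy)
  obtain ⟨L', hL'⟩ := hequiv _ hy'
  refine (ψ.hasFDerivAt_symm (f' := L') hy ?_).differentiableAt.differentiableWithinAt
  rw [hL', show (ψ : Params p ℓ k → Params p ℓ k) = φ from funext hψ]
  exact hder _ hy'

theorem isLocalCoordinates_coordMap (hk : ∀ i, 1 ≤ k i) (hW : IsOpen W) (hw : IsRootBranch W w)
    {m : Fin p → Fin ℓ → ℂ}
    (hm : ∀ d ∈ W, ∀ i j, PowerSeries.constantCoeff (betaSer m d i j) ≠ 0) :
    IsLocalCoordinates (coordMap w) W := by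
  refine isLocalCoordinates_of_fderiv hW (differentiableOn_coordMap hk hw) (fun Y => ?_)
    fun d hd => fderiv_coordMap_injective hk hW hw hm hd
  refine ContinuousOn.congr ?_ fun d hd => fderiv_coordMap hk hW hw hm hd Y
  refine continuousOn_const.prodMk ?_
  rw [continuousOn_pi]; intro i
  rw [continuousOn_pi]; intro j
  rw [continuousOn_pi]; intro n
  exact ((hw.holSeries_rootSer i j).wCoeff
    (fun d hd => hw.constantCoeff_rootSer_ne_zero hk hd i j)
    (holSeries_alphaSer hm Y i j) _).continuousOn

end Coordinates

/-! ### The Euler field. -/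

theorem differentiableOn_clm_apply {E G : Type*} [NormedAddCommGroup E] [NormedSpace ℂ E]
    [FiniteDimensional ℂ E] [NormedAddCommGroup G] [NormedSpace ℂ G]
    {f : E → E →L[ℂ] G} {s : Set E} (h : ∀ y, DifferentiableOn ℂ (fun x => f x y) s) :
    DifferentiableOn ℂ f s := by
  have hd : Module.finrank ℂ E = Module.finrank ℂ (Fin (Module.finrank ℂ E) → ℂ) :=
    (Module.finrank_fin_fun ℂ).symm
  let e₁ := ContinuousLinearEquiv.ofFinrankEq hd
  let e₂ := (e₁.arrowCongr (1 : G ≃L[ℂ] G)).trans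
    (ContinuousLinearEquiv.piRing (Fin (Module.finrank ℂ E)))
  rw [← Function.id_comp f, ← e₂.symm_comp_self]
  exact e₂.symm.differentiable.comp_differentiableOn (differentiableOn_pi.mpr fun i => h _)

theorem eulerField_eq (d : Params p ℓ k) :
    eulerField d = (d.1, fun i j (s : Fin (k i - 1)) =>
      ((k i - 1 - (s : ℕ) : ℕ) : ℂ) * d.2 i j s) := by
  have he : HasDerivAt Complex.exp 1 0 := by simpa using Complex.hasDerivAt_exp 0
  have h1 : HasDerivAt (fun τ : ℂ => fun i => Complex.exp τ * d.1 i) d.1 0 := by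
    rw [hasDerivAt_pi]; intro i
    simpa using he.mul_const (d.1 i)
  have h2 : HasDerivAt (fun τ : ℂ => fun i j (s : Fin (k i - 1)) =>
      Complex.exp τ ^ (k i - 1 - (s : ℕ)) * d.2 i j s)
      (fun i j s => ((k i - 1 - (s : ℕ) : ℕ) : ℂ) * d.2 i j s) 0 := by
    rw [hasDerivAt_pi]; intro i
    rw [hasDerivAt_pi]; intro j
    rw [hasDerivAt_pi]; intro s
    have := (he.pow (k i - 1 - (s : ℕ))).mul_const (d.2 i j s)
    simpa using this
  exact (h1.prodMk h2).deriv

theorem tSer_euler (d : Params p ℓ k) (i : Fin p) (j : Fin ℓ) :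
    tSer i j (eulerField d) = PowerSeries.C ((k i : ℂ) - 1) * tSer i j d -
      PowerSeries.X * PowerSeries.derivative (R := ℂ) (tSer i j d) := by
  ext n
  rw [map_sub, PowerSeries.coeff_C_mul, coeff_X_mul_derivative, eulerField_eq, coeff_tSer,
    coeff_tSer]
  split_ifs with h
  · push_cast [show n ≤ k i - 1 by omega, show 1 ≤ k i by omega]
    ring1
  · simp

/-- Since `t_ij(E) = m_ij x ^ (k_i - 1) - β_ij`, the series is `λ_i + x - m_ij x ^ k_i / β_ij`. -/
theorem jet_alphaSer_euler (hk : ∀ i, 1 ≤ k i) (m : Fin p → Fin ℓ → ℂ) (d : Params p ℓ k)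
    (i : Fin p) (j : Fin ℓ) (hm : PowerSeries.constantCoeff (betaSer m d i j) ≠ 0) :
    jet (k i) (alphaSer m d (eulerField d) i j) =
      jet (k i) (PowerSeries.C (d.1 i) + PowerSeries.X) := by
  have h1 : tSer i j (eulerField d) =
      PowerSeries.C (m i j) * PowerSeries.X ^ (k i - 1) - betaSer m d i j := by
    rw [tSer_euler, betaSer, map_sub, map_sub]
    ring1
  have hX : (PowerSeries.X : ℂ⟦X⟧) * PowerSeries.X ^ (k i - 1) = PowerSeries.X ^ k i := by
    rw [← pow_succ', Nat.sub_add_cancel (hk i)]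
  rw [jet_eq_iff, alphaSer, h1, eulerField_eq]
  refine ⟨-(PowerSeries.C (m i j) * (betaSer m d i j)⁻¹), ?_⟩
  have h2 := PowerSeries.mul_inv_cancel _ hm
  linear_combination PowerSeries.X * h2 - PowerSeries.C (m i j) * (betaSer m d i j)⁻¹ * hX

/-! ### Matrices in the frame of the `w_ij ^ s ε_ij`. -/

theorem jetVec_smul {K : ℕ} (c : ℂ) (v : Fin K → Fin ℓ → ℂ) :
    jetVec (c • v) = jet K (PowerSeries.C c) • jetVec v := by
  have h : (jet K (PowerSeries.C c) • jetVec v) =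
      fun r => jet K (PowerSeries.C c * jetSer v r) := by
    funext r
    rw [map_mul]
    rfl
  rw [h, jetVec_eq_iff]
  intro s r
  rw [PowerSeries.coeff_C_mul, coeff_jetSer]
  rfl

/-- The coefficient of `w ^ s'` in the expansion of `f * w ^ s` in powers of `w = x * r`. -/
def shiftCoeff (r f : ℂ⟦X⟧) (s' s : ℕ) : ℂ := if s ≤ s' then wCoeff r (s' - s) f else 0

/-- Multiplication by `w ^ s` shifts the expansion by `s` places, and powers from `w ^ K` on vanish.
Hence the blocks are lower triangular and constant along diagonals. -/
theorem jet_mul_pow_eq_sum {r : ℂ⟦X⟧} (hr : PowerSeries.constantCoeff r ≠ 0) {K s : ℕ}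
    (hs : s ≤ K) (f : ℂ⟦X⟧) :
    jet K f * jet K (PowerSeries.X * r) ^ s =
      ∑ s' : Fin K, jet K (PowerSeries.C (shiftCoeff r f s' s)) *
        jet K (PowerSeries.X * r) ^ (s' : ℕ) := by
  rw [Fin.sum_univ_eq_sum_range (fun s' => jet K (PowerSeries.C (shiftCoeff r f s' s)) *
    jet K (PowerSeries.X * r) ^ s') K]
  have hsplit : Finset.range K = Finset.range (s + (K - s)) := by
    congr 1
    omega
  have hlow : ∑ s' ∈ Finset.range s, jet K (PowerSeries.C (shiftCoeff r f s' s)) *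
      jet K (PowerSeries.X * r) ^ s' = 0 := by
    refine Finset.sum_eq_zero fun s' hs' => ?_
    rw [shiftCoeff, if_neg (by simpa using hs'), map_zero, map_zero, zero_mul]
  have hzero : jet K (PowerSeries.X * r) ^ (K - s) * jet K (PowerSeries.X * r) ^ s = 0 := by
    rw [← pow_add, Nat.sub_add_cancel hs, map_mul, mul_pow, jet_X_pow, zero_mul]
  rw [hsplit, Finset.sum_range_add, hlow, zero_add]
  conv_lhs => rw [sum_wCoeff hr (K - s) f, map_add, add_mul, map_mul _ (_ ^ (K - s)), map_pow,
    mul_right_comm, hzero, zero_mul, add_zero, map_sum, Finset.sum_mul]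
  refine Finset.sum_congr rfl fun n _ => ?_
  rw [shiftCoeff, if_pos (Nat.le_add_right s n), Nat.add_sub_cancel_left, map_mul, map_pow,
    mul_assoc, ← pow_add, add_comm n s]

/-- The matrix of an endomorphism of `V` that acts near `λ_i` as multiplication by a matrix function
with eigenvectors `ε_ij` and eigenvalues `f_ij`, in the frame of the `w_ij ^ s * ε_ij`. -/
theorem toMatrix_frame {e : Module.Basis (FrameIndex p ℓ k) ℂ (Fibre p ℓ k)}
    {ε : (i : Fin p) → Fin ℓ → Fin (k i) → Fin ℓ → ℂ} {w : Fin p → Fin ℓ → ℂ[X]}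
    {r f : Fin p → Fin ℓ → ℂ⟦X⟧} (hr : ∀ i j, PowerSeries.constantCoeff (r i j) ≠ 0)
    (hw : ∀ i j, jet (k i) (w i j : ℂ⟦X⟧) = jet (k i) (PowerSeries.X * r i j))
    (he : ∀ (i : Fin p) (j : Fin ℓ) (s : Fin (k i)),
      e ⟨i, (j, s)⟩ = Pi.single i (jetSMul (w i j ^ (s : ℕ)) (ε i j)))
    {T : Fibre p ℓ k →ₗ[ℂ] Fibre p ℓ k} {M : (i : Fin p) → Matrix (Fin ℓ) (Fin ℓ) (Jet (k i))}
    (hT : ∀ v i, jetVec (T v i) = (M i).mulVec (jetVec (v i)))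
    (hM : ∀ i j, (M i).mulVec (jetVec (ε i j)) = jet (k i) (f i j) • jetVec (ε i j))
    (I J : FrameIndex p ℓ k) :
    LinearMap.toMatrix e e T I J = if I.1 = J.1 ∧ I.2.1 = J.2.1 then
      shiftCoeff (r J.1 J.2.1) (f J.1 J.2.1) I.2.2 J.2.2 else 0 := by
  obtain ⟨i, j, s⟩ := J
  have hsmul : ∀ s : ℕ, jetVec (jetSMul (w i j ^ s) (ε i j)) =
      jet (k i) (PowerSeries.X * r i j) ^ s • jetVec (ε i j) := by
    intro s
    rw [jetVec_jetSMul, Polynomial.coe_pow, map_pow, hw]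
  have key : T (e ⟨i, (j, s)⟩) =
      ∑ s' : Fin (k i), shiftCoeff (r i j) (f i j) s' s • e ⟨i, (j, s')⟩ := by
    funext i'
    apply jetVec_injective
    rw [hT, Finset.sum_apply, map_sum]
    simp only [Pi.smul_apply, jetVec_smul, he]
    by_cases hi : i' = i
    · subst hi
      simp only [Pi.single_eq_same, hsmul, smul_smul, ← Finset.sum_smul]
      rw [← jet_mul_pow_eq_sum (hr i' j) s.isLt.le, Matrix.mulVec_smul, hM, smul_smul, mul_comm]
    · simp [Pi.single_eq_of_ne hi]
  rw [LinearMap.toMatrix_apply, key, map_sum, Finsupp.finsetSum_apply]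
  simp only [map_smul, Module.Basis.repr_self, Finsupp.smul_apply, smul_eq_mul,
    Finsupp.single_apply]
  obtain ⟨i', j', s'⟩ := I
  by_cases hi : i' = i
  · subst hi
    by_cases hj : j' = j
    · subst hj
      rw [Finset.sum_eq_single s']
      · simp
      · intro s'' _ hs
        simp [hs]
      · simp
    · rw [if_neg (by simp [hj])]
      refine Finset.sum_eq_zero fun s'' _ => ?_
      rw [if_neg, mul_zero]
      simp [Ne.symm hj]
  · rw [if_neg (by simp [hi])]
    refine Finset.sum_eq_zero fun s'' _ => ?_
    rw [if_neg, mul_zero]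
    intro h
    exact hi (congrArg Sigma.fst h).symm

theorem jetSMul_apply {K : ℕ} (f : ℂ[X]) (v : Fin K → Fin ℓ → ℂ) (s : Fin K) :
    jetSMul f v s = ∑ n : Fin K, if n ≤ s then f.coeff ((s : ℕ) - n) • v n else 0 := by
  simp only [jetSMul, jetMul, LinearMap.mk₂_apply, Matrix.smul_mulVec, Matrix.one_mulVec]

theorem differentiableOn_jetSMul {E : Type*} [NormedAddCommGroup E] [NormedSpace ℂ E] {W : Set E}
    {K : ℕ} {f : E → ℂ[X]} {v : E → Fin K → Fin ℓ → ℂ}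
    (hf : ∀ n, DifferentiableOn ℂ (fun d => (f d).coeff n) W) (hv : DifferentiableOn ℂ v W) :
    DifferentiableOn ℂ (fun d => jetSMul (f d) (v d)) W := by
  rw [differentiableOn_pi]
  intro s
  simp only [jetSMul_apply]
  refine DifferentiableOn.fun_sum fun n _ => ?_
  split_ifs
  · exact (hf _).smul (differentiableOn_pi.1 hv n)
  · exact differentiableOn_const _

theorem card_frameIndex :
    Fintype.card (FrameIndex p ℓ k) = Module.finrank ℂ (Fibre p ℓ k) := by
  rw [Fintype.card_sigma, Module.finrank_pi_fintype]
  refine Finset.sum_congr rfl fun i _ => ?_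
  rw [Module.finrank_pi_fintype]
  simp [mul_comm]

namespace SystemFamily

variable (F : SystemFamily p ℓ k)

/-- Three independent separations: over `i` by the support of the vectors, over `j` by invertibility
of `g_i`, over `s` by uniqueness of the expansion in powers of `w_ij`. -/
theorem linearIndependent_frame {d : Params p ℓ k} (hd : d ∈ F.dom)
    {ε : (i : Fin p) → Fin ℓ → Fin (k i) → Fin ℓ → ℂ} {w : Fin p → Fin ℓ → ℂ[X]}
    {r c : Fin p → Fin ℓ → ℂ⟦X⟧} (hr : ∀ i j, PowerSeries.constantCoeff (r i j) ≠ 0)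
    (hw : ∀ i j, jet (k i) (w i j : ℂ⟦X⟧) = jet (k i) (PowerSeries.X * r i j))
    (hc : ∀ i j, PowerSeries.constantCoeff (c i j) ≠ 0)
    (hε : ∀ i j, jetVec (ε i j) = jet (k i) (c i j) • F.formalEigenvector d i j) :
    LinearIndependent ℂ fun I : FrameIndex p ℓ k =>
      (Pi.single I.1 (jetSMul (w I.1 I.2.1 ^ (I.2.2 : ℕ)) (ε I.1 I.2.1)) : Fibre p ℓ k) := by
  rw [Fintype.linearIndependent_iff]
  rintro a ha ⟨i, j, s⟩
  have h1 := congrArg jetVec (congrFun ha i)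
  rw [Finset.sum_apply, map_sum, Fintype.sum_sigma, Finset.sum_eq_single i] at h1
  · simp only [Pi.smul_apply, Pi.single_eq_same, jetVec_smul, jetVec_jetSMul, hε, Pi.zero_apply,
      map_zero, smul_smul, Polynomial.coe_pow, map_pow, hw, Fintype.sum_prod_type,
      ← Finset.sum_smul] at h1
    have h2 := congrFun (F.formalEigenvector_sum_eq_zero hd h1) j
    simp only [← mul_assoc] at h2
    rw [← Finset.sum_mul, Pi.zero_apply] at h2
    have h3 := ((isUnit_of_constantCoeff_ne_zero (hc i j)).map (jet (k i))).mul_left_eq_zero.1 h2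
    have h4 := eq_zero_of_jet_sum_eq_zero (hr i j) (K := k i)
      (c := fun n => if h : n < k i then a ⟨i, (j, ⟨n, h⟩)⟩ else 0) (by
        rw [map_sum, ← h3, ← Fin.sum_univ_eq_sum_range]
        refine Finset.sum_congr rfl fun n _ => ?_
        simp) s s.isLt
    simpa using h4
  · intro i' _ hi'
    refine Finset.sum_eq_zero fun x _ => ?_
    rw [Pi.smul_apply, Pi.single_eq_of_ne (Ne.symm hi'), smul_zero, map_zero]
  · simp

variable {W : Set (Params p ℓ k)} {w : Params p ℓ k → Fin p → Fin ℓ → ℂ[X]}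
  {ε : Params p ℓ k → (i : Fin p) → Fin ℓ → Fin (k i) → Fin ℓ → ℂ}

theorem IsEigenframe.exists_eq {F : SystemFamily p ℓ k} (hk : ∀ i, 1 ≤ k i)
    (hε : F.IsEigenframe W ε) (hW : W ⊆ F.regularPoints) {d : Params p ℓ k} (hd : d ∈ W)
    (i : Fin p) (j : Fin ℓ) : ∃ c : ℂ⟦X⟧, PowerSeries.constantCoeff c ≠ 0 ∧
      jetVec (ε d i j) = jet (k i) c • F.formalEigenvector d i j :=
  (F.eigenvector_iff_exists hk (hW hd) i j _).1 ((hε i j).2 d hd)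

theorem exists_isPowerFrame (hk : ∀ i, 1 ≤ k i) (hW : W ⊆ F.regularPoints)
    (hw : IsRootBranch W w) (hε : F.IsEigenframe W ε) : ∃ e, IsPowerFrame W w ε e := by
  have h : ∀ d, ∃ e : Module.Basis (FrameIndex p ℓ k) ℂ (Fibre p ℓ k), d ∈ W →
      ∀ (i : Fin p) (j : Fin ℓ) (s : Fin (k i)),
        e ⟨i, (j, s)⟩ = Pi.single i (jetSMul (w d i j ^ (s : ℕ)) (ε d i j)) := by
    intro d
    by_cases hd : d ∈ W
    · choose c hc0 hc using fun i j => hε.exists_eq hk hW hd i j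
      have hli := F.linearIndependent_frame (hW hd).1
        (fun i j => hw.constantCoeff_rootSer_ne_zero hk hd i j)
        (fun i j => hw.jet_eq hk hd i j) hc0 hc
      refine ⟨Module.Basis.mk hli
        (hli.span_eq_top_of_card_eq_finrank' card_frameIndex).ge, fun _ i j s => ?_⟩
      rw [Module.Basis.mk_apply]
    -- Off `W` nothing is required and any basis will do.
    · exact ⟨(Module.finBasis ℂ (Fibre p ℓ k)).reindex
        (Fintype.equivOfCardEq (by rw [Fintype.card_fin, card_frameIndex])),
        fun h => absurd h hd⟩
  choose e he using h
  exact ⟨e, he⟩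

theorem jetVec_aEnd (d : Params p ℓ k) (v : Fibre p ℓ k) (i : Fin p) :
    jetVec (aEnd d v i) =
      (Matrix.scalar (Fin ℓ) (jet (k i) (PowerSeries.C (d.1 i) + PowerSeries.X))).mulVec
        (jetVec (v i)) := by
  have h : aEnd d v i = jetSMul (Polynomial.C (d.1 i) + Polynomial.X) (v i) := rfl
  rw [h, jetVec_jetSMul]
  funext r
  simp [Matrix.scalar_apply, Matrix.mulVec_diagonal]

theorem exists_jetVec_alpha (hk : ∀ i, 1 ≤ k i) {d : Params p ℓ k} (hd : d ∈ F.regularPoints)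
    (Y : Params p ℓ k) : ∃ M : (i : Fin p) → Matrix (Fin ℓ) (Fin ℓ) (Jet (k i)),
      (∀ v i, jetVec (F.alpha d Y v i) = (M i).mulVec (jetVec (v i))) ∧
      ∀ i, M i * (F.g d i).map (jet (k i)) = (F.g d i).map (jet (k i)) *
        Matrix.diagonal fun j => jet (k i) (alphaSer F.m d Y i j) := by
  choose M hM hMg using fun i => F.exists_alphaCoeff_eq hk hd Y i
  refine ⟨fun i => (M i).map (jet (k i)), fun v i => ?_, hMg⟩
  exact jetVec_jetMul (fun n _ => hM i n) (v i)

/-- All eigenvalues of `α_E` at `λ_i` are the same jet `λ_i + x_i`, so the matrix conjugated by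
`g_i` is scalar. -/
theorem alpha_euler (hk : ∀ i, 1 ≤ k i) {d : Params p ℓ k} (hd : d ∈ F.regularPoints) :
    F.alpha d (eulerField d) = aEnd d := by
  obtain ⟨M, hM, hMg⟩ := F.exists_jetVec_alpha hk hd (eulerField d)
  refine LinearMap.ext fun v => funext fun i => jetVec_injective ?_
  rw [hM, jetVec_aEnd]
  congr 1
  refine (F.isUnit_map_g hd.1 i (jet (k i))).mul_right_cancel ?_
  rw [hMg, Matrix.scalar_apply]
  have h : (fun j => jet (k i) (alphaSer F.m d (eulerField d) i j)) =
      fun _ => jet (k i) (PowerSeries.C (d.1 i) + PowerSeries.X) :=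
    funext fun j => jet_alphaSer_euler hk F.m d i j (((F.mem_regularPoints_iff hk hd.1).1 hd i).2 j)
  rw [h]
  ext1 r s
  rw [Matrix.mul_diagonal, Matrix.diagonal_mul, mul_comm]

/-- The matrix of `a` in the frame is the matrix of multiplication by `x`. -/
theorem matA_apply (hk : ∀ i, 1 ≤ k i)
    (hw : IsRootBranch W w) {e : Frame p ℓ k} (he : IsPowerFrame W w ε e)
    {d : Params p ℓ k} (hd : d ∈ W) (I J : FrameIndex p ℓ k) :
    matA e d I J = if I.1 = J.1 ∧ I.2.1 = J.2.1 then
      shiftCoeff (rootSer w d J.1 J.2.1) (PowerSeries.C (d.1 J.1) + PowerSeries.X) I.2.2 J.2.2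
      else 0 := by
  refine toMatrix_frame (r := fun i j => rootSer w d i j)
    (f := fun i _ => PowerSeries.C (d.1 i) + PowerSeries.X)
    (fun i j => hw.constantCoeff_rootSer_ne_zero hk hd i j)
    (fun i j => hw.jet_eq hk hd i j) (he d hd) (fun v i => jetVec_aEnd d v i) (fun i j => ?_) I J
  funext r
  simp [Matrix.scalar_apply, Matrix.mulVec_diagonal]

/-- The factor between `ε_ij` and the formal eigenvector commutes with `α` and drops out; the result
depends on `w` alone. -/
theorem matAlpha_apply (hk : ∀ i, 1 ≤ k i) (hW : W ⊆ F.regularPoints)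
    (hw : IsRootBranch W w) (hε : F.IsEigenframe W ε) {e : Frame p ℓ k}
    (he : IsPowerFrame W w ε e) {d : Params p ℓ k} (hd : d ∈ W) (I J : FrameIndex p ℓ k)
    (Y : Params p ℓ k) :
    F.matAlpha e d I J Y = if I.1 = J.1 ∧ I.2.1 = J.2.1 then
      shiftCoeff (rootSer w d J.1 J.2.1) (alphaSer F.m d Y J.1 J.2.1) I.2.2 J.2.2 else 0 := by
  obtain ⟨M, hM, hMg⟩ := F.exists_jetVec_alpha hk (hW hd) Y
  refine toMatrix_frame (r := fun i j => rootSer w d i j) (f := fun i j => alphaSer F.m d Y i j)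
    (fun i j => hw.constantCoeff_rootSer_ne_zero hk hd i j)
    (fun i j => hw.jet_eq hk hd i j) (he d hd) hM (fun i j => ?_) I J
  obtain ⟨c, -, hc⟩ := hε.exists_eq hk hW hd i j
  rw [hc, Matrix.mulVec_smul, F.mulVec_formalEigenvector (hMg i), smul_comm]

theorem matA_eq_normalForm (hk : ∀ i, 1 ≤ k i)
    (hw : IsRootBranch W w) {e : Frame p ℓ k} (he : IsPowerFrame W w ε e)
    {d : Params p ℓ k} (hd : d ∈ W) : matA e d = normalForm (coordMap w d) := by
  ext ⟨i, j, s⟩ ⟨i', j', s'⟩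
  rw [matA_apply hk hw he hd, normalForm, Matrix.of_apply]
  by_cases h : i = i' ∧ j = j'
  · obtain ⟨rfl, rfl⟩ := h
    simp only [and_self, if_true, shiftCoeff]
    rcases lt_trichotomy (s : ℕ) (s' : ℕ) with hs | hs | hs
    · rw [if_neg (by omega), dif_neg (by omega), if_neg (by omega)]
    · rw [if_pos (by omega), dif_neg (by omega), if_pos hs, hs, Nat.sub_self, wCoeff_zero]
      simp [coordMap]
    · rw [if_pos (by omega), dif_pos hs]
      have : (s : ℕ) - s' - 1 + 1 = s - s' := by omega
      simp only [coordMap, xCoeff, this]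
  · rw [if_neg h, if_neg h]

/-- Entry by entry this is `fderiv_xCoeff`: the matrices of `a` and `α` are built from the
coefficients of `λ_i + x_i` and of `alphaSer` by the same rule. -/
theorem hasFDerivAt_matA (hk : ∀ i, 1 ≤ k i) (hWo : IsOpen W) (hW : W ⊆ F.regularPoints)
    (hw : IsRootBranch W w) (hε : F.IsEigenframe W ε) {e : Frame p ℓ k}
    (he : IsPowerFrame W w ε e) {d : Params p ℓ k} (hd : d ∈ W) (I J : FrameIndex p ℓ k) :
    HasFDerivAt (fun d' => matA e d' I J) (F.matAlpha e d I J) d := by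
  have hev : (fun d' => matA e d' I J) =ᶠ[nhds d] fun d' =>
      if I.1 = J.1 ∧ I.2.1 = J.2.1 then (if (J.2.2 : ℕ) ≤ I.2.2 then
        xCoeff w d' J.1 J.2.1 (I.2.2 - J.2.2) else 0) else 0 := by
    filter_upwards [hWo.mem_nhds hd] with d' hd'
    exact matA_apply hk hw he hd' I J
  refine HasFDerivAt.congr_of_eventuallyEq ?_ hev
  have hα := F.matAlpha_apply hk hW hw hε he hd I J
  by_cases h : I.1 = J.1 ∧ I.2.1 = J.2.1
  · simp only [if_pos h] at hα ⊢
    by_cases hs : (J.2.2 : ℕ) ≤ I.2.2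
    · simp only [shiftCoeff, if_pos hs] at hα ⊢
      have h1 := ((differentiableOn_xCoeff hk hw J.1 J.2.1 (I.2.2 - J.2.2)).differentiableAt
        (hWo.mem_nhds hd)).hasFDerivAt
      convert h1 using 1
      refine ContinuousLinearMap.ext fun Y => ?_
      have hn : (I.2.2 : ℕ) - J.2.2 < k J.1 := by
        have := I.2.2.isLt
        have := congrArg k h.1
        omega
      rw [hα, fderiv_xCoeff hk hWo hw hd J.1 J.2.1
        (((F.mem_regularPoints_iff hk (hW hd).1).1 (hW hd) J.1).2 J.2.1) Y hn]
    · simp only [shiftCoeff, if_neg hs] at hα ⊢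
      rw [show F.matAlpha e d I J = 0 from ContinuousLinearMap.ext hα]
      exact hasFDerivAt_const _ _
  · simp only [if_neg h] at hα ⊢
    rw [show F.matAlpha e d I J = 0 from ContinuousLinearMap.ext hα]
    exact hasFDerivAt_const _ _

theorem differentiableOn_matAlpha (hk : ∀ i, 1 ≤ k i) (hW : W ⊆ F.regularPoints)
    (hw : IsRootBranch W w) (hε : F.IsEigenframe W ε) {e : Frame p ℓ k}
    (he : IsPowerFrame W w ε e) (I J : FrameIndex p ℓ k) :
    DifferentiableOn ℂ (fun d => F.matAlpha e d I J) W := by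
  refine differentiableOn_clm_apply fun Y => ?_
  refine DifferentiableOn.congr ?_ fun d hd => F.matAlpha_apply hk hW hw hε he hd I J Y
  unfold shiftCoeff
  split_ifs
  · exact (hw.holSeries_rootSer _ _).wCoeff
      (fun d hd => hw.constantCoeff_rootSer_ne_zero hk hd _ _)
      (holSeries_alphaSer (fun d hd i =>
        ((F.mem_regularPoints_iff hk (hW hd).1).1 (hW hd) i).2) Y _ _) _
  · exact differentiableOn_const _
  · exact differentiableOn_const _

/-- Each entry is the differential of an entry of `a`, and second derivatives are symmetric. -/
theorem isClosedForm_matAlpha (hk : ∀ i, 1 ≤ k i) (hWo : IsOpen W) (hW : W ⊆ F.regularPoints)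
    (hw : IsRootBranch W w) (hε : F.IsEigenframe W ε) {e : Frame p ℓ k}
    (he : IsPowerFrame W w ε e) : IsClosedForm W (F.matAlpha e) := by
  intro I J
  have hdiff := F.differentiableOn_matAlpha hk hW hw hε he I J
  refine ⟨hdiff, fun d hd X Y => sub_eq_zero.2 ?_⟩
  refine second_derivative_symmetric_of_eventually (𝕜 := ℂ) (f := fun d' => matA e d' I J) ?_
    (hdiff.differentiableAt (hWo.mem_nhds hd)).hasFDerivAt X Y
  filter_upwards [hWo.mem_nhds hd] with d' hd'
  exact F.hasFDerivAt_matA hk hWo hW hw hε he hd' I J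

theorem differentiableOn_frame (hw : IsRootBranch W w) {F : SystemFamily p ℓ k}
    (hε : F.IsEigenframe W ε) {e : Frame p ℓ k} (he : IsPowerFrame W w ε e)
    (I : FrameIndex p ℓ k) : DifferentiableOn ℂ (fun d => e d I) W := by
  obtain ⟨i, j, s⟩ := I
  refine DifferentiableOn.congr ?_ fun d hd => he d hd i j s
  have hpow : ∀ n, DifferentiableOn ℂ (fun d => (w d i j ^ (s : ℕ)).coeff n) W := by
    have h : HolSeries W fun d => (w d i j : ℂ⟦X⟧) ^ (s : ℕ) := by
      refine HolSeries.pow (fun n => ?_) _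
      simpa only [Polynomial.coeff_coe] using (hw i j).1 n
    intro n
    have h1 := h n
    simp only [← Polynomial.coe_pow, Polynomial.coeff_coe] at h1
    exact h1
  rw [differentiableOn_pi]
  intro i'
  by_cases hi : i' = i
  · subst hi
    simp only [Pi.single_eq_same]
    exact differentiableOn_jetSMul hpow (hε i' j).1
  · simp only [Pi.single_eq_of_ne hi]
    exact differentiableOn_const _

end SystemFamily

/-! ### Uniqueness of the roots up to constants. -/

/-- Two `N`-th roots of the same series differ by a constant root of unity. -/
theorem exists_root_of_unity {N : ℕ} (hN : N ≠ 0) {r r' t : ℂ⟦X⟧} (h : r ^ N * t = 1)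
    (h' : r' ^ N * t = 1) : ∃ ζ : ℂ, ζ ^ N = 1 ∧ r' = PowerSeries.C ζ * r := by
  have hr0 : PowerSeries.constantCoeff r ≠ 0 := by
    intro h0
    have h1 := congrArg PowerSeries.constantCoeff h
    rw [map_mul, map_pow, h0, zero_pow hN, zero_mul, map_one] at h1
    exact zero_ne_one h1
  have ht : t ≠ 0 := right_ne_zero_of_mul_eq_one h
  have hinv := PowerSeries.mul_inv_cancel r hr0
  set u := r' * r⁻¹ with hu
  have hru : r' = u * r := by
    rw [hu]
    linear_combination (-r') * hinv
  have huN : u ^ N = 1 := by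
    have h1 : r' ^ N = r ^ N := mul_right_cancel₀ ht (h'.trans h.symm)
    rw [hu, mul_pow, h1, ← mul_pow, hinv, one_pow]
  have hu0 : u ≠ 0 := by
    rintro h0
    rw [h0, zero_pow hN] at huN
    exact zero_ne_one huN
  -- From `u ^ N = 1`, `N u ^ (N - 1) u' = 0`, so `u` is constant.
  have hder : PowerSeries.derivative (R := ℂ) u = 0 := by
    have h1 := congrArg (PowerSeries.derivative (R := ℂ)) huN
    rw [PowerSeries.derivative_pow, PowerSeries.derivative_one] at h1
    refine (mul_eq_zero.1 h1).resolve_left (mul_ne_zero ?_ (pow_ne_zero _ hu0))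
    rw [← map_natCast (PowerSeries.C (R := ℂ)), map_ne_zero_iff _ PowerSeries.C_injective]
    exact Nat.cast_ne_zero.2 hN
  have huC : u = PowerSeries.C (PowerSeries.constantCoeff u) := by
    refine PowerSeries.derivative.ext ?_ ?_
    · rw [hder, PowerSeries.derivative_C]
    · rw [PowerSeries.constantCoeff_C]
  refine ⟨PowerSeries.constantCoeff u, ?_, ?_⟩
  · rw [← map_pow, huN, map_one]
  · rw [← huC]
    exact hru

/-- At each point the two choices differ by a root of unity, equal to the ratio of the coefficients
of `x_i`. This ratio is continuous with values in a finite set, hence constant on a connected set.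
-/
theorem IsRootBranch.exists_eq_smul {W : Set (Params p ℓ k)}
    {w w' : Params p ℓ k → Fin p → Fin ℓ → ℂ[X]} (hk : ∀ i, 1 ≤ k i) (hW : IsPreconnected W)
    (hw : IsRootBranch W w) (hw' : IsRootBranch W w') (i : Fin p) (j : Fin ℓ) :
    ∃ ζ : ℂ, ζ ^ (k i - 1) = 1 ∧ ∀ d ∈ W, w' d i j = ζ • w d i j := by
  rcases Nat.eq_or_lt_of_le (hk i) with h1 | h1
  · refine ⟨1, one_pow _, fun d hd => ?_⟩
    rw [((hw i j).2 d hd).1 h1.symm, ((hw' i j).2 d hd).1 h1.symm, smul_zero]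
  have hN : k i - 1 ≠ 0 := by omega
  have key : ∀ d ∈ W, ∃ ζ : ℂ, ζ ^ (k i - 1) = 1 ∧ w' d i j = ζ • w d i j ∧
      (w d i j).coeff 1 ≠ 0 := by
    intro d hd
    obtain ⟨r, hr, hwr⟩ := ((hw i j).2 d hd).2 h1
    obtain ⟨r', hr', hwr'⟩ := ((hw' i j).2 d hd).2 h1
    obtain ⟨ζ, hζ, hrr⟩ := exists_root_of_unity hN hr hr'
    refine ⟨ζ, hζ, ?_, ?_⟩
    · rw [hwr, hwr', hrr, ← map_smul]
      congr 1
      rw [PowerSeries.smul_eq_C_mul]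
      ring1
    · rw [hwr, PowerSeries.coeff_trunc, if_pos h1, show 1 = 0 + 1 from rfl,
        PowerSeries.coeff_succ_X_mul]
      intro h0
      have h2 := congrArg (PowerSeries.coeff 0) hr
      simp only [PowerSeries.coeff_zero_eq_constantCoeff, map_mul, map_pow, map_one] at h0 h2
      rw [h0, zero_pow hN, zero_mul] at h2
      exact zero_ne_one h2
  rcases W.eq_empty_or_nonempty with rfl | ⟨d₁, hd₁⟩
  · exact ⟨1, one_pow _, fun d hd => absurd hd (Set.notMem_empty d)⟩
  let T : Set ℂ := ((Polynomial.nthRoots (k i - 1) (1 : ℂ)).toFinset : Finset ℂ)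
  let z : Params p ℓ k → ℂ := fun d => (w' d i j).coeff 1 / (w d i j).coeff 1
  have hz : ∀ d ∈ W, z d ^ (k i - 1) = 1 ∧ w' d i j = z d • w d i j := by
    intro d hd
    obtain ⟨ζ, hζ, hww, h0⟩ := key d hd
    have : z d = ζ := by
      simp only [z, hww, Polynomial.coeff_smul, smul_eq_mul]
      exact mul_div_cancel_right₀ _ h0
    rw [this]
    exact ⟨hζ, hww⟩
  have hcont : ContinuousOn z W := by
    refine ContinuousOn.div ((hw' i j).1 1).continuousOn ((hw i j).1 1).continuousOn ?_
    intro d hd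
    obtain ⟨-, -, -, h0⟩ := key d hd
    exact h0
  have hmaps : Set.MapsTo z W T := by
    intro d hd
    simp only [T, Finset.mem_coe, Multiset.mem_toFinset]
    exact (Polynomial.mem_nthRoots (Nat.pos_of_ne_zero hN)).2 (hz d hd).1
  refine ⟨z d₁, (hz d₁ hd₁).1, fun d hd => ?_⟩
  rw [hW.constant_of_mapsTo (Finset.finite_toSet _).isDiscrete hcont hmaps hd₁ hd]
  exact (hz d hd).2

/-! ### Existence of holomorphic roots. -/

/-- The coefficients of the solution of `y' = h * y`, `y(0) = 1`. -/
def odeCoeff (h : ℂ⟦X⟧) : ℕ → ℂ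
  | 0 => 1
  | n + 1 => (∑ x : Fin (n + 1), PowerSeries.coeff (n - x) h * odeCoeff h x) / (n + 1)

/-- The solution of `y' = h * y`, `y(0) = 1`. -/
def odeSol (h : ℂ⟦X⟧) : ℂ⟦X⟧ := PowerSeries.mk (odeCoeff h)

theorem constantCoeff_odeSol (h : ℂ⟦X⟧) : PowerSeries.constantCoeff (odeSol h) = 1 := by
  rw [← PowerSeries.coeff_zero_eq_constantCoeff_apply, odeSol, PowerSeries.coeff_mk, odeCoeff]

theorem derivative_odeSol (h : ℂ⟦X⟧) :
    PowerSeries.derivative (R := ℂ) (odeSol h) = odeSol h * h := by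
  ext n
  rw [PowerSeries.coeff_derivative, odeSol, PowerSeries.coeff_mk, odeCoeff,
    div_mul_cancel₀ _ (Nat.cast_add_one_ne_zero n), PowerSeries.coeff_mul,
    Finset.Nat.sum_antidiagonal_eq_sum_range_succ
      (fun a b => PowerSeries.coeff a (PowerSeries.mk (odeCoeff h)) * PowerSeries.coeff b h),
    ← Fin.sum_univ_eq_sum_range]
  refine Finset.sum_congr rfl fun x _ => ?_
  rw [PowerSeries.coeff_mk, mul_comm]

theorem HolSeries.odeSol {E : Type*} [NormedAddCommGroup E] [NormedSpace ℂ E] {W : Set E}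
    {h : E → ℂ⟦X⟧} (hh : HolSeries W h) : HolSeries W fun d => odeSol (h d) := by
  intro n
  simp only [Isomonodromy.odeSol, PowerSeries.coeff_mk]
  induction n using Nat.strong_induction_on with
  | _ n ih =>
    rcases n with _ | n
    · simp only [odeCoeff]
      exact differentiableOn_const _
    · simp only [odeCoeff]
      simp only [div_eq_mul_inv]
      refine DifferentiableOn.mul_const ?_ _
      exact DifferentiableOn.fun_sum fun x _ => (hh _).mul (ih x x.isLt)

/-- Holomorphic families of power series have holomorphic roots near a point at which the constant
term does not vanish. -/
theorem exists_holSeries_root {E : Type*} [NormedAddCommGroup E] [NormedSpace ℂ E]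
    {t : E → ℂ⟦X⟧} (ht : HolSeries Set.univ t) {N : ℕ} (hN : N ≠ 0) {d₀ : E}
    (h0 : PowerSeries.constantCoeff (t d₀) ≠ 0) :
    ∃ V : Set E, IsOpen V ∧ d₀ ∈ V ∧ ∃ r : E → ℂ⟦X⟧, HolSeries V r ∧
      ∀ d ∈ V, r d ^ N * t d = 1 := by
  have hNC : (N : ℂ) ≠ 0 := Nat.cast_ne_zero.2 hN
  -- Normalized to `1` at `d₀`, so that the principal branch of the power is holomorphic nearby.
  let q : E → ℂ := fun d => PowerSeries.constantCoeff (t d) / PowerSeries.constantCoeff (t d₀)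
  have hq : DifferentiableOn ℂ q Set.univ := by
    simp only [q, div_eq_mul_inv]
    exact ht.constantCoeff.mul_const _
  have hqc : Continuous q := continuousOn_univ.1 hq.continuousOn
  let V : Set E := q ⁻¹' Complex.slitPlane
  have hVt : ∀ d ∈ V, PowerSeries.constantCoeff (t d) ≠ 0 := by
    intro d hd hz
    refine Complex.slitPlane_ne_zero hd ?_
    simp only [q, hz, zero_div]
  obtain ⟨ρ, hρ⟩ := IsAlgClosed.exists_pow_nat_eq (PowerSeries.constantCoeff (t d₀))⁻¹
    (Nat.pos_of_ne_zero hN)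
  let r₀ : E → ℂ := fun d => ρ * q d ^ (-(N : ℂ)⁻¹)
  have hr₀ : DifferentiableOn ℂ r₀ V :=
    (DifferentiableOn.cpow (hq.mono (Set.subset_univ _)) (differentiableOn_const _)
      fun d hd => hd).const_mul ρ
  have hr₀N : ∀ d ∈ V, r₀ d ^ N * PowerSeries.constantCoeff (t d) = 1 := by
    intro d hd
    have hq0 : q d ≠ 0 := Complex.slitPlane_ne_zero hd
    simp only [r₀]
    rw [mul_pow, hρ, ← Complex.cpow_mul_nat, neg_mul, inv_mul_cancel₀ hNC, Complex.cpow_neg_one]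
    have := hVt d hd
    simp only [q]
    field_simp
  -- The logarithmic derivative in `x` of `t ^ (-1 / N)`.
  let h : E → ℂ⟦X⟧ := fun d => PowerSeries.C (-(N : ℂ)⁻¹) *
    (PowerSeries.derivative (R := ℂ) (t d) * (t d)⁻¹)
  have htV : HolSeries V t := ht.mono (Set.subset_univ _)
  have hh : HolSeries V h := (HolSeries.const _).mul (htV.derivative.mul (htV.inv hVt))
  refine ⟨V, Complex.isOpen_slitPlane.preimage hqc, ?_,
    fun d => PowerSeries.C (r₀ d) * odeSol (h d), (HolSeries.C hr₀).mul hh.odeSol, fun d hd => ?_⟩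
  · change q d₀ ∈ Complex.slitPlane
    simp only [q, div_self h0]
    exact Complex.one_mem_slitPlane
  -- The product has zero derivative in `x`; the factor `r₀ d` then corrects its constant value.
  · have hconst : odeSol (h d) ^ N * t d = PowerSeries.C (PowerSeries.constantCoeff (t d)) := by
      refine PowerSeries.derivative.ext ?_ ?_
      · rw [PowerSeries.derivative_C, Derivation.leibniz, PowerSeries.derivative_pow,
          derivative_odeSol, smul_eq_mul, smul_eq_mul]
        have hpow : odeSol (h d) ^ N = odeSol (h d) ^ (N - 1) * odeSol (h d) := by
          rw [← pow_succ, Nat.sub_add_cancel (Nat.pos_of_ne_zero hN)]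
        have hNh : (N : ℂ⟦X⟧) * h d * t d = -PowerSeries.derivative (R := ℂ) (t d) := by
          have h1 := PowerSeries.inv_mul_cancel _ (hVt d hd)
          have h2 : (N : ℂ⟦X⟧) * PowerSeries.C (-(N : ℂ)⁻¹) = -1 := by
            rw [← map_natCast (PowerSeries.C (R := ℂ)), ← map_mul, mul_neg, mul_inv_cancel₀ hNC,
              map_neg, map_one]
          simp only [h]
          linear_combination (PowerSeries.derivative (R := ℂ) (t d) * (t d)⁻¹ * t d) * h2 -
            PowerSeries.derivative (R := ℂ) (t d) * h1
        rw [hpow]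
        linear_combination (odeSol (h d) ^ (N - 1) * odeSol (h d)) * hNh
      · rw [map_mul, map_pow, constantCoeff_odeSol, one_pow, one_mul, PowerSeries.constantCoeff_C]
    rw [mul_pow, mul_assoc, hconst, ← map_pow, ← map_mul, hr₀N d hd, map_one]

theorem exists_rootBranch_entry (hk : ∀ i, 1 ≤ k i) {m : Fin p → Fin ℓ → ℂ} {d₀ : Params p ℓ k}
    (i : Fin p) (j : Fin ℓ) (hm : PowerSeries.constantCoeff (betaSer m d₀ i j) ≠ 0) :
    ∃ V : Set (Params p ℓ k), IsOpen V ∧ d₀ ∈ V ∧ ∃ w : Params p ℓ k → ℂ[X],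
      (∀ n, DifferentiableOn ℂ (fun d => (w d).coeff n) V) ∧
        ∀ d ∈ V, (k i = 1 → w d = 0) ∧
          (2 ≤ k i → ∃ r : ℂ⟦X⟧, r ^ (k i - 1) * (tPoly i j d : ℂ⟦X⟧) = 1 ∧
            w d = PowerSeries.trunc (k i) (PowerSeries.X * r)) := by
  rcases Nat.eq_or_lt_of_le (hk i) with h1 | h1
  · refine ⟨Set.univ, isOpen_univ, Set.mem_univ _, fun _ => 0, fun n => ?_, fun d _ => ?_⟩
    · exact differentiableOn_const _
    · exact ⟨fun _ => rfl, fun h => by omega⟩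
  -- For `k_i ≥ 2`, `β_ij(0) = (1 - k_i) t_ij(0)`.
  · have ht0 : PowerSeries.constantCoeff (tSer i j d₀) ≠ 0 := by
      intro h0
      apply hm
      rw [betaSer]
      simp [h0, show k i - 1 ≠ 0 by omega]
    obtain ⟨V, hV, hd₀, r, hr, hrt⟩ := exists_holSeries_root (holSeries_tSer i j Set.univ)
      (show k i - 1 ≠ 0 by omega) ht0
    refine ⟨V, hV, hd₀, fun d => PowerSeries.trunc (k i) (PowerSeries.X * r d), fun n => ?_,
      fun d hd => ⟨fun h => by omega, fun _ => ⟨r d, hrt d hd, rfl⟩⟩⟩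
    simp only [PowerSeries.coeff_trunc]
    split_ifs
    · exact ((HolSeries.const _).mul hr) n
    · exact differentiableOn_const _

/-! ### Existence of holomorphic eigenvectors. -/

theorem HolSeries.det {E : Type*} [NormedAddCommGroup E] [NormedSpace ℂ E] {W : Set E}
    {M : E → Matrix (Fin ℓ) (Fin ℓ) ℂ⟦X⟧} (hM : ∀ r s, HolSeries W fun d => M d r s) :
    HolSeries W fun d => (M d).det := by
  simp only [Matrix.det_apply']
  exact HolSeries.sum fun σ _ => (HolSeries.const _).mul (HolSeries.prod fun r _ => hM _ _)

theorem HolSeries.adjugate {E : Type*} [NormedAddCommGroup E] [NormedSpace ℂ E] {W : Set E}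
    {M : E → Matrix (Fin ℓ) (Fin ℓ) ℂ⟦X⟧} (hM : ∀ r s, HolSeries W fun d => M d r s)
    (r s : Fin ℓ) : HolSeries W fun d => (M d).adjugate r s := by
  simp only [Matrix.adjugate_apply]
  refine HolSeries.det fun a b => ?_
  simp only [Matrix.updateRow_apply]
  split_ifs
  · exact HolSeries.const _
  · exact hM a b

namespace SystemFamily

variable (F : SystemFamily p ℓ k)

theorem holSeries_locB (i : Fin p) (r s : Fin ℓ) :
    HolSeries F.dom fun d => F.locB d i r s := by
  have hc : HolSeries F.dom fun d => cofactorSer d i := by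
    unfold cofactorSer
    refine HolSeries.prod fun j _ => HolSeries.pow (HolSeries.add (HolSeries.C ?_)
      (HolSeries.const _)) _
    fun_prop
  have hinv := hc.inv fun d hd => constantCoeff_cofactorSer_ne_zero (F.poles_distinct d hd) i
  -- The bound on `deg Q` gives a range of summation independent of `d`.
  have hQ : HolSeries F.dom fun d => ∑ n ∈ Finset.range ((∑ i, k i) + 1),
      PowerSeries.C ((F.Q d r s).coeff n) * (PowerSeries.C (d.1 i) + PowerSeries.X) ^ n := by
    refine HolSeries.sum fun n _ => (HolSeries.C (F.holomorphic_Q r s n)).mul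
      (HolSeries.pow (HolSeries.add (HolSeries.C ?_) (HolSeries.const _)) n)
    fun_prop
  intro n
  refine (hinv.mul hQ n).congr fun d hd => ?_
  have hdeg : (F.Q d r s).natDegree < (∑ i, k i) + 1 := by
    rw [Nat.lt_succ_iff]
    refine Polynomial.natDegree_le_of_degree_le ?_
    exact le_trans (le_add_of_nonneg_right (by norm_num)) (F.degree_Q d hd r s)
  simp only [locB, Matrix.smul_apply, Matrix.map_apply, smul_eq_mul]
  rw [Polynomial.eval₂_eq_sum_range' _ hdeg]

theorem isOpen_regularPoints (hk : ∀ i, 1 ≤ k i) : IsOpen F.regularPoints := by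
  have hcont : ∀ i j, Continuous fun d : Params p ℓ k =>
      PowerSeries.constantCoeff (betaSer F.m d i j) := fun i j =>
    continuousOn_univ.1 (holSeries_betaSer F.m i j Set.univ).constantCoeff.continuousOn
  rw [isOpen_iff_mem_nhds]
  intro d hd
  have hreg := (F.mem_regularPoints_iff hk hd.1).1 hd
  have h1 : ∀ᶠ d' in nhds d, ∀ i j, PowerSeries.constantCoeff (betaSer F.m d' i j) ≠ 0 := by
    rw [Filter.eventually_all]; intro i
    rw [Filter.eventually_all]; intro j
    exact (hcont i j).continuousAt.eventually_ne ((hreg i).2 j)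
  have h2 : ∀ᶠ d' in nhds d, ∀ i j l, j ≠ l → PowerSeries.constantCoeff (betaSer F.m d' i j) ≠
      PowerSeries.constantCoeff (betaSer F.m d' i l) := by
    rw [Filter.eventually_all]; intro i
    rw [Filter.eventually_all]; intro j
    rw [Filter.eventually_all]; intro l
    by_cases hjl : j = l
    · exact Filter.Eventually.of_forall fun _ h => absurd hjl h
    · filter_upwards [((hcont i j).sub (hcont i l)).continuousAt.eventually_ne
        (sub_ne_zero.2 fun h => hjl ((hreg i).1 h))] with d' hd' _
      exact sub_ne_zero.1 hd'
  filter_upwards [h1, h2, F.isOpen_dom.mem_nhds hd.1] with d' h1' h2' hd'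
  refine (F.mem_regularPoints_iff hk hd').2 fun i => ⟨fun j l hjl => ?_, h1' i⟩
  by_contra h
  exact h2' i j l h hjl

/-- The columns of the adjugate of `B - β_j` are eigenvectors of `B` modulo `x_i ^ k_i`. -/
theorem jet_locB_mulVec_adjugate (hk : ∀ i, 1 ≤ k i) {d : Params p ℓ k} (hd : d ∈ F.dom)
    (i : Fin p) (j s : Fin ℓ) :
    ((F.locB d i).map (jet (k i))).mulVec (fun r => jet (k i)
      ((F.locB d i - Matrix.scalar (Fin ℓ) (betaSer F.m d i j)).adjugate r s)) =
      jet (k i) (betaSer F.m d i j) • fun r => jet (k i)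
        ((F.locB d i - Matrix.scalar (Fin ℓ) (betaSer F.m d i j)).adjugate r s) := by
  set B := (F.locB d i).map (jet (k i)) with hB
  set G := (F.g d i).map (jet (k i)) with hG
  set b := fun j => jet (k i) (betaSer F.m d i j) with hb
  set C := B - Matrix.scalar (Fin ℓ) (b j) with hC
  have hmap : (F.locB d i - Matrix.scalar (Fin ℓ) (betaSer F.m d i j)).adjugate.map (jet (k i)) =
      C.adjugate := by
    have h := RingHom.map_adjugate (jet (k i))
      (F.locB d i - Matrix.scalar (Fin ℓ) (betaSer F.m d i j))
    rw [RingHom.mapMatrix_apply, RingHom.mapMatrix_apply] at h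
    rw [h, hC]
    congr 1
    ext1 r s
    simp only [Matrix.map_apply, Matrix.sub_apply, map_sub, hB, hb, Matrix.scalar_apply,
      Matrix.diagonal_apply]
    split_ifs <;> simp
  have hcol : (fun r => jet (k i)
      ((F.locB d i - Matrix.scalar (Fin ℓ) (betaSer F.m d i j)).adjugate r s)) =
      C.adjugate.mulVec (Pi.single s 1) := by
    rw [← hmap]
    funext r
    simp
  have hCG : C * G = G * Matrix.diagonal fun l => b l - b j := by
    rw [hC, sub_mul, F.jet_locB hk hd i]
    ext r l
    rw [Matrix.sub_apply, Matrix.scalar_apply, Matrix.diagonal_mul, Matrix.mul_diagonal,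
      Matrix.mul_diagonal]
    ring1
  -- `C` is conjugate to a diagonal matrix whose `j`-th entry is zero; with zero determinant, the
  -- columns of its adjugate lie in its kernel.
  have hdet : C.det = 0 := by
    have h := congrArg Matrix.det hCG
    rw [Matrix.det_mul, Matrix.det_mul, Matrix.det_diagonal,
      Finset.prod_eq_zero (Finset.mem_univ j) (sub_self _), mul_zero] at h
    exact ((Matrix.isUnit_iff_isUnit_det _).1
      (F.isUnit_map_g hd i (jet (k i)))).mul_left_eq_zero.1 h
  have h0 : C.mulVec (C.adjugate.mulVec (Pi.single s 1)) = 0 := by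
    rw [Matrix.mulVec_mulVec, Matrix.mul_adjugate, hdet, zero_smul, Matrix.zero_mulVec]
  rw [hcol]
  rw [hC, Matrix.sub_mulVec, sub_eq_zero, ← hC] at h0
  rw [h0]
  funext r
  simp [Matrix.scalar_apply, Matrix.mulVec_diagonal, hb]

/-- At `x_i = 0`, vanishing of the adjugate would pass through `g_i(0)` to the diagonal matrix of
the `β_il(0) - β_ij(0)`. But the `j`-th entry of the adjugate of the latter is the product over `l ≠
j`, nonzero because the eigenvalues are distinct. -/
theorem exists_constantCoeff_adjugate_ne_zero (hk : ∀ i, 1 ≤ k i) {d : Params p ℓ k}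
    (hd : d ∈ F.regularPoints) (i : Fin p) (j : Fin ℓ) : ∃ r s, PowerSeries.constantCoeff
      ((F.locB d i - Matrix.scalar (Fin ℓ) (betaSer F.m d i j)).adjugate r s) ≠ 0 := by
  by_contra! h
  set G := (F.g d i).map PowerSeries.constantCoeff with hG
  set b := fun j => PowerSeries.constantCoeff (betaSer F.m d i j) with hb
  set C := (F.locB d i).map PowerSeries.constantCoeff - Matrix.scalar (Fin ℓ) (b j) with hC
  have hadj : C.adjugate = 0 := by
    have h1 := RingHom.map_adjugate PowerSeries.constantCoeff
      (F.locB d i - Matrix.scalar (Fin ℓ) (betaSer F.m d i j))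
    rw [RingHom.mapMatrix_apply, RingHom.mapMatrix_apply] at h1
    have h2 : (F.locB d i - Matrix.scalar (Fin ℓ) (betaSer F.m d i j)).map
        PowerSeries.constantCoeff = C := by
      ext1 r s
      simp only [Matrix.map_apply, Matrix.sub_apply, map_sub, hC, hb, Matrix.scalar_apply,
        Matrix.diagonal_apply]
      split_ifs <;> simp
    rw [← h2, ← h1]
    ext1 r s
    exact h r s
  have hCG : C * G = G * Matrix.diagonal fun l => b l - b j := by
    rw [hC, sub_mul, F.constantCoeff_locB hk hd.1 i]
    ext r l
    rw [Matrix.sub_apply, Matrix.scalar_apply, Matrix.diagonal_mul, Matrix.mul_diagonal,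
      Matrix.mul_diagonal]
    ring1
  have hGu := F.isUnit_map_g hd.1 i PowerSeries.constantCoeff
  have hGdet := (Matrix.isUnit_iff_isUnit_det _).1 hGu
  have h3 := congrArg Matrix.adjugate hCG
  rw [Matrix.adjugate_mul_distrib, Matrix.adjugate_mul_distrib, hadj, mul_zero] at h3
  have h4 : (Matrix.diagonal fun l => b l - b j).adjugate = 0 := by
    have h5 := congrArg (· * G) h3
    simp only [zero_mul, Matrix.mul_assoc, Matrix.adjugate_mul, mul_smul_comm, mul_one] at h5
    exact (smul_eq_zero.1 h5.symm).resolve_left hGdet.ne_zero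
  rw [Matrix.adjugate_diagonal] at h4
  have h6 := congrFun (congrFun h4 j) j
  rw [Matrix.diagonal_apply_eq, Matrix.zero_apply, Finset.prod_eq_zero_iff] at h6
  obtain ⟨l, hl, h7⟩ := h6
  exact Finset.ne_of_mem_erase hl (((F.mem_regularPoints_iff hk hd.1).1 hd i).1
    (sub_eq_zero.1 h7))

/-- A column of the adjugate that is nonzero at `d₀` stays nonzero nearby, and unlike the columns of
`g_i` it is holomorphic in `d`. -/
theorem exists_eigenframe_entry (hk : ∀ i, 1 ≤ k i) {d₀ : Params p ℓ k}
    (hd₀ : d₀ ∈ F.regularPoints) (i : Fin p) (j : Fin ℓ) :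
    ∃ V : Set (Params p ℓ k), IsOpen V ∧ d₀ ∈ V ∧ V ⊆ F.regularPoints ∧
      ∃ ε : Params p ℓ k → Fin (k i) → Fin ℓ → ℂ, DifferentiableOn ℂ ε V ∧
        ∀ d ∈ V, (∀ s : Fin (k i), (s : ℕ) = 0 → ε d s ≠ 0) ∧
          ∀ r, IsHol (((F.locA d i - Matrix.scalar (Fin ℓ)
            (formalEigenvalue F.m d i j)).mulVec
              (fun r' => ∑ s : Fin (k i), HahnSeries.single ((s : ℕ) : ℤ) (ε d s r'))) r) := by
  obtain ⟨r, s, hrs⟩ := F.exists_constantCoeff_adjugate_ne_zero hk hd₀ i j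
  let A : Params p ℓ k → Matrix (Fin ℓ) (Fin ℓ) ℂ⟦X⟧ := fun d =>
    (F.locB d i - Matrix.scalar (Fin ℓ) (betaSer F.m d i j)).adjugate
  have hA : ∀ r s, HolSeries F.dom fun d => A d r s := by
    refine HolSeries.adjugate fun a b => ?_
    simp only [Matrix.sub_apply, Matrix.scalar_apply, Matrix.diagonal_apply]
    refine (F.holSeries_locB i a b).sub ?_
    split_ifs
    · exact holSeries_betaSer F.m i j _
    · exact HolSeries.const _
  have hopen := F.isOpen_regularPoints hk
  have hAc : ContinuousOn (fun d => PowerSeries.constantCoeff (A d r s)) F.regularPoints :=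
    (hA r s).constantCoeff.continuousOn.mono fun d hd => hd.1
  refine ⟨F.regularPoints ∩ (fun d => PowerSeries.constantCoeff (A d r s)) ⁻¹' {0}ᶜ,
    hAc.isOpen_inter_preimage hopen isOpen_compl_singleton, ⟨hd₀, hrs⟩, Set.inter_subset_left,
    fun d n r' => PowerSeries.coeff (n : ℕ) (A d r' s), ?_, fun d hd => ⟨fun n hn h => ?_, ?_⟩⟩
  · rw [differentiableOn_pi]; intro n
    rw [differentiableOn_pi]; intro r'
    exact (hA r' s n).mono fun d hd => hd.1.1
  · refine hd.2 ?_
    have h1 := congrFun h r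
    simpa [hn] using h1
  · rw [F.isHol_eigenvector_iff hk hd.1]
    have h1 : jetVec (fun (n : Fin (k i)) r' => PowerSeries.coeff (n : ℕ) (A d r' s)) =
        fun r' => jet (k i) (A d r' s) := jetVec_eq_iff.2 fun _ _ => rfl
    rw [h1]
    exact F.jet_locB_mulVec_adjugate hk hd.1.1 i j s

/-- Near each regular point there are holomorphic roots and eigenvectors. -/
theorem exists_nhds_choices (hk : ∀ i, 1 ≤ k i) {d₀ : Params p ℓ k} (hd₀ : d₀ ∈ F.regularPoints) :
    ∃ W : Set (Params p ℓ k), IsOpen W ∧ d₀ ∈ W ∧ W ⊆ F.regularPoints ∧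
      (∃ w, IsRootBranch W w) ∧ ∃ ε, F.IsEigenframe W ε := by
  choose V hVo hV0 w hwd hw using fun i j => exists_rootBranch_entry hk (m := F.m) i j
    (((F.mem_regularPoints_iff hk hd₀.1).1 hd₀ i).2 j)
  choose U hUo hU0 hUr ε hεd hε using fun i j => F.exists_eigenframe_entry hk hd₀ i j
  have hV : (F.regularPoints ∩ ⋂ i, ⋂ j, V i j ∩ U i j) ⊆ F.regularPoints := Set.inter_subset_left
  have hVV : ∀ i j, (F.regularPoints ∩ ⋂ i, ⋂ j, V i j ∩ U i j) ⊆ V i j ∩ U i j := fun i j d hd =>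
    Set.mem_iInter.1 (Set.mem_iInter.1 hd.2 i) j
  refine ⟨F.regularPoints ∩ ⋂ i, ⋂ j, V i j ∩ U i j, ?_, ⟨hd₀, ?_⟩, hV,
    ⟨fun d i j => w i j d, fun i j => ⟨fun n => ?_, fun d hd => ?_⟩⟩,
    ⟨fun d i j => ε i j d, fun i j => ⟨?_, fun d hd => ?_⟩⟩⟩
  · exact (F.isOpen_regularPoints hk).inter (isOpen_iInter_of_finite fun i =>
      isOpen_iInter_of_finite fun j => (hVo i j).inter (hUo i j))
  · exact Set.mem_iInter.2 fun i => Set.mem_iInter.2 fun j => ⟨hV0 i j, hU0 i j⟩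
  · exact (hwd i j n).mono fun d hd => (hVV i j hd).1
  · exact hw i j d (hVV i j hd).1
  · exact (hεd i j).mono fun d hd => (hVV i j hd).2
  · exact hε i j d (hVV i j hd).2

/-! ### The freedom in the eigenvectors. -/

theorem isEigenframe_of_jetSMul (hk : ∀ i, 1 ≤ k i) {W : Set (Params p ℓ k)}
    (hW : W ⊆ F.regularPoints) {ε ε' : Params p ℓ k → (i : Fin p) → Fin ℓ → Fin (k i) → Fin ℓ → ℂ}
    (hε : F.IsEigenframe W ε) {c : Params p ℓ k → Fin p → Fin ℓ → ℂ[X]}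
    (hc : ∀ i j, (∀ n, DifferentiableOn ℂ (fun d => (c d i j).coeff n) W) ∧
      ∀ d ∈ W, (c d i j).coeff 0 ≠ 0 ∧ ε' d i j = jetSMul (c d i j) (ε d i j)) :
    F.IsEigenframe W ε' := by
  intro i j
  refine ⟨(differentiableOn_jetSMul (hc i j).1 (hε i j).1).congr fun d hd => ((hc i j).2 d hd).2,
    fun d hd => (F.eigenvector_iff_exists hk (hW hd) i j _).2 ?_⟩
  obtain ⟨b, hb0, hb⟩ := hε.exists_eq hk hW hd i j
  obtain ⟨h0, h1⟩ := (hc i j).2 d hd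
  refine ⟨(c d i j : ℂ⟦X⟧) * b, ?_, ?_⟩
  · rw [map_mul]
    refine mul_ne_zero ?_ hb0
    rwa [← PowerSeries.coeff_zero_eq_constantCoeff_apply, Polynomial.coeff_coe]
  · rw [h1, jetVec_jetSMul, hb, smul_smul, map_mul]

/-- Both eigenvectors are unit multiples of the formal one, so a factor exists at each point. It is
unique modulo `x_i ^ k_i` and is locally the quotient of components that do not vanish, hence
holomorphic, although no single component need serve on all of `W`. -/
theorem exists_jetSMul_of_isEigenframe (hk : ∀ i, 1 ≤ k i) {W : Set (Params p ℓ k)}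
    (hWo : IsOpen W) (hW : W ⊆ F.regularPoints)
    {ε ε' : Params p ℓ k → (i : Fin p) → Fin ℓ → Fin (k i) → Fin ℓ → ℂ}
    (hε : F.IsEigenframe W ε) (hε' : F.IsEigenframe W ε') :
    ∃ c : Params p ℓ k → Fin p → Fin ℓ → ℂ[X],
      ∀ i j, (∀ n, DifferentiableOn ℂ (fun d => (c d i j).coeff n) W) ∧
        ∀ d ∈ W, (c d i j).coeff 0 ≠ 0 ∧ ε' d i j = jetSMul (c d i j) (ε d i j) := by
  have hex : ∀ d i j, ∃ γ : ℂ⟦X⟧, d ∈ W → PowerSeries.constantCoeff γ ≠ 0 ∧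
      jetVec (ε' d i j) = jet (k i) γ • jetVec (ε d i j) := by
    intro d i j
    by_cases hd : d ∈ W
    · obtain ⟨b, hb0, hb⟩ := hε.exists_eq hk hW hd i j
      obtain ⟨b', hb0', hb'⟩ := hε'.exists_eq hk hW hd i j
      refine ⟨b' * b⁻¹, fun _ => ⟨?_, ?_⟩⟩
      · rw [map_mul, PowerSeries.constantCoeff_inv]
        exact mul_ne_zero hb0' (inv_ne_zero hb0)
      · rw [hb, hb', smul_smul, ← map_mul, mul_assoc, PowerSeries.inv_mul_cancel _ hb0, mul_one]
    · exact ⟨1, fun h => absurd h hd⟩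
  choose γ hγ using hex
  refine ⟨fun d i j => PowerSeries.trunc (k i) (γ d i j), fun i j => ⟨fun n => ?_, fun d hd => ?_⟩⟩
  · simp only [PowerSeries.coeff_trunc]
    split_ifs with hn
    · intro d₁ hd₁
      have h0 := ((hε i j).2 d₁ hd₁).1 ⟨0, hk i⟩ rfl
      obtain ⟨r, hr⟩ := Function.ne_iff.1 h0
      have hser : ∀ {ε : Params p ℓ k → (i : Fin p) → Fin ℓ → Fin (k i) → Fin ℓ → ℂ},
          F.IsEigenframe W ε → HolSeries W fun d => jetSer (ε d i j) r := by
        intro ε hε n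
        simp only [jetSer, PowerSeries.coeff_mk]
        split_ifs with h
        · exact differentiableOn_pi.1 (differentiableOn_pi.1 (hε i j).1 ⟨n, h⟩) r
        · exact differentiableOn_const _
      have hcc : ∀ d, PowerSeries.constantCoeff (jetSer (ε d i j) r) = ε d i j ⟨0, hk i⟩ r := by
        intro d
        rw [← PowerSeries.coeff_zero_eq_constantCoeff_apply]
        exact coeff_jetSer _ _ ⟨0, hk i⟩
      set V := W ∩ (fun d => PowerSeries.constantCoeff (jetSer (ε d i j) r)) ⁻¹' {0}ᶜ with hV
      have hVo : IsOpen V := (hser hε).constantCoeff.continuousOn.isOpen_inter_preimage hWo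
        isOpen_compl_singleton
      have hVd : d₁ ∈ V := ⟨hd₁, by simpa [hcc] using hr⟩
      have hq : HolSeries V fun d => jetSer (ε' d i j) r * (jetSer (ε d i j) r)⁻¹ :=
        ((hser hε').mono Set.inter_subset_left).mul
          (((hser hε).mono Set.inter_subset_left).inv fun d hd => hd.2)
      have heq : ∀ d ∈ V, PowerSeries.coeff n (γ d i j) =
          PowerSeries.coeff n (jetSer (ε' d i j) r * (jetSer (ε d i j) r)⁻¹) := by
        intro d hd
        have h1 := congrFun (hγ d i j hd.1).2 r
        rw [Pi.smul_apply, jetVec_apply, jetVec_apply, smul_eq_mul, ← map_mul] at h1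
        refine jet_eq_iff_coeff.1 ?_ n hn
        rw [map_mul, h1, ← map_mul, mul_assoc, PowerSeries.mul_inv_cancel _ hd.2, mul_one]
      exact (((hq n).congr heq).differentiableAt (hVo.mem_nhds hVd)).differentiableWithinAt
    · exact differentiableOn_const _
  · obtain ⟨h0, h1⟩ := hγ d i j hd
    refine ⟨?_, jetVec_injective ?_⟩
    · rw [PowerSeries.coeff_trunc, if_pos (show 0 < k i from hk i)]
      simpa using h0
    · rw [h1, jetVec_jetSMul]
      congr 1
      rw [jet_eq_iff_coeff]
      intro n hn
      rw [Polynomial.coeff_coe, PowerSeries.coeff_trunc, if_pos hn]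

end SystemFamily

end Isomonodromy

end

/-! ### Assembly of the results. -/

open Isomonodromy in
theorem mainTheorem2 {p ℓ : ℕ} {k : Fin p → ℕ} (hk : ∀ i, 1 ≤ k i) (F : SystemFamily p ℓ k)
    (d₀ : Params p ℓ k) (hd₀ : d₀ ∈ F.regularPoints) :
    -- near `d₀` there are holomorphic choices of the `w_i` and of the eigenvectors of `Q`
    (∃ W : Set (Params p ℓ k), IsOpen W ∧ d₀ ∈ W ∧ W ⊆ F.regularPoints ∧
      (∃ w, IsRootBranch W w) ∧ ∃ ε, F.IsEigenframe W ε) ∧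
    ∀ W : Set (Params p ℓ k), IsOpen W → W ⊆ F.regularPoints →
      -- any such choices give a frame, the frame has the stated properties, and the entries of `a`
      -- are local coordinates, which depend only on `w`
      (∀ w, IsRootBranch W w → ∃ φ : Params p ℓ k → Params p ℓ k, IsLocalCoordinates φ W ∧
        ∀ ε, F.IsEigenframe W ε →
          (∃ e, IsPowerFrame W w ε e) ∧
          ∀ e, IsPowerFrame W w ε e →
            (∀ I, DifferentiableOn ℂ (fun d => e d I) W) ∧
            (∀ d ∈ W, matA e d = normalForm (φ d)) ∧
            IsClosedForm W (F.matAlpha e) ∧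
            (∀ d ∈ W, ∀ I J, HasFDerivAt (fun d' => matA e d' I J) (F.matAlpha e d I J) d) ∧
            (∀ d ∈ W, ∀ I J, fderiv ℂ (fun d' => matA e d' I J) d (eulerField d) = matA e d I J) ∧
            (∀ d ∈ W, F.alpha d (eulerField d) = aEnd d)) ∧
      -- for given `w`, the freedom is in rescaling the eigenvectors by nonvanishing holomorphic
      -- functions, and this leaves the matrices of `a` and `α` unchanged
      (∀ ε, F.IsEigenframe W ε → ∀ ε' : Params p ℓ k → (i : Fin p) → Fin ℓ → Fin (k i) → Fin ℓ → ℂ,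
        F.IsEigenframe W ε' ↔ ∃ c : Params p ℓ k → Fin p → Fin ℓ → Polynomial ℂ,
          ∀ i j, (∀ n, DifferentiableOn ℂ (fun d => (c d i j).coeff n) W) ∧
            ∀ d ∈ W, (c d i j).coeff 0 ≠ 0 ∧ ε' d i j = jetSMul (c d i j) (ε d i j)) ∧
      (∀ w, IsRootBranch W w → ∀ ε ε', F.IsEigenframe W ε → F.IsEigenframe W ε' →
        ∀ e e', IsPowerFrame W w ε e → IsPowerFrame W w ε' e' →
          ∀ d ∈ W, matA e d = matA e' d ∧ F.matAlpha e d = F.matAlpha e' d) ∧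
      -- the only ambiguity in `w` is in the choice of the roots
      (IsPreconnected W → ∀ w w', IsRootBranch W w → IsRootBranch W w' →
        ∃ ζ : Fin p → Fin ℓ → ℂ, (∀ i j, ζ i j ^ (k i - 1) = 1) ∧
          ∀ d ∈ W, ∀ i j, w' d i j = ζ i j • w d i j) := by
  refine ⟨F.exists_nhds_choices hk hd₀, fun W hWo hW => ⟨fun w hw => ?_, fun ε hε ε' => ?_,
    fun w hw ε ε' hε hε' e e' he he' d hd => ⟨?_, ?_⟩, fun hWc w w' hw hw' => ?_⟩⟩
  · refine ⟨coordMap w, isLocalCoordinates_coordMap hk hWo hw (m := F.m) fun d hd i =>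
      ((F.mem_regularPoints_iff hk (hW hd).1).1 (hW hd) i).2, fun ε hε =>
      ⟨F.exists_isPowerFrame hk hW hw hε, fun e he =>
        ⟨SystemFamily.differentiableOn_frame hw hε he,
          fun d hd => SystemFamily.matA_eq_normalForm hk hw he hd,
          F.isClosedForm_matAlpha hk hWo hW hw hε he,
          fun d hd I J => F.hasFDerivAt_matA hk hWo hW hw hε he hd I J,
          fun d hd I J => ?_, fun d hd => F.alpha_euler hk (hW hd)⟩⟩⟩
    -- `E(a) = α_E = a`, by `α = da` and `i_E α = a`.
    rw [(F.hasFDerivAt_matA hk hWo hW hw hε he hd I J).fderiv]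
    exact congrFun (congrFun (congrArg (LinearMap.toMatrix (e d) (e d))
      (F.alpha_euler hk (hW hd))) I) J
  · exact ⟨F.exists_jetSMul_of_isEigenframe hk hWo hW hε, fun ⟨c, hc⟩ =>
      F.isEigenframe_of_jetSMul hk hW hε hc⟩
  · rw [SystemFamily.matA_eq_normalForm hk hw he hd, SystemFamily.matA_eq_normalForm hk hw he' hd]
  · funext I J
    refine ContinuousLinearMap.ext fun Y => ?_
    rw [F.matAlpha_apply hk hW hw hε he hd, F.matAlpha_apply hk hW hw hε' he' hd]
  · choose ζ hζ hww using fun i j => hw.exists_eq_smul hk hWc hw' i j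
    exact ⟨ζ, hζ, fun d hd i j => hww i j d hd⟩
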